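/- Work on $\mathbb R^2$ with $\langle x\rangle=\sqrt{1+|x|^2}$, $\hat f(\xi)=\int_{\mathbb R^2}e^{-ix\cdot\xi}f(x)\,dx$, let $\sigma(\nabla)$ denote Fourier multipliers (so $\langle\nabla\rangle$ has symbol $\langle\xi\rangle$), and $\|w\|_{H^k}=\|\langle\nabla\rangle^k w\|_{L^2}$. For a scalar function $u(t,x)$ and a vector field $v(t,x)\in\mathbb C^2$ put $$G_1(u,v)=\nabla\cdot\big((v\cdot\nabla)v+u\nabla u\big)-\partial_t\big(v\cdot\nabla u+u\,\nabla\cdot v\big),$$ $$G_2(u,v)=\nabla\big(v\cdot\nabla u+u\,\nabla\cdot v\big)-\partial_t\big((v\cdot\nabla)v+u\nabla u\big)-\nabla\Delta^{-1}\nabla\cdot(uv).$$ For every integer $m\ge 0$ there is a constant $C$, depending only on $m$, such that the following holds. Let $f_1,g_1:\mathbb R^2\to\mathbb C$ and $f_2,g_2:\mathbb R^2\to\mathbb C^2$ be integrable functions whose Fourier transforms are $C^2$ and satisfy $$N:=\sup_{\xi\in\mathbb R^2}\langle\xi\rangle^{m+24}\sum_{i=1,2}\ \sum_{|\alpha|\le2}\big(|\partial_\xi^\alpha\hat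 f_i(\xi)|+|\partial_\xi^\alpha\hat g_i(\xi)|\big)<\infty .$$ Let $h_i(t)=\cos(t\langle\nabla\rangle)f_i+\frac{\sin(t\langle\nabla\rangle)}{\langle\nabla\rangle}g_i$ for $i=1,2$ be the linear Klein--Gordon solutions with these data. Then, for every $t\in\mathbb R$ and $i=1,2$, $G_i(h_1,h_2)(s)\in L^2$ for all $s$, the Duhamel integral from infinity $$\Phi_i(t)=\int_\infty^t\frac{\sin((t-s)\langle\nabla\rangle)}{\langle\nabla\rangle}\,G_i(h_1,h_2)(s)\,ds:=\lim_{T\to\infty}\int_T^t\frac{\sin((t-s)\langle\nabla\rangle)}{\langle\nabla\rangle}\,G_i(h_1,h_2)(s)\,ds$$ exists as a limit in $L^2$ of $L^2$-valued integrals, $\Phi_i$ is differentiable in $t$ with values in $L^2$, and $$\langle t\rangle\big(\|\Phi_i(t)\|_{H^{m+2}}+\|\partial_t\Phi_i(t)\|_{H^{m+2}}\big)\le C\,N^2 .$$ -/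

import Mathlib

open MeasureTheory Filter Topology
open scoped FourierTransform ENNReal NNReal

noncomputable section

namespace EulerPoisson

/-- The plane `ℝ²` with its Euclidean norm. -/
abbrev Plane : Type := EuclideanSpace ℝ (Fin 2)

/-- Values of vector fields, with the Euclidean norm. -/
abbrev Vec : Type := EuclideanSpace ℂ (Fin 2)

/-- Complex-valued square-integrable functions on the plane. -/
abbrev L2Scalar : Type := Lp (α := Plane) ℂ 2

/-- Square-integrable vector fields on the plane. -/
abbrev L2Vec : Type := Lp (α := Plane) Vec 2

/-- The Japanese bracket `⟨x⟩ = √(1 + |x|²)`. -/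
def bracket {W : Type*} [NormedAddCommGroup W] (x : W) : ℝ := √(1 + ‖x‖ ^ 2)

section General

variable {F : Type*} [NormedAddCommGroup F] [InnerProductSpace ℂ F] [CompleteSpace F]

/-- The partial derivative `∂_j`. -/
def pd (j : Fin 2) (w : Plane → F) (x : Plane) : F :=
  fderiv ℝ w x (EuclideanSpace.single j 1)

/-- The Fourier transform in angular frequency, `f̂(ξ) = ∫ e^{-i x·ξ} f(x) dx`.
Mathlib's transform is `𝓕 f ζ = ∫ e^{-2πi x·ζ} f(x) dx`. -/
def hat (f : Plane → F) (ξ : Plane) : F := 𝓕 f ((2 * Real.pi)⁻¹ • ξ)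

/-- The operator `σ(∇/i)` on integrable functions `f` whose transform is integrable against `σ`,
evaluated pointwise; the symbol `σ` is a function of the angular frequency. -/
def multiplier (σ : Plane → ℝ) (f : Plane → F) : Plane → F :=
  𝓕⁻ (fun ζ : Plane => (σ ((2 * Real.pi) • ζ) : ℂ) • 𝓕 f ζ)

/-- The linear Klein–Gordon solution `cos(t⟨∇⟩) f + (sin(t⟨∇⟩)/⟨∇⟩) g`. -/
def linearSol (f g : Plane → F) (t : ℝ) (x : Plane) : F :=
  multiplier (fun ξ => Real.cos (t * bracket ξ)) f x
    + multiplier (fun ξ => Real.sin (t * bracket ξ) / bracket ξ) g x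

open Classical in
/-- The class in `L²` of a square-integrable function (and `0` for other functions). -/
def toL2 (f : Plane → F) : Lp (α := Plane) F 2 :=
  if h : MemLp f 2 (volume : Measure Plane) then h.toLp f else 0

/-- The Fourier multiplier on `L²` with the bounded (possibly matrix-valued) symbol `M`, a function
of the angular frequency. The Fourier transform here is the one on `L²`. -/
def l2Multiplier (M : Plane → F → F) (u : Lp (α := Plane) F 2) : Lp (α := Plane) F 2 :=
  𝓕⁻ (toL2 (fun ζ : Plane => M ((2 * Real.pi) • ζ) ((𝓕 u : Lp F 2 (volume : Measure Plane)) ζ)))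

/-- The Klein–Gordon propagator `sin(t⟨∇⟩)/⟨∇⟩` on `L²`. -/
def propagator (t : ℝ) : Lp (α := Plane) F 2 → Lp (α := Plane) F 2 :=
  l2Multiplier (fun ξ v => ((Real.sin (t * bracket ξ) / bracket ξ : ℝ) : ℂ) • v)

/-- The norm of the Sobolev space `H^k`, namely `‖⟨∇⟩^k u‖_{L²}`; it is `∞` off `H^k`. -/
def sobolevNorm (k : ℕ) (u : Lp (α := Plane) F 2) : ℝ≥0∞ :=
  eLpNorm (fun ζ : Plane =>
    (bracket ((2 * Real.pi) • ζ) ^ k : ℝ) • (𝓕 u : Lp F 2 (volume : Measure Plane)) ζ) 2 volume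

/-- The Duhamel integral `∫_T^t (sin((t-s)⟨∇⟩)/⟨∇⟩) G(s) ds`, as an integral in `L²`. -/
def duhamel (G : ℝ → Lp (α := Plane) F 2) (T t : ℝ) : Lp (α := Plane) F 2 :=
  ∫ s in T..t, propagator (t - s) (G s)

/-- The Duhamel integral from infinity, `lim_{T → ∞} ∫_T^t (sin((t-s)⟨∇⟩)/⟨∇⟩) G(s) ds`. -/
def duhamelInfty (G : ℝ → Lp (α := Plane) F 2) (t : ℝ) : Lp (α := Plane) F 2 :=
  limUnder atTop (fun T : ℝ => duhamel G T t)

/-- `∑_{|α| ≤ 2} |∂^α w(ξ)|`, the sum over multi-indices `α` in two variables. -/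
def jetSum (w : Plane → F) (ξ : Plane) : ℝ :=
  ∑ k ∈ Finset.range 3, ∑ α ∈ Finset.HasAntidiagonal.antidiagonal k, ‖((pd 0)^[α.1] ((pd 1)^[α.2] w)) ξ‖

/-- `(v · ∇) w`. -/
def advect (v : Plane → Vec) (w : Plane → F) (x : Plane) : F := ∑ k, v x k • pd k w x

end General

/-- The gradient of a scalar function. -/
def grad (u : Plane → ℂ) (x : Plane) : Vec := WithLp.toLp 2 (fun j => pd j u x)

/-- The divergence of a vector field. -/
def divergence (v : Plane → Vec) (x : Plane) : ℂ := ∑ j, pd j v x j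

/-- `(v · ∇) v + u ∇u`. -/
def momentumFlux (u : Plane → ℂ) (v : Plane → Vec) (x : Plane) : Vec :=
  advect v v x + u x • grad u x

/-- `v · ∇u + u ∇ · v`. -/
def massFlux (u : Plane → ℂ) (v : Plane → Vec) (x : Plane) : ℂ :=
  advect v u x + u x * divergence v x

/-- The nonlinearity `G₁(u,v) = ∇·((v·∇)v + u∇u) - ∂_t(v·∇u + u∇·v)`. -/
def G₁ (u : ℝ → Plane → ℂ) (v : ℝ → Plane → Vec) (t : ℝ) (x : Plane) : ℂ :=
  divergence (momentumFlux (u t) (v t)) x - deriv (fun s => massFlux (u s) (v s) x) t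

/-- The local part `∇(v·∇u + u∇·v) - ∂_t((v·∇)v + u∇u)` of `G₂(u,v)`. -/
def G₂local (u : ℝ → Plane → ℂ) (v : ℝ → Plane → Vec) (t : ℝ) (x : Plane) : Vec :=
  grad (massFlux (u t) (v t)) x - deriv (fun s => momentumFlux (u s) (v s) x) t

/-- The operator `∇ Δ⁻¹ ∇·` on `L²` vector fields: its symbol sends `v` to
`(iξ) (-|ξ|²)⁻¹ (iξ · v)`. -/
def gradInvLapDiv : L2Vec → L2Vec :=
  l2Multiplier (fun ξ v => WithLp.toLp 2 (fun j =>
    (Complex.I * (ξ j : ℂ)) * (-((‖ξ‖ : ℂ) ^ 2))⁻¹ * ∑ k, (Complex.I * (ξ k : ℂ)) * v k))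

/-- `G₁(u,v)(t)` as an element of `L²`. -/
def G₁L2 (u : ℝ → Plane → ℂ) (v : ℝ → Plane → Vec) (t : ℝ) : L2Scalar := toL2 (G₁ u v t)

/-- `G₂(u,v)(t) = ∇(v·∇u + u∇·v) - ∂_t((v·∇)v + u∇u) - ∇Δ⁻¹∇·(uv)` as an element of `L²`. -/
def G₂L2 (u : ℝ → Plane → ℂ) (v : ℝ → Plane → Vec) (t : ℝ) : L2Vec :=
  toL2 (G₂local u v t) - gradInvLapDiv (toL2 (fun x => u t x • v t x))

/-- The resonant part `Φ₁` for the final data `(f₁,g₁,f₂,g₂)`. -/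
def Φ₁ (f₁ g₁ : Plane → ℂ) (f₂ g₂ : Plane → Vec) : ℝ → L2Scalar :=
  duhamelInfty (G₁L2 (linearSol f₁ g₁) (linearSol f₂ g₂))

/-- The resonant part `Φ₂` for the final data `(f₁,g₁,f₂,g₂)`. -/
def Φ₂ (f₁ g₁ : Plane → ℂ) (f₂ g₂ : Plane → Vec) : ℝ → L2Vec :=
  duhamelInfty (G₂L2 (linearSol f₁ g₁) (linearSol f₂ g₂))

/-- `sup_ξ ⟨ξ⟩^{m+24} ∑_{|α| ≤ 2, i = 1,2} (|∂^α f̂_i(ξ)| + |∂^α ĝ_i(ξ)|)`, possibly infinite. -/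
def dataNorm (m : ℕ) (f₁ g₁ : Plane → ℂ) (f₂ g₂ : Plane → Vec) : ℝ≥0∞ :=
  ⨆ ξ : Plane, ENNReal.ofReal (bracket ξ ^ (m + 24) *
    (jetSum (hat f₁) ξ + jetSum (hat f₂) ξ + jetSum (hat g₁) ξ + jetSum (hat g₂) ξ))

end EulerPoisson

end

open EulerPoisson

/-!
On the Fourier side a product of two half waves is `g t ξ = ∫ exp (i t φ) a(η) b(ξ - η) dη` with
phase `φ = ε⟨η⟩ + ε'⟨ξ - η⟩`. There is no time resonance: `⟨ξ⟩² - φ²` never vanishes, so dividing the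
integrand by it gives an explicit solution `Q` of the oscillator equation `Q'' + ⟨ξ⟩² Q = g`, and
since `Q` and `Q'` decay in time, `Q` is the Duhamel integral of `g` from infinity.

The decay `⟨t⟩⁻¹` in `L²` comes from integrating by parts in `η`. When the signs are opposite, `φ` is
stationary only at `ξ = 0`, with gradient comparable to `|ξ|` up to powers of the brackets, and two
integrations by parts give `⟨tξ⟩⁻²`, whose `L²` norm in the plane is `O(⟨t⟩⁻¹)`. When the signs agree,
`φ` is stationary at `η = ξ / 2`, where a radial integration by parts in polar coordinates gives
`⟨t⟩⁻¹` pointwise.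
-/

open MeasureTheory Filter Topology

open scoped FourierTransform ENNReal NNReal Convolution

noncomputable section

namespace EulerPoisson

section L2Functions

variable {F : Type*} [NormedAddCommGroup F]

theorem toL2_of_memLp {a : Plane → F} (h : MemLp a 2 volume) : toL2 a = h.toLp a := by
  rw [toL2, dif_pos h]

theorem coeFn_toL2 {a : Plane → F} (h : MemLp a 2 volume) : toL2 a =ᵐ[volume] a := by
  rw [toL2_of_memLp h]
  exact h.coeFn_toLp

theorem toL2_congr {a b : Plane → F} (h : a =ᵐ[volume] b) : toL2 a = toL2 b := by
  by_cases ha : MemLp a 2 volume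
  · rw [toL2_of_memLp ha, toL2_of_memLp ((memLp_congr_ae h).1 ha)]
    exact MemLp.toLp_congr _ _ h
  · rw [toL2, toL2, dif_neg ha, dif_neg fun hb => ha ((memLp_congr_ae h).2 hb)]

theorem toL2_add {a b : Plane → F} (ha : MemLp a 2 volume) (hb : MemLp b 2 volume) :
    toL2 (fun x => a x + b x) = toL2 a + toL2 b := by
  rw [toL2_of_memLp ha, toL2_of_memLp hb, ← MemLp.toLp_add ha hb]
  exact toL2_of_memLp (ha.add hb)

theorem toL2_neg {a : Plane → F} (ha : MemLp a 2 volume) : toL2 (fun x => -a x) = -toL2 a := by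
  rw [toL2_of_memLp ha, ← MemLp.toLp_neg ha]
  exact toL2_of_memLp ha.neg

theorem toL2_sub {a b : Plane → F} (ha : MemLp a 2 volume) (hb : MemLp b 2 volume) :
    toL2 (fun x => a x - b x) = toL2 a - toL2 b := by
  simp only [sub_eq_add_neg]
  rw [← toL2_neg hb]
  exact toL2_add ha hb.neg

theorem toL2_const_smul {𝕜 : Type*} [NormedRing 𝕜] [Module 𝕜 F] [IsBoundedSMul 𝕜 F] (c : 𝕜)
    {a : Plane → F} (ha : MemLp a 2 volume) : toL2 (fun x => c • a x) = c • toL2 a := by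
  rw [toL2_of_memLp ha, ← MemLp.toLp_const_smul c ha]
  exact toL2_of_memLp (ha.const_smul c)

theorem enorm_toL2 {a : Plane → F} (h : MemLp a 2 volume) : ‖toL2 a‖ₑ = eLpNorm a 2 volume := by
  rw [toL2_of_memLp h, Lp.enorm_toLp]

theorem norm_toL2_le {a : Plane → F} {W : Plane → ℝ} (ha : MemLp a 2 volume)
    (hW : MemLp W 2 volume) {c : ℝ} (hc : 0 ≤ c) (h : ∀ x, ‖a x‖ ≤ c * W x) :
    ‖toL2 a‖ ≤ c * (eLpNorm W 2 volume).toReal := by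
  have hle : eLpNorm a 2 volume ≤ ENNReal.ofReal c * eLpNorm W 2 volume :=
    eLpNorm_le_mul_eLpNorm_of_ae_le_mul (Eventually.of_forall fun x =>
      (h x).trans (mul_le_mul_of_nonneg_left (Real.le_norm_self _) hc)) 2
  rw [toL2_of_memLp ha, Lp.norm_toLp]
  simpa only [ENNReal.toReal_mul, ENNReal.toReal_ofReal hc] using
    ENNReal.toReal_mono (ENNReal.mul_lt_top ENNReal.ofReal_lt_top hW.2).ne hle

theorem continuous_toL2 {k : ℝ → Plane → F} {W : Plane → ℝ} (hW : MemLp W 2 volume)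
    (hk : ∀ s, MemLp (k s) 2 volume) (hlip : ∀ s r x, ‖k s x - k r x‖ ≤ |s - r| * W x) :
    Continuous fun s => toL2 (k s) := by
  refine (LipschitzWith.of_dist_le_mul (K := (eLpNorm W 2 volume).toNNReal)
    fun s r => ?_).continuous
  rw [dist_eq_norm, ← toL2_sub (hk s) (hk r), Real.dist_eq, mul_comm]
  exact norm_toL2_le ((hk s).sub (hk r)) hW (abs_nonneg _) (hlip s r)

variable [NormedSpace ℝ F]

theorem norm_sub_sub_smul_le_of_lipschitz_deriv {f f' : ℝ → F} {C : ℝ}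
    (hf : ∀ s, HasDerivAt f (f' s) s) (hlip : ∀ s r, ‖f' s - f' r‖ ≤ |s - r| * C) (s r : ℝ) :
    ‖f r - f s - (r - s) • f' s‖ ≤ |r - s| ^ 2 * C := by
  have hC : 0 ≤ C := by simpa using (norm_nonneg _).trans (hlip 1 0)
  have hderiv (y : ℝ) : HasDerivAt (fun y => f y - (y - s) • f' s) (f' y - f' s) y := by
    have hlinear := ((hasDerivAt_id y).sub_const s).smul_const (f' s)
    rw [one_smul] at hlinear
    exact (hf y).sub hlinear
  have hmean := (convex_uIcc s r).norm_image_sub_le_of_norm_hasDerivWithin_le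
    (fun y _ => (hderiv y).hasDerivWithinAt)
    (fun y hy => (hlip y s).trans (mul_le_mul_of_nonneg_right (Set.abs_sub_left_of_mem_uIcc hy) hC))
    Set.left_mem_uIcc Set.right_mem_uIcc
  simp only [sub_self, zero_smul, sub_zero, Real.norm_eq_abs] at hmean
  rw [sub_right_comm]
  exact hmean.trans_eq (by ring)

theorem hasDerivAt_toL2 {k k' : ℝ → Plane → F} {W : Plane → ℝ} (hW : MemLp W 2 volume)
    (hk : ∀ s, MemLp (k s) 2 volume) (hk' : ∀ s, MemLp (k' s) 2 volume)
    (hderiv : ∀ s x, HasDerivAt (fun s => k s x) (k' s x) s)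
    (hlip : ∀ s r x, ‖k' s x - k' r x‖ ≤ |s - r| * W x) (s : ℝ) :
    HasDerivAt (fun s => toL2 (k s)) (toL2 (k' s)) s := by
  have hquadratic : (fun r => toL2 (k r) - toL2 (k s) - (r - s) • toL2 (k' s))
      =O[𝓝 s] fun r => (r - s) ^ 2 := by
    refine .of_bound (eLpNorm W 2 volume).toReal (Eventually.of_forall fun r => ?_)
    have hdiff : MemLp (fun x => k r x - k s x) 2 volume := (hk r).sub (hk s)
    have hsmul : MemLp (fun x => (r - s) • k' s x) 2 volume := (hk' s).const_smul _
    rw [← toL2_const_smul _ (hk' s), ← toL2_sub (hk r) (hk s), ← toL2_sub hdiff hsmul,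
      Real.norm_eq_abs, abs_pow, mul_comm]
    exact norm_toL2_le (hdiff.sub hsmul) hW (by positivity) fun x =>
      norm_sub_sub_smul_le_of_lipschitz_deriv (hderiv · x) (hlip · · x) s r
  rw [hasDerivAt_iff_isLittleO]
  exact hquadratic.trans_isLittleO <| (Asymptotics.isLittleO_pow_id one_lt_two).comp_tendsto
    (tendsto_sub_nhds_zero_iff.2 tendsto_id)

end L2Functions

section FourierL2

variable {V : Type*} [NormedAddCommGroup V] [InnerProductSpace ℝ V] [FiniteDimensional ℝ V]
  [MeasurableSpace V] [BorelSpace V]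

theorem continuous_fourierInv {F : Type*} [NormedAddCommGroup F] [NormedSpace ℂ F] {a : V → F}
    (ha : Integrable a) : Continuous (𝓕⁻ a) :=
  VectorFourier.fourierIntegral_continuous (L := -innerₗ V) Real.continuous_fourierChar
    (by simp only [LinearMap.neg_apply, innerₗ_apply_apply]; fun_prop) ha

theorem integral_fourierInv_smul_eq {F : Type*} [NormedAddCommGroup F] [NormedSpace ℂ F]
    [CompleteSpace F] {φ : V → ℂ} {a : V → F} (hφ : Integrable φ) (ha : Integrable a) :
    ∫ ξ, 𝓕⁻ φ ξ • a ξ = ∫ x, φ x • 𝓕⁻ a x := by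
  have hflip : (-innerₗ V).flip = -innerₗ V := by
    ext x y
    simp [real_inner_comm]
  have h := VectorFourier.integral_fourierIntegral_smul_eq_flip (μ := (volume : Measure V))
    (ν := (volume : Measure V)) (L := -innerₗ V) Real.continuous_fourierChar
    (by simp only [LinearMap.neg_apply, innerₗ_apply_apply]; fun_prop) hφ ha
  rwa [hflip] at h

variable {F : Type*} [NormedAddCommGroup F] [InnerProductSpace ℂ F] [CompleteSpace F]

/- The two transforms agree as tempered distributions: they have the same integral against every
test function. -/
theorem fourierInv_toLp_ae_eq {a : V → F} (h1 : Integrable a) (h2 : MemLp a 2 volume) :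
    (𝓕⁻ (h2.toLp a) : Lp F 2 (volume : Measure V)) =ᵐ[volume] 𝓕⁻ a := by
  refine ae_eq_of_integral_contDiff_smul_eq ((Lp.memLp _).locallyIntegrable (by norm_num))
    (continuous_fourierInv h1).locallyIntegrable fun g hg hg_supp => ?_
  have hg_smooth : ContDiff ℝ ((⊤ : ℕ∞) : WithTop ℕ∞) fun x => (g x : ℂ) :=
    Complex.ofRealCLM.contDiff.comp hg
  have hg_supp : HasCompactSupport fun x => (g x : ℂ) :=
    hg_supp.comp_left (g := fun r : ℝ => (r : ℂ)) rfl
  let φ : SchwartzMap V ℂ := hg_supp.toSchwartzMap hg_smooth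
  have hpairing := congrArg (· φ) (Lp.fourierInv_toTemperedDistribution_eq (h2.toLp a))
  simp only [TemperedDistribution.fourierInv_apply, Lp.toTemperedDistribution_apply] at hpairing
  have hpairing' : ∫ x, (𝓕⁻ φ : SchwartzMap V ℂ) x • (h2.toLp a) x = ∫ x, φ x • 𝓕⁻ a x := by
    rw [← integral_fourierInv_smul_eq φ.integrable h1]
    refine integral_congr_ae ?_
    filter_upwards [h2.coeFn_toLp] with x hx
    rw [hx, SchwartzMap.fourierInv_coe]
  rw [hpairing'] at hpairing
  exact hpairing.symm

theorem memLp_fourierInv {a : V → F} (h1 : Integrable a) (h2 : MemLp a 2 volume) :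
    MemLp (𝓕⁻ a) 2 volume :=
  (memLp_congr_ae (fourierInv_toLp_ae_eq h1 h2)).1 (Lp.memLp _)

theorem toL2_fourierInv {a : Plane → F} (h1 : Integrable a) (h2 : MemLp a 2 volume) :
    toL2 (𝓕⁻ a) = 𝓕⁻ (toL2 a) := by
  rw [toL2_of_memLp (memLp_fourierInv h1 h2), toL2_of_memLp h2]
  exact Lp.ext ((MemLp.coeFn_toLp _).trans (fourierInv_toLp_ae_eq h1 h2).symm)

end FourierL2

section Scaling

variable {V : Type*} [NormedAddCommGroup V] [NormedSpace ℝ V] [FiniteDimensional ℝ V]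
  [MeasurableSpace V] [BorelSpace V] (μ : Measure V) [μ.IsAddHaarMeasure]
  {F : Type*} [NormedAddCommGroup F]

theorem eLpNorm_comp_smul (f : V → F) {r : ℝ} (hr : r ≠ 0) {p : ℝ≥0∞} :
    eLpNorm (fun x => f (r • x)) p μ
      = ENNReal.ofReal |(r ^ Module.finrank ℝ V)⁻¹| ^ (1 / p).toReal * eLpNorm f p μ := by
  have hemb : MeasurableEmbedding fun x : V => r • x :=
    (Homeomorph.smulOfNeZero r hr).measurableEmbedding
  rw [← smul_eq_mul, ← eLpNorm_smul_measure_of_ne_zero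
      (ENNReal.ofReal_pos.2 (abs_pos.2 (inv_ne_zero (pow_ne_zero _ hr)))).ne',
    ← Measure.map_addHaar_smul μ hr, hemb.eLpNorm_map_measure]
  rfl

theorem memLp_comp_smul {f : V → F} {r : ℝ} (hr : r ≠ 0) {p : ℝ≥0∞} (hf : MemLp f p μ) :
    MemLp (fun x => f (r • x)) p μ := by
  refine ⟨hf.1.comp_quasiMeasurePreserving ⟨by fun_prop, ?_⟩, ?_⟩
  · rw [Measure.map_addHaar_smul μ hr]
    exact Measure.smul_absolutelyContinuous
  · rw [eLpNorm_comp_smul μ f hr]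
    exact ENNReal.mul_lt_top (ENNReal.rpow_lt_top_of_nonneg ENNReal.toReal_nonneg
      ENNReal.ofReal_ne_top) hf.2

theorem eLpNorm_two_comp_smul (f : Plane → F) {r : ℝ} (hr : 0 < r) :
    eLpNorm (fun x => f (r • x)) 2 volume = ENNReal.ofReal r⁻¹ * eLpNorm f 2 volume := by
  rw [eLpNorm_comp_smul volume f hr.ne', finrank_euclideanSpace_fin, ← inv_pow,
    abs_of_nonneg (by positivity), ENNReal.ofReal_pow (by positivity), ← ENNReal.rpow_natCast,
    ← ENNReal.rpow_mul]
  norm_num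

end Scaling

section Bracket

variable {W : Type*} [NormedAddCommGroup W]

theorem bracket_sq (x : W) : bracket x ^ 2 = 1 + ‖x‖ ^ 2 := Real.sq_sqrt (by positivity)

theorem one_le_bracket (x : W) : 1 ≤ bracket x :=
  Real.one_le_sqrt.2 (le_add_of_nonneg_right (sq_nonneg _))

theorem bracket_pos (x : W) : 0 < bracket x := one_pos.trans_le (one_le_bracket x)

theorem norm_le_bracket (x : W) : ‖x‖ ≤ bracket x :=
  Real.le_sqrt_of_sq_le (le_add_of_nonneg_left zero_le_one)

theorem bracket_le_bracket {W' : Type*} [NormedAddCommGroup W'] {x : W} {y : W'}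
    (h : ‖x‖ ≤ ‖y‖) : bracket x ≤ bracket y := by
  unfold bracket
  gcongr

theorem continuous_bracket : Continuous (bracket : W → ℝ) := by
  unfold bracket
  fun_prop

theorem continuous_inv_bracket_pow (k : ℕ) : Continuous fun x : W => (bracket x ^ k)⁻¹ :=
  (continuous_bracket.pow k).inv₀ fun x => (pow_pos (bracket_pos x) k).ne'

theorem tendsto_inv_bracket_atTop : Tendsto (fun t : ℝ => (bracket t)⁻¹) atTop (𝓝 0) :=
  (tendsto_atTop_mono (fun t => (le_abs_self t).trans (norm_le_bracket t))
    tendsto_id).inv_tendsto_atTop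

variable {V : Type*} [NormedAddCommGroup V] [NormedSpace ℝ V] [FiniteDimensional ℝ V]
  [MeasurableSpace V] [BorelSpace V] {μ : Measure V} [μ.IsAddHaarMeasure]

theorem integrable_inv_bracket_pow {k : ℕ} (hk : Module.finrank ℝ V < k) :
    Integrable (fun ξ : V => (bracket ξ ^ k)⁻¹) μ := by
  refine (integrable_rpow_neg_one_add_norm_sq (μ := μ) (Nat.cast_lt.2 hk)).congr
    (Eventually.of_forall fun x => ?_)
  have hx : (0 : ℝ) ≤ 1 + ‖x‖ ^ 2 := by positivity
  simp only [bracket, Real.sqrt_eq_rpow]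
  rw [← Real.rpow_natCast _ k, ← Real.rpow_mul hx, ← Real.rpow_neg hx]
  ring_nf

theorem memLp_inv_bracket_pow {k : ℕ} (hk : Module.finrank ℝ V < 2 * k) :
    MemLp (fun ξ : V => (bracket ξ ^ k)⁻¹) 2 μ := by
  rw [memLp_two_iff_integrable_sq (continuous_inv_bracket_pow k).aestronglyMeasurable]
  simpa only [inv_pow, ← pow_mul, mul_comm] using integrable_inv_bracket_pow (μ := μ) hk

theorem memLp_inv_bracket_sq : MemLp (fun ξ : Plane => (bracket ξ ^ 2)⁻¹) 2 volume :=
  memLp_inv_bracket_pow (by simp)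

theorem memLp_of_norm_le_inv_bracket_sq {F : Type*} [NormedAddCommGroup F] {a : Plane → F}
    (ha : StronglyMeasurable a) {B : ℝ} (h : ∀ ξ, ‖a ξ‖ ≤ B * (bracket ξ ^ 2)⁻¹) :
    MemLp a 2 volume :=
  (memLp_inv_bracket_sq.const_mul B).mono' ha.aestronglyMeasurable (Eventually.of_forall h)

end Bracket

section InverseHat

/-- The inverse Fourier transform in angular frequency, `∫ e^{i x·ξ} a(ξ) dξ / (2π)²`. -/
def invHat {F : Type*} [NormedAddCommGroup F] [NormedSpace ℂ F] (a : Plane → F) : Plane → F :=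
  𝓕⁻ fun ζ : Plane => a ((2 * Real.pi) • ζ)

variable {F : Type*} [NormedAddCommGroup F] [InnerProductSpace ℂ F] [CompleteSpace F]

/-- The inverse Fourier transform in angular frequency of a square-integrable function, as an
element of `L²` (and `0` if the function is not square-integrable). -/
def l2InvHat (a : Plane → F) : Lp (α := Plane) F 2 :=
  𝓕⁻ (toL2 fun ζ : Plane => a ((2 * Real.pi) • ζ))

theorem memLp_comp_two_pi_smul {E : Type*} [NormedAddCommGroup E] {a : Plane → E}
    (ha : MemLp a 2 volume) : MemLp (fun ζ => a ((2 * Real.pi) • ζ)) 2 volume :=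
  memLp_comp_smul volume Real.two_pi_pos.ne' ha

theorem eLpNorm_comp_two_pi_smul_le {E : Type*} [NormedAddCommGroup E] (a : Plane → E) :
    eLpNorm (fun ζ => a ((2 * Real.pi) • ζ)) 2 volume ≤ eLpNorm a 2 volume := by
  rw [eLpNorm_two_comp_smul a Real.two_pi_pos]
  exact mul_le_of_le_one_left zero_le
    (ENNReal.ofReal_le_one.2 (inv_le_one_of_one_le₀ (by linarith [Real.pi_gt_three])))

theorem memLp_invHat {a : Plane → F} (h1 : Integrable a) (h2 : MemLp a 2 volume) :
    MemLp (invHat a) 2 volume :=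
  memLp_fourierInv (h1.comp_smul Real.two_pi_pos.ne') (memLp_comp_two_pi_smul h2)

theorem toL2_invHat {a : Plane → F} (h1 : Integrable a) (h2 : MemLp a 2 volume) :
    toL2 (invHat a) = l2InvHat a :=
  toL2_fourierInv (h1.comp_smul Real.two_pi_pos.ne') (memLp_comp_two_pi_smul h2)

theorem l2InvHat_add {a b : Plane → F} (ha : MemLp a 2 volume) (hb : MemLp b 2 volume) :
    l2InvHat (fun ξ => a ξ + b ξ) = l2InvHat a + l2InvHat b := by
  rw [l2InvHat, toL2_add (memLp_comp_two_pi_smul ha) (memLp_comp_two_pi_smul hb),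
    FourierTransform.fourierInv_add, ← l2InvHat, ← l2InvHat]

theorem l2InvHat_neg {a : Plane → F} (ha : MemLp a 2 volume) :
    l2InvHat (fun ξ => -a ξ) = -l2InvHat a := by
  rw [l2InvHat, toL2_neg (memLp_comp_two_pi_smul ha), FourierTransform.fourierInv_neg, ← l2InvHat]

theorem enorm_l2InvHat_le {a : Plane → F} (ha : MemLp a 2 volume) :
    ‖l2InvHat a‖ₑ ≤ eLpNorm a 2 volume := by
  have hplancherel : ‖l2InvHat a‖ = ‖toL2 fun ζ : Plane => a ((2 * Real.pi) • ζ)‖ :=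
    (Lp.fourierTransformₗᵢ Plane F).symm.norm_map _
  rw [← ofReal_norm, hplancherel, ofReal_norm, enorm_toL2 (memLp_comp_two_pi_smul ha)]
  exact eLpNorm_comp_two_pi_smul_le a

theorem continuous_l2InvHat {k : ℝ → Plane → F} {W : Plane → ℝ} (hW : MemLp W 2 volume)
    (hk : ∀ s, MemLp (k s) 2 volume) (hlip : ∀ s r x, ‖k s x - k r x‖ ≤ |s - r| * W x) :
    Continuous fun s => l2InvHat (k s) :=
  (FourierTransform.fourierInvCLM ℂ (Lp (α := Plane) F 2)).continuous.comp
    (continuous_toL2 (memLp_comp_two_pi_smul hW) (fun s => memLp_comp_two_pi_smul (hk s))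
      fun s r _ => hlip s r _)

theorem hasDerivAt_l2InvHat {k k' : ℝ → Plane → F} {W : Plane → ℝ} (hW : MemLp W 2 volume)
    (hk : ∀ s, MemLp (k s) 2 volume) (hk' : ∀ s, MemLp (k' s) 2 volume)
    (hderiv : ∀ s x, HasDerivAt (fun s => k s x) (k' s x) s)
    (hlip : ∀ s r x, ‖k' s x - k' r x‖ ≤ |s - r| * W x) (s : ℝ) :
    HasDerivAt (fun s => l2InvHat (k s)) (l2InvHat (k' s)) s :=
  ((FourierTransform.fourierInvCLM ℂ (Lp F 2 (volume : Measure Plane)) (F := Lp F 2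
    (volume : Measure Plane))).restrictScalars ℝ).hasFDerivAt.comp_hasDerivAt s
    (hasDerivAt_toL2 (memLp_comp_two_pi_smul hW) (fun s => memLp_comp_two_pi_smul (hk s))
      (fun s => memLp_comp_two_pi_smul (hk' s)) (fun s _ => hderiv s _) (fun s r _ => hlip s r _) s)

theorem l2Multiplier_l2InvHat (M : Plane → F → F) {a : Plane → F} (ha : MemLp a 2 volume) :
    l2Multiplier M (l2InvHat a) = l2InvHat fun ξ => M ξ (a ξ) := by
  rw [l2Multiplier, l2InvHat, FourierTransform.fourier_fourierInv_eq, l2InvHat]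
  congr 1
  refine toL2_congr ?_
  filter_upwards [coeFn_toL2 (memLp_comp_two_pi_smul ha)] with ζ hζ
  rw [hζ]

theorem sobolevNorm_l2InvHat_le (k : ℕ) {a : Plane → F} (ha : MemLp a 2 volume) :
    sobolevNorm k (l2InvHat a) ≤ eLpNorm (fun ξ => bracket ξ ^ k • a ξ) 2 volume := by
  refine le_trans (le_of_eq ?_) (eLpNorm_comp_two_pi_smul_le fun ξ => bracket ξ ^ k • a ξ)
  rw [sobolevNorm, l2InvHat, FourierTransform.fourier_fourierInv_eq]
  refine eLpNorm_congr_ae ?_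
  filter_upwards [coeFn_toL2 (memLp_comp_two_pi_smul ha)] with ζ hζ
  rw [hζ]

end InverseHat

section DecayWeight

/-- A profile of frequency decay whose `L²` norm in `ξ` is of size `⟨s⟩⁻¹`. -/
def decayWeight (s : ℝ) (ξ : Plane) : ℝ :=
  (bracket s)⁻¹ * (bracket ξ ^ 2)⁻¹ + (bracket (bracket s • ξ) ^ 2)⁻¹

/-- The `L²` norm of `⟨ξ⟩⁻²`. -/
def bracketMass : ℝ≥0∞ := eLpNorm (fun ξ : Plane => (bracket ξ ^ 2)⁻¹) 2 volume

theorem bracketMass_lt_top : bracketMass < ∞ := memLp_inv_bracket_sq.2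

theorem decayWeight_nonneg (s : ℝ) (ξ : Plane) : 0 ≤ decayWeight s ξ := by
  have hs := bracket_pos s
  unfold decayWeight
  positivity

theorem decayWeight_le (s : ℝ) (ξ : Plane) : decayWeight s ξ ≤ 2 * (bracket ξ ^ 2)⁻¹ := by
  have hs := one_le_bracket s
  have hξ := bracket_pos ξ
  have hdilate : bracket ξ ≤ bracket (bracket s • ξ) := bracket_le_bracket <| by
    rw [norm_smul, Real.norm_of_nonneg (bracket_pos s).le]
    exact le_mul_of_one_le_left (norm_nonneg _) hs
  have hfirst : (bracket s)⁻¹ * (bracket ξ ^ 2)⁻¹ ≤ (bracket ξ ^ 2)⁻¹ :=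
    mul_le_of_le_one_left (by positivity) (inv_le_one_of_one_le₀ hs)
  have hsecond : (bracket (bracket s • ξ) ^ 2)⁻¹ ≤ (bracket ξ ^ 2)⁻¹ := by gcongr
  rw [decayWeight, two_mul]
  exact add_le_add hfirst hsecond

theorem eLpNorm_decayWeight_le (s : ℝ) :
    eLpNorm (decayWeight s) 2 volume ≤ 2 * (ENNReal.ofReal (bracket s)⁻¹ * bracketMass) := by
  have hsum : decayWeight s = (bracket s)⁻¹ • (fun ξ : Plane => (bracket ξ ^ 2)⁻¹)
      + fun ξ : Plane => (bracket (bracket s • ξ) ^ 2)⁻¹ := rfl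
  rw [hsum]
  refine (eLpNorm_add_le (memLp_inv_bracket_sq.1.const_smul _)
    (memLp_comp_smul volume (bracket_pos s).ne' memLp_inv_bracket_sq).1 one_le_two).trans_eq ?_
  rw [eLpNorm_const_smul, Real.enorm_of_nonneg (inv_nonneg.2 (bracket_pos s).le),
    eLpNorm_two_comp_smul (fun ξ : Plane => (bracket ξ ^ 2)⁻¹) (bracket_pos s), two_mul,
    bracketMass]

theorem eLpNorm_le_of_norm_le_decayWeight {F : Type*} [NormedAddCommGroup F] {a : Plane → F}
    {D s : ℝ} (hD : 0 ≤ D) (h : ∀ ξ, ‖a ξ‖ ≤ D * decayWeight s ξ) :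
    eLpNorm a 2 volume
      ≤ ENNReal.ofReal D * (2 * (ENNReal.ofReal (bracket s)⁻¹ * bracketMass)) :=
  (eLpNorm_le_mul_eLpNorm_of_ae_le_mul (Eventually.of_forall fun ξ =>
    (h ξ).trans (mul_le_mul_of_nonneg_left (Real.le_norm_self _) hD)) 2).trans
      (mul_le_mul_right (eLpNorm_decayWeight_le s) _)

end DecayWeight

section PropagatorSymbol

/-- The symbol of the propagator `sin(t⟨∇⟩)/⟨∇⟩`. -/
def propagatorSymbol (t : ℝ) (ξ : Plane) : ℝ := Real.sin (t * bracket ξ) / bracket ξ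

theorem abs_propagatorSymbol_le_one (t : ℝ) (ξ : Plane) : |propagatorSymbol t ξ| ≤ 1 := by
  rw [propagatorSymbol, abs_div, abs_of_pos (bracket_pos ξ)]
  exact div_le_one_of_le₀ ((Real.abs_sin_le_one _).trans (one_le_bracket ξ)) (bracket_pos ξ).le

theorem abs_propagatorSymbol_sub_le (t r : ℝ) (ξ : Plane) :
    |propagatorSymbol t ξ - propagatorSymbol r ξ| ≤ |t - r| := by
  have hξ := bracket_pos ξ
  have hsin := Real.lipschitzWith_sin.dist_le_mul (t * bracket ξ) (r * bracket ξ)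
  rw [NNReal.coe_one, one_mul, Real.dist_eq, Real.dist_eq, ← sub_mul, abs_mul,
    abs_of_pos hξ] at hsin
  rwa [propagatorSymbol, propagatorSymbol, ← sub_div, abs_div, abs_of_pos hξ, div_le_iff₀ hξ]

theorem continuous_propagatorSymbol (t : ℝ) : Continuous (propagatorSymbol t) :=
  (Real.continuous_sin.comp (continuous_bracket.const_mul t)).div continuous_bracket
    fun ξ => (bracket_pos ξ).ne'

variable {F : Type*} [NormedAddCommGroup F] [NormedSpace ℂ F]

theorem norm_ofReal_smul_sub_smul_le (a b : ℝ) (u v : F) :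
    ‖(a : ℂ) • u - (b : ℂ) • v‖ ≤ |a - b| * ‖u‖ + |b| * ‖u - v‖ := by
  have hsplit : (a : ℂ) • u - (b : ℂ) • v = ((a - b : ℝ) : ℂ) • u + (b : ℂ) • (u - v) := by
    push_cast
    module
  rw [hsplit]
  refine (norm_add_le _ _).trans_eq ?_
  simp only [norm_smul, Complex.norm_real, Real.norm_eq_abs]

theorem norm_ofReal_smul_le {a : ℝ} (ha : |a| ≤ 1) (u : F) : ‖(a : ℂ) • u‖ ≤ ‖u‖ := by
  rw [norm_smul, Complex.norm_real, Real.norm_eq_abs]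
  exact mul_le_of_le_one_left (norm_nonneg u) ha

end PropagatorSymbol

section Duhamel

variable {F : Type*} [NormedAddCommGroup F] [NormedSpace ℂ F]

/-- `Q` solves `Q'' + ⟨ξ⟩² Q = g` at each frequency `ξ`, with the decay that makes `Q` the Fourier
transform of the Duhamel integral of `g` from infinity; `Q'` is the time derivative of `Q`. The
bounds by `decayWeight` carry the Sobolev weight `⟨ξ⟩^{m+2}` and the size `D`. -/
structure IsDecayingSolution (m : ℕ) (D : ℝ) (g Q Q' : ℝ → Plane → F) : Prop where
  nonneg : 0 ≤ D
  stronglyMeasurable_source : ∀ s, StronglyMeasurable (g s)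
  stronglyMeasurable : ∀ s, StronglyMeasurable (Q s)
  stronglyMeasurable_deriv : ∀ s, StronglyMeasurable (Q' s)
  hasDerivAt : ∀ s ξ, HasDerivAt (fun s => Q s ξ) (Q' s ξ) s
  hasDerivAt_deriv : ∀ s ξ,
    HasDerivAt (fun s => Q' s ξ) (g s ξ - ((bracket ξ ^ 2 : ℝ) : ℂ) • Q s ξ) s
  bound : ∀ s ξ, bracket ξ ^ (m + 2) * ‖Q s ξ‖ ≤ D * decayWeight s ξ
  bound_deriv : ∀ s ξ, bracket ξ ^ (m + 2) * ‖Q' s ξ‖ ≤ D * decayWeight s ξ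
  source_bound : ∃ B, ∀ s ξ, ‖g s ξ‖ ≤ B * (bracket ξ ^ 2)⁻¹
  source_lipschitz : ∃ B, ∀ s r ξ, ‖g s ξ - g r ξ‖ ≤ |s - r| * (B * (bracket ξ ^ 2)⁻¹)

/-- A primitive in `s` of `sin((t-s)⟨ξ⟩)/⟨ξ⟩ g(s)`, where `Q'' + ⟨ξ⟩² Q = g`. -/
def duhamelPrimitive (Q Q' : ℝ → Plane → F) (t s : ℝ) (ξ : Plane) : F :=
  (Real.cos ((t - s) * bracket ξ) : ℂ) • Q s ξ + (propagatorSymbol (t - s) ξ : ℂ) • Q' s ξ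

theorem duhamelPrimitive_self (Q Q' : ℝ → Plane → F) (t : ℝ) : duhamelPrimitive Q Q' t t = Q t := by
  ext ξ
  simp [duhamelPrimitive, propagatorSymbol]

variable {m : ℕ} {D : ℝ} {g Q Q' : ℝ → Plane → F}

namespace IsDecayingSolution

theorem norm_le (h : IsDecayingSolution m D g Q Q') (s : ℝ) (ξ : Plane) :
    ‖Q s ξ‖ ≤ D * decayWeight s ξ :=
  (le_mul_of_one_le_left (norm_nonneg _) (one_le_pow₀ (one_le_bracket ξ))).trans (h.bound s ξ)

theorem norm_deriv_le (h : IsDecayingSolution m D g Q Q') (s : ℝ) (ξ : Plane) :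
    ‖Q' s ξ‖ ≤ D * decayWeight s ξ :=
  (le_mul_of_one_le_left (norm_nonneg _) (one_le_pow₀ (one_le_bracket ξ))).trans (h.bound_deriv s ξ)

theorem mul_decayWeight_le (h : IsDecayingSolution m D g Q Q') (s : ℝ) (ξ : Plane) :
    D * decayWeight s ξ ≤ 2 * D * (bracket ξ ^ 2)⁻¹ :=
  (mul_le_mul_of_nonneg_left (decayWeight_le s ξ) h.nonneg).trans_eq (by ring)

theorem norm_duhamelPrimitive_le (h : IsDecayingSolution m D g Q Q') (t s : ℝ) (ξ : Plane) :
    ‖duhamelPrimitive Q Q' t s ξ‖ ≤ 2 * D * decayWeight s ξ := by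
  have hcos := norm_ofReal_smul_le (Real.abs_cos_le_one ((t - s) * bracket ξ)) (Q s ξ)
  have hsin := norm_ofReal_smul_le (abs_propagatorSymbol_le_one (t - s) ξ) (Q' s ξ)
  refine (norm_add_le _ _).trans ?_
  linarith [h.norm_le s ξ, h.norm_deriv_le s ξ]

theorem memLp_source (h : IsDecayingSolution m D g Q Q') (s : ℝ) : MemLp (g s) 2 volume :=
  have ⟨_, hB⟩ := h.source_bound
  memLp_of_norm_le_inv_bracket_sq (h.stronglyMeasurable_source s) (hB s)

theorem memLp (h : IsDecayingSolution m D g Q Q') (s : ℝ) : MemLp (Q s) 2 volume :=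
  memLp_of_norm_le_inv_bracket_sq (h.stronglyMeasurable s) fun ξ =>
    (h.norm_le s ξ).trans (h.mul_decayWeight_le s ξ)

theorem memLp_deriv (h : IsDecayingSolution m D g Q Q') (s : ℝ) : MemLp (Q' s) 2 volume :=
  memLp_of_norm_le_inv_bracket_sq (h.stronglyMeasurable_deriv s) fun ξ =>
    (h.norm_deriv_le s ξ).trans (h.mul_decayWeight_le s ξ)

theorem memLp_duhamelPrimitive (h : IsDecayingSolution m D g Q Q') (t s : ℝ) :
    MemLp (duhamelPrimitive Q Q' t s) 2 volume := by
  refine memLp_of_norm_le_inv_bracket_sq (B := 2 * (2 * D)) ?_ fun ξ => ?_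
  · have hcos : Continuous fun ξ : Plane => (Real.cos ((t - s) * bracket ξ) : ℂ) :=
      Complex.continuous_ofReal.comp (Real.continuous_cos.comp (continuous_bracket.const_mul _))
    exact (hcos.stronglyMeasurable.smul (h.stronglyMeasurable s)).add
      ((Complex.continuous_ofReal.comp (continuous_propagatorSymbol _)).stronglyMeasurable.smul
        (h.stronglyMeasurable_deriv s))
  · linarith [h.norm_duhamelPrimitive_le t s ξ, h.mul_decayWeight_le s ξ]

theorem memLp_propagatorSymbol_smul (h : IsDecayingSolution m D g Q Q') (t s : ℝ) :
    MemLp (fun ξ => (propagatorSymbol t ξ : ℂ) • g s ξ) 2 volume :=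
  have ⟨_, hB⟩ := h.source_bound
  memLp_of_norm_le_inv_bracket_sq
    ((Complex.continuous_ofReal.comp (continuous_propagatorSymbol t)).stronglyMeasurable.smul
      (h.stronglyMeasurable_source s))
    fun ξ => (norm_ofReal_smul_le (abs_propagatorSymbol_le_one t ξ) _).trans (hB s ξ)

theorem exists_lipschitz_deriv (h : IsDecayingSolution m D g Q Q') :
    ∃ B, ∀ s r ξ, ‖Q' s ξ - Q' r ξ‖ ≤ |s - r| * (B * (bracket ξ ^ 2)⁻¹) := by
  obtain ⟨B, hB⟩ := h.source_bound
  refine ⟨B + 2 * D, fun s r ξ => ?_⟩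
  have hderiv_le (y : ℝ) :
      ‖g y ξ - ((bracket ξ ^ 2 : ℝ) : ℂ) • Q y ξ‖ ≤ (B + 2 * D) * (bracket ξ ^ 2)⁻¹ := by
    have hrestoring : ‖((bracket ξ ^ 2 : ℝ) : ℂ) • Q y ξ‖ ≤ 2 * D * (bracket ξ ^ 2)⁻¹ := by
      rw [norm_smul, Complex.norm_real, Real.norm_of_nonneg (sq_nonneg _)]
      exact (mul_le_mul_of_nonneg_right (pow_le_pow_right₀ (one_le_bracket ξ) (by omega))
        (norm_nonneg _)).trans ((h.bound y ξ).trans (h.mul_decayWeight_le y ξ))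
    rw [add_mul]
    exact (norm_sub_le _ _).trans (add_le_add (hB y ξ) hrestoring)
  have hmean := convex_univ.norm_image_sub_le_of_norm_hasDerivWithin_le
    (fun y _ => (h.hasDerivAt_deriv y ξ).hasDerivWithinAt) (fun y _ => hderiv_le y)
    (Set.mem_univ r) (Set.mem_univ s)
  rwa [Real.norm_eq_abs, mul_comm] at hmean

theorem exists_lipschitz_propagatorSymbol_smul (h : IsDecayingSolution m D g Q Q') :
    ∃ B, ∀ t s r ξ, ‖(propagatorSymbol (t - s) ξ : ℂ) • g s ξ
      - (propagatorSymbol (t - r) ξ : ℂ) • g r ξ‖ ≤ |s - r| * (B * (bracket ξ ^ 2)⁻¹) := by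
  obtain ⟨B, hB⟩ := h.source_bound
  obtain ⟨B', hB'⟩ := h.source_lipschitz
  refine ⟨B + B', fun t s r ξ => (norm_ofReal_smul_sub_smul_le _ _ _ _).trans ?_⟩
  have hsymbol : |propagatorSymbol (t - s) ξ - propagatorSymbol (t - r) ξ| ≤ |s - r| := by
    simpa [abs_sub_comm] using abs_propagatorSymbol_sub_le (t - s) (t - r) ξ
  have hfirst := mul_le_mul hsymbol (hB s ξ) (norm_nonneg _) (abs_nonneg _)
  have hsecond := (mul_le_of_le_one_left (norm_nonneg (g s ξ - g r ξ))
    (abs_propagatorSymbol_le_one (t - r) ξ)).trans (hB' s r ξ)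
  linarith

theorem hasDerivAt_duhamelPrimitive (h : IsDecayingSolution m D g Q Q') (t s : ℝ) (ξ : Plane) :
    HasDerivAt (fun s => duhamelPrimitive Q Q' t s ξ)
      ((propagatorSymbol (t - s) ξ : ℂ) • g s ξ) s := by
  have hξ : (bracket ξ : ℂ) ≠ 0 := Complex.ofReal_ne_zero.2 (bracket_pos ξ).ne'
  have hphase : HasDerivAt (fun s => (t - s) * bracket ξ) (-bracket ξ) s := by
    simpa using ((hasDerivAt_id s).const_sub t).mul_const (bracket ξ)
  refine ((hphase.cos.ofReal_comp.smul (h.hasDerivAt s ξ)).add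
    ((hphase.sin.div_const (bracket ξ)).ofReal_comp.smul (h.hasDerivAt_deriv s ξ))).congr_deriv ?_
  rw [propagatorSymbol]
  push_cast
  match_scalars <;> field_simp <;> ring

end IsDecayingSolution

end Duhamel

section DuhamelInfty

variable {F : Type*} [NormedAddCommGroup F] [InnerProductSpace ℂ F] [CompleteSpace F]
  {m : ℕ} {D : ℝ} {g Q Q' : ℝ → Plane → F}

theorem sobolevNorm_l2InvHat_le_of_norm_le_decayWeight {k : ℕ} {a : Plane → F} {D s : ℝ}
    (hD : 0 ≤ D) (ha : MemLp a 2 volume)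
    (h : ∀ ξ, bracket ξ ^ k * ‖a ξ‖ ≤ D * decayWeight s ξ) :
    sobolevNorm k (l2InvHat a)
      ≤ ENNReal.ofReal D * (2 * (ENNReal.ofReal (bracket s)⁻¹ * bracketMass)) := by
  refine (sobolevNorm_l2InvHat_le k ha).trans (eLpNorm_le_of_norm_le_decayWeight hD fun ξ => ?_)
  rw [norm_smul, Real.norm_of_nonneg (pow_nonneg (bracket_pos ξ).le k)]
  exact h ξ

namespace IsDecayingSolution

theorem propagator_l2InvHat (h : IsDecayingSolution m D g Q Q') (t s : ℝ) :
    propagator t (l2InvHat (g s)) = l2InvHat fun ξ => (propagatorSymbol t ξ : ℂ) • g s ξ :=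
  l2Multiplier_l2InvHat _ (h.memLp_source s)

theorem continuous_propagator (h : IsDecayingSolution m D g Q Q') (t : ℝ) :
    Continuous fun s => propagator (t - s) (l2InvHat (g s)) := by
  obtain ⟨B, hB⟩ := h.exists_lipschitz_propagatorSymbol_smul
  simp only [h.propagator_l2InvHat]
  exact continuous_l2InvHat (memLp_inv_bracket_sq.const_mul B)
    (fun s => h.memLp_propagatorSymbol_smul (t - s) s) (hB t)

theorem hasDerivAt_l2InvHat (h : IsDecayingSolution m D g Q Q') (t : ℝ) :
    HasDerivAt (fun t => l2InvHat (Q t)) (l2InvHat (Q' t)) t :=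
  have ⟨B, hB⟩ := h.exists_lipschitz_deriv
  EulerPoisson.hasDerivAt_l2InvHat (memLp_inv_bracket_sq.const_mul B) h.memLp h.memLp_deriv
    h.hasDerivAt hB t

theorem hasDerivAt_l2InvHat_duhamelPrimitive (h : IsDecayingSolution m D g Q Q') (t s : ℝ) :
    HasDerivAt (fun s => l2InvHat (duhamelPrimitive Q Q' t s))
      (propagator (t - s) (l2InvHat (g s))) s := by
  obtain ⟨B, hB⟩ := h.exists_lipschitz_propagatorSymbol_smul
  rw [h.propagator_l2InvHat]
  exact EulerPoisson.hasDerivAt_l2InvHat (memLp_inv_bracket_sq.const_mul B)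
    (h.memLp_duhamelPrimitive t) (fun s => h.memLp_propagatorSymbol_smul (t - s) s)
    (h.hasDerivAt_duhamelPrimitive t) (hB t) s

theorem duhamel_eq (h : IsDecayingSolution m D g Q Q') (T t : ℝ) :
    duhamel (fun s => l2InvHat (g s)) T t
      = l2InvHat (Q t) - l2InvHat (duhamelPrimitive Q Q' t T) := by
  rw [duhamel, intervalIntegral.integral_eq_sub_of_hasDerivAt
    (fun s _ => h.hasDerivAt_l2InvHat_duhamelPrimitive t s)
    ((h.continuous_propagator t).intervalIntegrable T t), duhamelPrimitive_self]

theorem tendsto_l2InvHat_duhamelPrimitive (h : IsDecayingSolution m D g Q Q') (t : ℝ) :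
    Tendsto (fun T => l2InvHat (duhamelPrimitive Q Q' t T)) atTop (𝓝 0) := by
  have hbound (T : ℝ) : ‖l2InvHat (duhamelPrimitive Q Q' t T)‖ₑ
      ≤ ENNReal.ofReal (2 * D) * (2 * (ENNReal.ofReal (bracket T)⁻¹ * bracketMass)) :=
    (enorm_l2InvHat_le (h.memLp_duhamelPrimitive t T)).trans
      (eLpNorm_le_of_norm_le_decayWeight (mul_nonneg zero_le_two h.nonneg)
        (h.norm_duhamelPrimitive_le t T))
  have hlim : Tendsto (fun T : ℝ => ENNReal.ofReal (2 * D)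
      * (2 * (ENNReal.ofReal (bracket T)⁻¹ * bracketMass))) atTop (𝓝 0) := by
    have hinv := ENNReal.tendsto_ofReal tendsto_inv_bracket_atTop
    have hmass := ENNReal.Tendsto.mul_const hinv (.inr bracketMass_lt_top.ne)
    have htwo := ENNReal.Tendsto.const_mul hmass (.inr ENNReal.ofNat_ne_top) (a := 2)
    have h := ENNReal.Tendsto.const_mul htwo (.inr ENNReal.ofReal_ne_top)
      (a := ENNReal.ofReal (2 * D))
    simpa only [ENNReal.ofReal_zero, zero_mul, mul_zero] using h
  exact tendsto_zero_iff_enorm_tendsto_zero.2 (tendsto_of_tendsto_of_tendsto_of_le_of_le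
    tendsto_const_nhds hlim (fun _ => zero_le) hbound)

theorem tendsto_duhamel (h : IsDecayingSolution m D g Q Q') (t : ℝ) :
    Tendsto (fun T => duhamel (fun s => l2InvHat (g s)) T t) atTop (𝓝 (l2InvHat (Q t))) := by
  simp only [h.duhamel_eq]
  simpa only [sub_zero] using (h.tendsto_l2InvHat_duhamelPrimitive t).const_sub (l2InvHat (Q t))

theorem duhamelInfty_eq (h : IsDecayingSolution m D g Q Q') :
    duhamelInfty (fun s => l2InvHat (g s)) = fun t => l2InvHat (Q t) :=
  funext fun t => (h.tendsto_duhamel t).limUnder_eq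

theorem sobolevNorm_duhamelInfty_le (h : IsDecayingSolution m D g Q Q') (t : ℝ) :
    ENNReal.ofReal (bracket t) * (sobolevNorm (m + 2) (duhamelInfty (fun s => l2InvHat (g s)) t)
        + sobolevNorm (m + 2) (deriv (duhamelInfty fun s => l2InvHat (g s)) t))
      ≤ ENNReal.ofReal D * (4 * bracketMass) := by
  have hbracket : ENNReal.ofReal (bracket t) * ENNReal.ofReal (bracket t)⁻¹ = 1 := by
    rw [← ENNReal.ofReal_mul (bracket_pos t).le, mul_inv_cancel₀ (bracket_pos t).ne',
      ENNReal.ofReal_one]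
  rw [h.duhamelInfty_eq, (h.hasDerivAt_l2InvHat t).deriv]
  calc _ ≤ ENNReal.ofReal (bracket t)
        * (ENNReal.ofReal D * (2 * (ENNReal.ofReal (bracket t)⁻¹ * bracketMass))
          + ENNReal.ofReal D * (2 * (ENNReal.ofReal (bracket t)⁻¹ * bracketMass))) := by
        gcongr
        · exact sobolevNorm_l2InvHat_le_of_norm_le_decayWeight h.nonneg (h.memLp t) (h.bound t)
        · exact sobolevNorm_l2InvHat_le_of_norm_le_decayWeight h.nonneg (h.memLp_deriv t)
            (h.bound_deriv t)
    _ = (ENNReal.ofReal (bracket t) * ENNReal.ofReal (bracket t)⁻¹)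
        * (ENNReal.ofReal D * (4 * bracketMass)) := by ring
    _ = ENNReal.ofReal D * (4 * bracketMass) := by rw [hbracket, one_mul]

end IsDecayingSolution

end DuhamelInfty

section DirectionalDerivative

variable {E : Type*} [NormedAddCommGroup E] [NormedSpace ℝ E] {v : E} {A B : E → ℂ}

/-- The derivative of `A` at `η` in the direction `v`. -/
def dirDeriv (v : E) (A : E → ℂ) (η : E) : ℂ := fderiv ℝ A η v

theorem contDiff_dirDeriv {n : WithTop ℕ∞} (hA : ContDiff ℝ (n + 1) A) :
    ContDiff ℝ n (dirDeriv v A) :=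
  (hA.fderiv_right le_rfl).clm_apply contDiff_const

theorem dirDeriv_eq_of_hasFDerivAt {A' : E →L[ℝ] ℂ} {η : E} (h : HasFDerivAt A A' η) :
    dirDeriv v A η = A' v := by
  rw [dirDeriv, h.fderiv]

theorem dirDeriv_ofReal {f : E → ℝ} {f' : E →L[ℝ] ℝ} {η : E} (h : HasFDerivAt f f' η) :
    dirDeriv v (fun η => (f η : ℂ)) η = f' v :=
  dirDeriv_eq_of_hasFDerivAt (Complex.ofRealCLM.hasFDerivAt.comp η h)

theorem hasDerivAt_comp_line {p : E} {ρ : ℝ} (hA : DifferentiableAt ℝ A (p + ρ • v)) :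
    HasDerivAt (fun ρ : ℝ => A (p + ρ • v)) (dirDeriv v A (p + ρ • v)) ρ := by
  have hline : HasDerivAt (fun ρ : ℝ => p + ρ • v) v ρ := by
    simpa only [one_smul, id_eq] using ((hasDerivAt_id ρ).smul_const v).const_add p
  exact hA.hasFDerivAt.comp_hasDerivAt ρ hline

theorem dirDeriv_const (c : ℂ) : dirDeriv v (fun _ : E => c) = fun _ => 0 :=
  funext fun _ => dirDeriv_eq_of_hasFDerivAt (hasFDerivAt_const c _)

theorem dirDeriv_continuousLinearMap (L : E →L[ℝ] ℂ) : dirDeriv v L = fun _ => L v :=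
  funext fun _ => dirDeriv_eq_of_hasFDerivAt L.hasFDerivAt

theorem dirDeriv_neg (A : E → ℂ) : dirDeriv v (fun η => -A η) = fun η => -dirDeriv v A η := by
  ext η
  simp only [dirDeriv, fderiv_fun_neg, neg_apply]

theorem dirDeriv_add (hA : Differentiable ℝ A) (hB : Differentiable ℝ B) :
    dirDeriv v (fun η => A η + B η) = fun η => dirDeriv v A η + dirDeriv v B η :=
  funext fun η => dirDeriv_eq_of_hasFDerivAt ((hA η).hasFDerivAt.add (hB η).hasFDerivAt)

theorem dirDeriv_mul (hA : Differentiable ℝ A) (hB : Differentiable ℝ B) :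
    dirDeriv v (fun η => A η * B η) = fun η => dirDeriv v A η * B η + A η * dirDeriv v B η := by
  ext η
  rw [dirDeriv_eq_of_hasFDerivAt (A := fun η => A η * B η)
    ((hA η).hasFDerivAt.mul (hB η).hasFDerivAt)]
  simp only [dirDeriv, add_apply, smul_apply, smul_eq_mul]
  ring

theorem dirDeriv_inv (hA : Differentiable ℝ A) (h0 : ∀ η, A η ≠ 0) :
    dirDeriv v (fun η => (A η)⁻¹) = fun η => -(dirDeriv v A η * ((A η)⁻¹ * (A η)⁻¹)) := by
  ext η
  have hinv := ((hasDerivAt_inv (h0 η)).hasFDerivAt.restrictScalars ℝ).comp η (hA η).hasFDerivAt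
  rw [dirDeriv_eq_of_hasFDerivAt (A := fun η => (A η)⁻¹) hinv]
  simp [dirDeriv, sq]

theorem dirDeriv_dirDeriv_mul (hA : ContDiff ℝ 2 A) (hB : ContDiff ℝ 2 B) :
    dirDeriv v (dirDeriv v fun η => A η * B η) = fun η =>
      dirDeriv v (dirDeriv v A) η * B η + dirDeriv v A η * dirDeriv v B η
        + (dirDeriv v A η * dirDeriv v B η + A η * dirDeriv v (dirDeriv v B) η) := by
  have hA₀ := hA.differentiable two_ne_zero
  have hB₀ := hB.differentiable two_ne_zero
  have hA₁ : Differentiable ℝ (dirDeriv v A) :=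
    (contDiff_dirDeriv (n := 1) hA).differentiable one_ne_zero
  have hB₁ : Differentiable ℝ (dirDeriv v B) :=
    (contDiff_dirDeriv (n := 1) hB).differentiable one_ne_zero
  rw [dirDeriv_mul hA₀ hB₀, dirDeriv_add (hA₁.fun_mul hB₀) (hA₀.fun_mul hB₁),
    dirDeriv_mul hA₁ hB₀, dirDeriv_mul hA₀ hB₁]

theorem dirDeriv_dirDeriv_inv (hA : ContDiff ℝ 2 A) (h0 : ∀ η, A η ≠ 0) :
    dirDeriv v (dirDeriv v fun η => (A η)⁻¹) = fun η =>
      2 * dirDeriv v A η ^ 2 * (A η)⁻¹ ^ 3 - dirDeriv v (dirDeriv v A) η * (A η)⁻¹ ^ 2 := by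
  have hA₀ := hA.differentiable two_ne_zero
  have hA₁ : Differentiable ℝ (dirDeriv v A) :=
    (contDiff_dirDeriv (n := 1) hA).differentiable one_ne_zero
  have hinv : Differentiable ℝ fun η => (A η)⁻¹ := fun η => (hA₀ η).inv (h0 η)
  rw [dirDeriv_inv hA₀ h0, dirDeriv_neg, dirDeriv_mul hA₁ (hinv.fun_mul hinv),
    dirDeriv_mul hinv hinv, dirDeriv_inv hA₀ h0]
  ext η
  ring

theorem dirDeriv_comp_const_sub (ξ : E) (hA : Differentiable ℝ A) :
    dirDeriv v (fun η => A (ξ - η)) = fun η => -dirDeriv v A (ξ - η) := by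
  ext η
  have hsub := (hA (ξ - η)).hasFDerivAt.comp η ((hasFDerivAt_id η).const_sub ξ)
  rw [dirDeriv_eq_of_hasFDerivAt (A := fun η => A (ξ - η)) hsub]
  simp [dirDeriv]

theorem dirDeriv_eq_zero_of_invariant (hA : Differentiable ℝ A)
    (h : ∀ (η : E) (t : ℝ), A (η + t • v) = A η) : dirDeriv v A = fun _ => 0 := by
  ext η
  rw [dirDeriv, ← (hA η).lineDeriv_eq_fderiv, lineDeriv]
  simp only [h, deriv_const]

end DirectionalDerivative

section JetBound

/-- `A` is of class `C²` and, together with its first two derivatives in the direction `v`, it is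
bounded by `D` times the weight `w`. -/
structure HasJetBound {E : Type*} [NormedAddCommGroup E] [NormedSpace ℝ E] (v : E) (w : E → ℝ)
    (D : ℝ) (A : E → ℂ) : Prop where
  contDiff : ContDiff ℝ 2 A
  bound : ∀ η, ‖A η‖ ≤ D * w η
  bound_dirDeriv : ∀ η, ‖dirDeriv v A η‖ ≤ D * w η
  bound_dirDeriv_dirDeriv : ∀ η, ‖dirDeriv v (dirDeriv v A) η‖ ≤ D * w η

namespace HasJetBound

variable {E : Type*} [NormedAddCommGroup E] [NormedSpace ℝ E] {v : E} {w w' : E → ℝ} {D D' : ℝ}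
  {A B : E → ℂ}

theorem differentiable (hA : HasJetBound v w D A) : Differentiable ℝ A :=
  hA.contDiff.differentiable two_ne_zero

theorem contDiff_one_dirDeriv (hA : HasJetBound v w D A) : ContDiff ℝ 1 (dirDeriv v A) :=
  contDiff_dirDeriv (n := 1) hA.contDiff

theorem differentiable_dirDeriv (hA : HasJetBound v w D A) : Differentiable ℝ (dirDeriv v A) :=
  hA.contDiff_one_dirDeriv.differentiable one_ne_zero

theorem nonneg (hA : HasJetBound v w D A) (η : E) : 0 ≤ D * w η :=
  (norm_nonneg _).trans (hA.bound η)

theorem mono (hA : HasJetBound v w D A) (h : ∀ η, D * w η ≤ D' * w' η) : HasJetBound v w' D' A :=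
  ⟨hA.contDiff, fun η => (hA.bound η).trans (h η), fun η => (hA.bound_dirDeriv η).trans (h η),
    fun η => (hA.bound_dirDeriv_dirDeriv η).trans (h η)⟩

theorem add (hA : HasJetBound v w D A) (hB : HasJetBound v w D' B) :
    HasJetBound v w (D + D') fun η => A η + B η := by
  refine ⟨hA.contDiff.add hB.contDiff, fun η => ?_, fun η => ?_, fun η => ?_⟩
  · rw [add_mul]
    exact norm_add_le_of_le (hA.bound η) (hB.bound η)
  · rw [dirDeriv_add hA.differentiable hB.differentiable, add_mul]
    exact norm_add_le_of_le (hA.bound_dirDeriv η) (hB.bound_dirDeriv η)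
  · rw [dirDeriv_add hA.differentiable hB.differentiable, dirDeriv_add hA.differentiable_dirDeriv
      hB.differentiable_dirDeriv, add_mul]
    exact norm_add_le_of_le (hA.bound_dirDeriv_dirDeriv η) (hB.bound_dirDeriv_dirDeriv η)

theorem mul (hA : HasJetBound v w D A) (hB : HasJetBound v w' D' B) :
    HasJetBound v (fun η => w η * w' η) (4 * D * D') fun η => A η * B η := by
  have hprod (η : E) {x y : ℂ} (hx : ‖x‖ ≤ D * w η) (hy : ‖y‖ ≤ D' * w' η) :
      ‖x * y‖ ≤ D * w η * (D' * w' η) := norm_mul_le_of_le hx hy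
  have hnonneg (η : E) : 0 ≤ D * w η * (D' * w' η) := mul_nonneg (hA.nonneg η) (hB.nonneg η)
  refine ⟨hA.contDiff.mul hB.contDiff, fun η => ?_, fun η => ?_, fun η => ?_⟩
  · linarith [hprod η (hA.bound η) (hB.bound η), hnonneg η]
  · rw [dirDeriv_mul hA.differentiable hB.differentiable]
    refine (norm_add_le _ _).trans ?_
    linarith [hprod η (hA.bound_dirDeriv η) (hB.bound η),
      hprod η (hA.bound η) (hB.bound_dirDeriv η), hnonneg η]
  · rw [dirDeriv_dirDeriv_mul hA.contDiff hB.contDiff]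
    refine (norm_add_le_of_le (norm_add_le _ _) (norm_add_le _ _)).trans ?_
    linarith [hprod η (hA.bound_dirDeriv_dirDeriv η) (hB.bound η),
      hprod η (hA.bound_dirDeriv η) (hB.bound_dirDeriv η),
      hprod η (hA.bound η) (hB.bound_dirDeriv_dirDeriv η)]

theorem inv (hA : HasJetBound v w D A) (hD : 1 ≤ D) (hw : ∀ η, 1 ≤ w η) (h : ∀ η, 1 ≤ ‖A η‖) :
    HasJetBound v (fun η => w η ^ 2) (3 * D ^ 2) fun η => (A η)⁻¹ := by
  have h0 (η : E) : A η ≠ 0 := norm_pos_iff.1 (one_pos.trans_le (h η))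
  have hinv (k : ℕ) (η : E) : ‖(A η)⁻¹ ^ k‖ ≤ 1 := by
    rw [norm_pow, norm_inv]
    exact pow_le_one₀ (inv_nonneg.2 (norm_nonneg _)) (inv_le_one_of_one_le₀ (h η))
  have hDw (η : E) : 1 ≤ D * w η := one_le_mul_of_one_le_of_one_le hD (hw η)
  have hsq (η : E) : D * w η ≤ (D * w η) ^ 2 := le_self_pow₀ (hDw η) two_ne_zero
  refine ⟨hA.contDiff.inv h0, fun η => ?_, fun η => ?_, fun η => ?_⟩
  · have := hinv 1 η
    rw [pow_one] at this
    linarith [hsq η, hDw η, mul_pow D (w η) 2]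
  · have := norm_mul_le_of_le (hA.bound_dirDeriv η) (hinv 2 η)
    rw [dirDeriv_inv hA.differentiable h0, norm_neg, ← sq]
    linarith [hsq η, hDw η, mul_pow D (w η) 2]
  · have hA₁ : ‖dirDeriv v A η ^ 2‖ ≤ (D * w η) ^ 2 := by
      rw [norm_pow]
      exact pow_le_pow_left₀ (norm_nonneg _) (hA.bound_dirDeriv η) 2
    have h₁ : ‖2 * dirDeriv v A η ^ 2 * (A η)⁻¹ ^ 3‖ ≤ 2 * (D * w η) ^ 2 * 1 :=
      norm_mul_le_of_le (norm_mul_le_of_le (by simp) hA₁) (hinv 3 η)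
    have h₂ := norm_mul_le_of_le (hA.bound_dirDeriv_dirDeriv η) (hinv 2 η)
    rw [dirDeriv_dirDeriv_inv hA.contDiff h0]
    linarith [norm_sub_le_of_le h₁ h₂, hsq η, mul_pow D (w η) 2]

theorem const (c : ℂ) : HasJetBound v (fun _ => 1) ‖c‖ fun _ => c :=
  ⟨contDiff_const, by simp, by simp [dirDeriv_const], by simp [dirDeriv_const]⟩

theorem const_mul (c : ℂ) (hA : HasJetBound v w D A) :
    HasJetBound v w (4 * ‖c‖ * D) fun η => c * A η := by
  simpa only [one_mul] using (const (v := v) c).mul hA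

theorem comp_const_sub (ξ : E) (hA : HasJetBound v w D A) :
    HasJetBound v (fun η => w (ξ - η)) D fun η => A (ξ - η) := by
  refine ⟨hA.contDiff.comp (contDiff_const.sub contDiff_id), fun η => hA.bound _, fun η => ?_,
    fun η => ?_⟩
  · rw [dirDeriv_comp_const_sub ξ hA.differentiable, norm_neg]
    exact hA.bound_dirDeriv _
  · rw [dirDeriv_comp_const_sub ξ hA.differentiable, dirDeriv_neg,
      dirDeriv_comp_const_sub ξ hA.differentiable_dirDeriv]
    simpa only [neg_neg] using hA.bound_dirDeriv_dirDeriv _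

theorem of_invariant (hA : ContDiff ℝ 2 A) (hinv : ∀ (η : E) (t : ℝ), A (η + t • v) = A η)
    (h : ∀ η, ‖A η‖ ≤ D) : HasJetBound v (fun _ => 1) D A := by
  have hD : 0 ≤ D := (norm_nonneg _).trans (h 0)
  have hderiv := dirDeriv_eq_zero_of_invariant (hA.differentiable two_ne_zero) hinv
  refine ⟨hA, by simpa using h, ?_, ?_⟩ <;> simp [hderiv, dirDeriv_const, hD]

theorem ofReal_continuousLinearMap (L : E →L[ℝ] ℝ) (hL : ‖L‖ ≤ 1) (hv : ‖v‖ ≤ 1) :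
    HasJetBound v bracket 1 fun η => (L η : ℂ) := by
  have hLe (u : E) : ‖(L u : ℂ)‖ ≤ ‖u‖ := by
    rw [Complex.norm_real]
    exact L.le_of_opNorm_le hL u |>.trans_eq (one_mul _)
  have hderiv : dirDeriv v (fun η => (L η : ℂ)) = fun _ => (L v : ℂ) :=
    dirDeriv_continuousLinearMap (Complex.ofRealCLM.comp L)
  refine ⟨Complex.ofRealCLM.contDiff.comp L.contDiff, fun η => ?_, fun η => ?_, fun η => ?_⟩
  · rw [one_mul]
    exact (hLe η).trans (norm_le_bracket η)
  · rw [hderiv, one_mul]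
    exact ((hLe v).trans hv).trans (one_le_bracket η)
  · rw [hderiv, dirDeriv_const, norm_zero, one_mul]
    exact (bracket_pos η).le

end HasJetBound

end JetBound

section BracketJet

variable {E : Type*} [NormedAddCommGroup E] [InnerProductSpace ℝ E]

theorem contDiff_bracket {n : WithTop ℕ∞} : ContDiff ℝ n (bracket : E → ℝ) :=
  (contDiff_const.add (contDiff_id.norm_sq ℝ)).sqrt fun x => by
    have : 0 < 1 + ‖x‖ ^ 2 := by positivity
    exact this.ne'

theorem hasFDerivAt_bracket (η : E) :
    HasFDerivAt (bracket : E → ℝ) ((bracket η)⁻¹ • innerSL ℝ η) η := by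
  have hsq : HasFDerivAt (fun x : E => 1 + ‖x‖ ^ 2) (2 • innerSL ℝ η) η :=
    (hasStrictFDerivAt_norm_sq η).hasFDerivAt.const_add 1
  refine (hsq.sqrt (by positivity)).congr_fderiv ?_
  ext u
  simp only [bracket, one_div, mul_inv, smul_apply, nsmul_eq_mul,
    Nat.cast_ofNat, smul_eq_mul, coe_innerSL_apply]
  ring

theorem dirDeriv_bracket (v : E) :
    dirDeriv v (fun η => (bracket η : ℂ)) = fun η => ((inner ℝ η v / bracket η : ℝ) : ℂ) := by
  ext η
  rw [dirDeriv_ofReal (hasFDerivAt_bracket η), smul_apply, coe_innerSL_apply,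
    smul_eq_mul, inv_mul_eq_div]

theorem hasFDerivAt_inner_left (v η : E) :
    HasFDerivAt (fun η : E => inner ℝ η v) (innerSL ℝ v) η := by
  simpa only [coe_innerSL_apply, real_inner_comm] using (innerSL ℝ v).hasFDerivAt (x := η)

theorem dirDeriv_dirDeriv_bracket (v : E) : dirDeriv v (dirDeriv v fun η => (bracket η : ℂ))
    = fun η => ((‖v‖ ^ 2 / bracket η - inner ℝ η v ^ 2 / bracket η ^ 3 : ℝ) : ℂ) := by
  rw [dirDeriv_bracket]
  ext η
  have hb := (bracket_pos η).ne'
  have hquot := (hasFDerivAt_inner_left v η).mul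
    ((hasDerivAt_inv hb).comp_hasFDerivAt η (hasFDerivAt_bracket η))
  rw [dirDeriv_ofReal (f := fun η => inner ℝ η v / bracket η) hquot]
  simp only [Function.comp_apply, add_apply, smul_apply,
    coe_innerSL_apply, smul_eq_mul, real_inner_self_eq_norm_sq]
  congr 1
  field_simp
  ring

theorem hasJetBound_bracket {v : E} (hv : ‖v‖ ≤ 1) :
    HasJetBound v bracket 2 fun η => (bracket η : ℂ) := by
  have hinner (η : E) : |inner ℝ η v| ≤ bracket η :=
    (abs_real_inner_le_norm η v).trans
      ((mul_le_of_le_one_right (norm_nonneg _) hv).trans (norm_le_bracket η))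
  refine ⟨Complex.ofRealCLM.contDiff.comp contDiff_bracket, fun η => ?_, fun η => ?_, fun η => ?_⟩
  · rw [Complex.norm_real, Real.norm_of_nonneg (bracket_pos η).le]
    linarith [bracket_pos η]
  · rw [dirDeriv_bracket, Complex.norm_real, Real.norm_eq_abs, abs_div, abs_of_pos (bracket_pos η)]
    linarith [div_le_one_of_le₀ (hinner η) (bracket_pos η).le, one_le_bracket η]
  · have hb := one_le_bracket η
    have hb0 := bracket_pos η
    have hv2 : ‖v‖ ^ 2 ≤ 1 := pow_le_one₀ (norm_nonneg v) hv
    have h₁ : ‖v‖ ^ 2 / bracket η ≤ 1 := div_le_one_of_le₀ (hv2.trans hb) hb0.le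
    have h₂ : inner ℝ η v ^ 2 / bracket η ^ 3 ≤ 1 := by
      refine div_le_one_of_le₀ ?_ (by positivity)
      exact (sq_le_sq' (neg_le_of_abs_le (hinner η)) (le_of_abs_le (hinner η))).trans
        (pow_le_pow_right₀ hb (by norm_num))
    rw [dirDeriv_dirDeriv_bracket, Complex.norm_real, Real.norm_eq_abs]
    refine (abs_sub_le_of_nonneg_of_le (by positivity) h₁ (by positivity) h₂).trans ?_
    linarith

end BracketJet

section PairWeight

variable {E : Type*} [NormedAddCommGroup E]

/-- The weight `⟨η⟩⟨ξ - η⟩` of a pair of frequencies `η`, `ξ - η` with sum `ξ`. -/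
def pairWeight (ξ η : E) : ℝ := bracket η * bracket (ξ - η)

theorem one_le_pairWeight (ξ η : E) : 1 ≤ pairWeight ξ η :=
  one_le_mul_of_one_le_of_one_le (one_le_bracket _) (one_le_bracket _)

theorem pairWeight_pos (ξ η : E) : 0 < pairWeight ξ η := one_pos.trans_le (one_le_pairWeight ξ η)

theorem bracket_le_pairWeight (ξ η : E) : bracket η ≤ pairWeight ξ η :=
  le_mul_of_one_le_right (bracket_pos η).le (one_le_bracket _)

theorem bracket_sub_le_pairWeight (ξ η : E) : bracket (ξ - η) ≤ pairWeight ξ η :=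
  le_mul_of_one_le_left (bracket_pos _).le (one_le_bracket _)

theorem continuous_pairWeight (ξ : E) : Continuous (pairWeight ξ) :=
  continuous_bracket.mul (continuous_bracket.comp (continuous_const.sub continuous_id))

theorem pairWeight_sq (ξ η : E) :
    pairWeight ξ η ^ 2 = (1 + ‖η‖ ^ 2) * (1 + ‖ξ - η‖ ^ 2) := by
  rw [pairWeight, mul_pow, bracket_sq, bracket_sq]

variable [InnerProductSpace ℝ E]

theorem norm_sq_eq_add_sub (ξ η : E) :
    ‖ξ‖ ^ 2 = ‖η‖ ^ 2 + 2 * inner ℝ η (ξ - η) + ‖ξ - η‖ ^ 2 := by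
  rw [← norm_add_sq_real, add_sub_cancel]

theorem inner_sq_le_norm_sq_mul_norm_sq (x y : E) : inner ℝ x y ^ 2 ≤ ‖x‖ ^ 2 * ‖y‖ ^ 2 := by
  rw [← mul_pow]
  exact sq_le_sq.2 ((abs_real_inner_le_norm x y).trans (le_abs_self _))

theorem abs_one_sub_inner_le (ξ η : E) : |1 - inner ℝ η (ξ - η)| ≤ pairWeight ξ η := by
  refine abs_le_of_sq_le_sq ?_ (pairWeight_pos ξ η).le
  rw [pairWeight_sq]
  linarith [norm_sq_eq_add_sub ξ η, sq_nonneg ‖ξ‖, inner_sq_le_norm_sq_mul_norm_sq η (ξ - η)]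

theorem abs_one_add_inner_le (ξ η : E) : |1 + inner ℝ η (ξ - η)| ≤ pairWeight ξ η := by
  refine abs_le_of_sq_le_sq ?_ (pairWeight_pos ξ η).le
  rw [pairWeight_sq]
  linarith [norm_sub_sq_real η (ξ - η), sq_nonneg ‖η - (ξ - η)‖,
    inner_sq_le_norm_sq_mul_norm_sq η (ξ - η)]

theorem bracket_le_two_mul_pairWeight (ξ η : E) : bracket ξ ≤ 2 * pairWeight ξ η := by
  refine (abs_le_of_sq_le_sq' ?_ (by linarith [pairWeight_pos ξ η])).2
  have hpar := parallelogram_law_with_norm ℝ η (ξ - η)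
  rw [add_sub_cancel] at hpar
  rw [mul_pow, pairWeight_sq, bracket_sq]
  nlinarith [sq_nonneg ‖η - (ξ - η)‖, mul_nonneg (sq_nonneg ‖η‖) (sq_nonneg ‖ξ - η‖)]

theorem inv_pairWeight_pow_le (n : ℕ) (ξ η : E) :
    (pairWeight ξ η ^ (n + 3))⁻¹ ≤ 2 ^ n * (bracket ξ ^ n)⁻¹ * (bracket η ^ 3)⁻¹ := by
  have hξ : bracket ξ ^ n ≤ (2 * pairWeight ξ η) ^ n :=
    pow_le_pow_left₀ (bracket_pos ξ).le (bracket_le_two_mul_pairWeight ξ η) n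
  have hη : bracket η ^ 3 ≤ pairWeight ξ η ^ 3 :=
    pow_le_pow_left₀ (bracket_pos η).le (bracket_le_pairWeight ξ η) 3
  have hξpos := bracket_pos ξ
  have hηpos := bracket_pos η
  have hpos := pairWeight_pos ξ η
  rw [mul_assoc, ← mul_inv, ← div_eq_mul_inv, le_div_iff₀ (by positivity),
    inv_mul_le_iff₀ (by positivity)]
  calc bracket ξ ^ n * bracket η ^ 3 ≤ (2 * pairWeight ξ η) ^ n * pairWeight ξ η ^ 3 := by gcongr
    _ = pairWeight ξ η ^ (n + 3) * 2 ^ n := by ring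

end PairWeight

section TimeResonance

variable {E : Type*} [NormedAddCommGroup E] [InnerProductSpace ℝ E] {ε ε' : ℝ}

theorem abs_eq_one_of_sq_eq_one {x : ℝ} (h : x ^ 2 = 1) : |x| = 1 :=
  (abs_eq zero_le_one).2 (sq_eq_one_iff.1 h)

/-- The time-resonance function `⟨ξ⟩² - (ε⟨η⟩ + ε'⟨ξ - η⟩)²` of the interaction of the half-waves
of signs `ε` and `ε'`. -/
def timeResonance (ε ε' : ℝ) (ξ η : E) : ℝ :=
  bracket ξ ^ 2 - (ε * bracket η + ε' * bracket (ξ - η)) ^ 2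

theorem timeResonance_eq (hε : ε ^ 2 = 1) (hε' : ε' ^ 2 = 1) (ξ η : E) :
    timeResonance ε ε' ξ η
      = 2 * inner ℝ η (ξ - η) - 1 - 2 * (ε * ε') * pairWeight ξ η := by
  rw [timeResonance, bracket_sq, norm_sq_eq_add_sub ξ η, pairWeight]
  linear_combination (-bracket η ^ 2) * hε - bracket (ξ - η) ^ 2 * hε' - bracket_sq η
    - bracket_sq (ξ - η)

theorem one_le_abs_timeResonance (hε : ε ^ 2 = 1) (hε' : ε' ^ 2 = 1) (ξ η : E) :
    1 ≤ |timeResonance ε ε' ξ η| := by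
  have hsub := abs_le.1 (abs_one_sub_inner_le ξ η)
  have hadd := abs_le.1 (abs_one_add_inner_le ξ η)
  have hsign : (ε * ε') ^ 2 = 1 := by rw [mul_pow, hε, hε', one_mul]
  rw [timeResonance_eq hε hε', le_abs]
  rcases sq_eq_one_iff.1 hsign with h | h <;> rw [h]
  · right
    linarith [one_le_pairWeight ξ η]
  · left
    linarith

end TimeResonance

section SymbolBounds

variable {E : Type*} [NormedAddCommGroup E] [InnerProductSpace ℝ E] {v : E}

theorem hasJetBound_one (ξ : E) : HasJetBound v (pairWeight ξ) 1 fun _ => (1 : ℂ) :=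
  (HasJetBound.const 1).mono fun η => by simpa using one_le_pairWeight ξ η

theorem hasJetBound_pairWeight (ξ : E) (hv : ‖v‖ ≤ 1) :
    HasJetBound v (pairWeight ξ) 16 fun η => (pairWeight ξ η : ℂ) := by
  have h := (hasJetBound_bracket hv).mul ((hasJetBound_bracket hv).comp_const_sub ξ)
  norm_num only at h
  simp only [← Complex.ofReal_mul] at h
  exact h

theorem dirDeriv_inner_sub (ξ : E) : dirDeriv v (fun η => (inner ℝ η (ξ - η) : ℂ))
    = fun η => ((inner ℝ v (ξ - η) - inner ℝ η v : ℝ) : ℂ) := by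
  ext η
  have h := (hasFDerivAt_id η).inner ℝ ((hasFDerivAt_id η).const_sub ξ)
  rw [dirDeriv_ofReal (f := fun η => inner ℝ η (ξ - η)) h]
  simp [fderivInnerCLM_apply, sub_eq_neg_add]

theorem dirDeriv_dirDeriv_inner_sub (ξ : E) :
    dirDeriv v (dirDeriv v fun η => (inner ℝ η (ξ - η) : ℂ))
      = fun _ => ((-2 * ‖v‖ ^ 2 : ℝ) : ℂ) := by
  rw [dirDeriv_inner_sub]
  ext η
  have h := ((hasFDerivAt_const v η).inner ℝ ((hasFDerivAt_id η).const_sub ξ)).sub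
    (hasFDerivAt_inner_left v η)
  rw [dirDeriv_ofReal (f := fun η => inner ℝ v (ξ - η) - inner ℝ η v) h]
  simp [fderivInnerCLM_apply]
  ring

theorem hasJetBound_inner (ξ : E) (hv : ‖v‖ ≤ 1) :
    HasJetBound v (pairWeight ξ) 2 fun η => (inner ℝ η (ξ - η) : ℂ) := by
  refine ⟨Complex.ofRealCLM.contDiff.comp (contDiff_id.inner ℝ (contDiff_const.sub contDiff_id)),
    fun η => ?_, fun η => ?_, fun η => ?_⟩
  · rw [Complex.norm_real, Real.norm_eq_abs, abs_le]
    have hadd := abs_le.1 (abs_one_add_inner_le ξ η)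
    constructor <;> linarith [one_le_pairWeight ξ η]
  · have hξη : |inner ℝ v (ξ - η)| ≤ ‖ξ - η‖ := (abs_real_inner_le_norm _ _).trans
      (mul_le_of_le_one_left (norm_nonneg _) hv)
    have hη : |inner ℝ η v| ≤ ‖η‖ := (abs_real_inner_le_norm _ _).trans
      (mul_le_of_le_one_right (norm_nonneg _) hv)
    rw [dirDeriv_inner_sub, Complex.norm_real, Real.norm_eq_abs]
    linarith [abs_sub (inner ℝ v (ξ - η)) (inner ℝ η v), norm_le_bracket η,
      norm_le_bracket (ξ - η), bracket_le_pairWeight ξ η, bracket_sub_le_pairWeight ξ η]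
  · rw [dirDeriv_dirDeriv_inner_sub, Complex.norm_real, Real.norm_eq_abs, abs_mul, abs_neg,
      abs_two, abs_sq]
    linarith [pow_le_one₀ (n := 2) (norm_nonneg v) hv, one_le_pairWeight ξ η]

theorem hasJetBound_bracket_add (ξ : E) (hv : ‖v‖ ≤ 1) :
    HasJetBound v (pairWeight ξ) 4 fun η => ((bracket η + bracket (ξ - η) : ℝ) : ℂ) := by
  have hη : HasJetBound v (pairWeight ξ) 2 fun η => (bracket η : ℂ) :=
    (hasJetBound_bracket hv).mono fun η => by
      gcongr
      exact bracket_le_pairWeight ξ η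
  have hξη : HasJetBound v (pairWeight ξ) 2 fun η => (bracket (ξ - η) : ℂ) :=
    ((hasJetBound_bracket hv).comp_const_sub ξ).mono fun η => by
      gcongr
      exact bracket_sub_le_pairWeight ξ η
  have h := hη.add hξη
  norm_num only at h
  simpa only [Complex.ofReal_add] using h

theorem hasJetBound_timeResonance {ε ε' : ℝ} (hε : ε ^ 2 = 1) (hε' : ε' ^ 2 = 1) (ξ : E)
    (hv : ‖v‖ ≤ 1) :
    HasJetBound v (pairWeight ξ) 148 fun η => (timeResonance ε ε' ξ η : ℂ) := by
  have hsign : ‖((-2 * (ε * ε') : ℝ) : ℂ)‖ = 2 := by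
    rw [Complex.norm_real, Real.norm_eq_abs, abs_mul, abs_mul, abs_eq_one_of_sq_eq_one hε,
      abs_eq_one_of_sq_eq_one hε']
    norm_num
  have h := (((hasJetBound_inner ξ hv).const_mul 2).add ((hasJetBound_one ξ).const_mul (-1))).add
    ((hasJetBound_pairWeight ξ hv).const_mul ((-2 * (ε * ε') : ℝ) : ℂ))
  rw [hsign, norm_neg, norm_one, Complex.norm_ofNat] at h
  norm_num only at h
  convert h using 2 with η
  rw [timeResonance_eq hε hε']
  push_cast
  ring

theorem exists_hasJetBound_inv_timeResonance : ∃ K, 0 ≤ K ∧ ∀ {ε ε' : ℝ} {ξ v : E},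
    ε ^ 2 = 1 → ε' ^ 2 = 1 → ‖v‖ ≤ 1 → HasJetBound v (fun η => pairWeight ξ η ^ 2) K
      fun η => (((timeResonance ε ε' ξ η)⁻¹ : ℝ) : ℂ) := by
  refine ⟨3 * 148 ^ 2, by norm_num, fun {ε ε' ξ v} hε hε' hv => ?_⟩
  have h := (hasJetBound_timeResonance hε hε' ξ hv).inv (by norm_num) (one_le_pairWeight ξ)
    fun η => by
      simpa only [Complex.norm_real, Real.norm_eq_abs] using one_le_abs_timeResonance hε hε' ξ η
  simpa only [Complex.ofReal_inv] using h

/-- The amplitude `⟨η⟩⟨ζ⟩(⟨η⟩⟨ζ⟩ + 1 + κ η·ζ)/(⟨η⟩ + ⟨ζ⟩)` with `ζ = ξ - η`, by which the phase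
`⟨η⟩ + κ⟨ζ⟩` has to be differentiated along its direction of fastest variation. -/
def phaseAmplitude (κ : ℝ) (ξ η : E) : ℝ :=
  pairWeight ξ η * (pairWeight ξ η + 1 + κ * inner ℝ η (ξ - η)) *
    (bracket η + bracket (ξ - η))⁻¹

theorem exists_hasJetBound_phaseAmplitude : ∃ K, 0 ≤ K ∧ ∀ {κ : ℝ} {ξ v : E}, κ ^ 2 = 1 →
    ‖v‖ ≤ 1 → HasJetBound v (fun η => pairWeight ξ η ^ 4) K
      fun η => (phaseAmplitude κ ξ η : ℂ) := by
  refine ⟨4 * (4 * 16 * (16 + 1 + 4 * 1 * 2)) * (3 * 4 ^ 2), by norm_num,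
    fun {κ ξ v} hκ hv => ?_⟩
  have hnum := ((hasJetBound_pairWeight ξ hv).add (hasJetBound_one ξ)).add
    ((hasJetBound_inner ξ hv).const_mul (κ : ℂ))
  rw [Complex.norm_real, Real.norm_eq_abs, abs_eq_one_of_sq_eq_one hκ] at hnum
  have hden := (hasJetBound_bracket_add ξ hv).inv (by norm_num) (one_le_pairWeight ξ) fun η => by
    rw [Complex.norm_real]
    exact le_trans (by linarith [one_le_bracket η, one_le_bracket (ξ - η)]) (Real.le_norm_self _)
  have h := ((hasJetBound_pairWeight ξ hv).mul hnum).mul hden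
  convert h using 2 with η η
  · ring
  · rw [phaseAmplitude]
    push_cast
    rfl

end SymbolBounds

section PairWeightIntegral

variable {n : ℕ} {ξ : Plane} {D : ℝ} {H : Plane → ℂ}

theorem integrable_inv_bracket_cube : Integrable fun η : Plane => (bracket η ^ 3)⁻¹ :=
  integrable_inv_bracket_pow (by simp)

theorem integrable_inv_pairWeight_pow (n : ℕ) (ξ : Plane) :
    Integrable fun η => (pairWeight ξ η ^ (n + 3))⁻¹ := by
  have hcont : Continuous fun η => (pairWeight ξ η ^ (n + 3))⁻¹ :=
    ((continuous_pairWeight ξ).pow _).inv₀ fun η => (pow_pos (pairWeight_pos ξ η) _).ne'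
  refine (integrable_inv_bracket_cube.const_mul (2 ^ n * (bracket ξ ^ n)⁻¹)).mono'
    hcont.aestronglyMeasurable (Eventually.of_forall fun η => ?_)
  rw [Real.norm_of_nonneg (inv_nonneg.2 (pow_pos (pairWeight_pos ξ η) _).le)]
  exact inv_pairWeight_pow_le n ξ η

/-- The total mass of `⟨η⟩⁻³` on the plane. -/
def inverseCubeMass : ℝ := ∫ η : Plane, (bracket η ^ 3)⁻¹

theorem inverseCubeMass_nonneg : 0 ≤ inverseCubeMass :=
  integral_nonneg fun η => inv_nonneg.2 (pow_pos (bracket_pos η) _).le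

theorem integrable_of_le_inv_pairWeight (hH : Continuous H)
    (h : ∀ η, ‖H η‖ ≤ D * (pairWeight ξ η ^ (n + 3))⁻¹) : Integrable H :=
  ((integrable_inv_pairWeight_pow n ξ).const_mul D).mono' hH.aestronglyMeasurable
    (Eventually.of_forall h)

theorem norm_integral_le_of_le_inv_pairWeight
    (h : ∀ η, ‖H η‖ ≤ D * (pairWeight ξ η ^ (n + 3))⁻¹) :
    ‖∫ η, H η‖ ≤ 2 ^ n * inverseCubeMass * D * (bracket ξ ^ n)⁻¹ := by
  have hD : 0 ≤ D := nonneg_of_mul_nonneg_left ((norm_nonneg _).trans (h 0))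
    (inv_pos.2 (pow_pos (pairWeight_pos ξ 0) _))
  have hle := norm_integral_le_of_norm_le
    (integrable_inv_bracket_cube.const_mul (D * (2 ^ n * (bracket ξ ^ n)⁻¹)))
    (Eventually.of_forall fun η => (h η).trans (by
      rw [mul_assoc]
      exact mul_le_mul_of_nonneg_left (inv_pairWeight_pow_le n ξ η) hD))
  rw [integral_const_mul] at hle
  refine hle.trans_eq ?_
  rw [inverseCubeMass]
  ring

theorem inv_pairWeight_pow_mul_pow_le {j : ℕ} (hj : j ≤ 8) (n : ℕ) (ξ η : Plane) :
    (pairWeight ξ η ^ (n + 11))⁻¹ * pairWeight ξ η ^ j ≤ (pairWeight ξ η ^ (n + 3))⁻¹ := by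
  have hpos := pairWeight_pos ξ η
  have hle := pow_le_pow_right₀ (one_le_pairWeight ξ η) hj
  rw [inv_mul_le_iff₀ (by positivity), ← div_eq_mul_inv, le_div_iff₀ (by positivity)]
  calc pairWeight ξ η ^ j * pairWeight ξ η ^ (n + 3)
      ≤ pairWeight ξ η ^ 8 * pairWeight ξ η ^ (n + 3) := by gcongr
    _ = pairWeight ξ η ^ (n + 11) := by ring

end PairWeightIntegral

section Phase

/-- The unimodular function `x ↦ e^{ix}`. -/
def expI (x : ℝ) : ℂ := Complex.exp (x * Complex.I)

theorem norm_expI (x : ℝ) : ‖expI x‖ = 1 := Complex.norm_exp_ofReal_mul_I x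

theorem continuous_expI : Continuous expI := by
  unfold expI
  fun_prop

theorem hasDerivAt_expI (x : ℝ) : HasDerivAt expI (Complex.I * expI x) x := by
  have h := ((hasDerivAt_id x).ofReal_comp.mul_const Complex.I).cexp
  rw [Complex.ofReal_one, one_mul, mul_comm] at h
  exact h

variable {E : Type*} [NormedAddCommGroup E]

/-- The phase `⟨η⟩ + κ⟨ξ - η⟩`. -/
def phase (κ : ℝ) (ξ η : E) : ℝ := bracket η + κ * bracket (ξ - η)

theorem continuous_phase (κ : ℝ) (ξ : E) : Continuous (phase κ ξ) :=
  continuous_bracket.add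
    ((continuous_bracket.comp (continuous_const.sub continuous_id)).const_mul κ)

variable [InnerProductSpace ℝ E] {κ : ℝ} {ξ η ω : E}

/-- The derivative of `phase κ ξ` at `η` in the direction `v`. -/
def phaseSlope (κ : ℝ) (ξ η v : E) : ℝ :=
  inner ℝ η v / bracket η - κ * (inner ℝ (ξ - η) v / bracket (ξ - η))

theorem hasFDerivAt_phase (κ : ℝ) (ξ η : E) :
    HasFDerivAt (phase κ ξ)
      ((bracket η)⁻¹ • innerSL ℝ η - (κ * (bracket (ξ - η))⁻¹) • innerSL ℝ (ξ - η)) η := by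
  have hsub : HasFDerivAt (fun η : E => ξ - η) (-ContinuousLinearMap.id ℝ E) η :=
    (hasFDerivAt_id η).const_sub ξ
  have hcomp := (hasFDerivAt_bracket (ξ - η)).comp η hsub
  refine ((hasFDerivAt_bracket η).add (hcomp.const_mul κ)).congr_fderiv ?_
  ext u
  simp
  ring

theorem hasFDerivAt_expI_phase (κ lam : ℝ) (ξ η : E) :
    HasFDerivAt (fun η => expI (lam * phase κ ξ η))
      ((lam • ((bracket η)⁻¹ • innerSL ℝ η
        - (κ * (bracket (ξ - η))⁻¹) • innerSL ℝ (ξ - η))).smulRight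
          (Complex.I * expI (lam * phase κ ξ η))) η := by
  refine ((hasDerivAt_expI (lam * phase κ ξ η)).hasFDerivAt.comp η
    ((hasFDerivAt_phase κ ξ η).const_mul lam)).congr_fderiv ?_
  ext u
  simp
  ring

theorem differentiable_expI_phase (κ lam : ℝ) (ξ : E) :
    Differentiable ℝ fun η => expI (lam * phase κ ξ η) :=
  fun η => (hasFDerivAt_expI_phase κ lam ξ η).differentiableAt

theorem dirDeriv_expI_phase (κ lam : ℝ) (ξ v η : E) :
    dirDeriv v (fun η => expI (lam * phase κ ξ η)) η
      = Complex.I * lam * phaseSlope κ ξ η v * expI (lam * phase κ ξ η) := by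
  rw [dirDeriv_eq_of_hasFDerivAt (hasFDerivAt_expI_phase κ lam ξ η), phaseSlope]
  simp [inner_sub_left]
  ring

theorem phaseSlope_smul (r : ℝ) (v : E) : phaseSlope κ ξ η (r • v) = r * phaseSlope κ ξ η v := by
  simp only [phaseSlope, real_inner_smul_right]
  ring

/-- The Gram determinant of `x` and `y`, i.e. the squared area of the parallelogram they span. -/
def gramDet (x y : E) : ℝ := ‖x‖ ^ 2 * ‖y‖ ^ 2 - inner ℝ x y ^ 2

theorem gramDet_nonneg (x y : E) : 0 ≤ gramDet x y :=
  sub_nonneg.2 (inner_sq_le_norm_sq_mul_norm_sq x y)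

theorem gramDet_smul_add_smul (a b c d : ℝ) (x y : E) :
    gramDet (a • x + b • y) (c • x + d • y) = (a * d - b * c) ^ 2 * gramDet x y := by
  simp only [gramDet, norm_add_sq_real, norm_smul, mul_pow, inner_add_left, inner_add_right,
    real_inner_smul_left, real_inner_smul_right, real_inner_self_eq_norm_sq, real_inner_comm x y,
    Real.norm_eq_abs, sq_abs]
  ring

theorem gramDet_add_smul (x y : E) (t : ℝ) : gramDet (x + t • y) y = gramDet x y := by
  simpa using gramDet_smul_add_smul 1 t 0 1 x y

theorem contDiff_gramDet (y : E) {n : WithTop ℕ∞} : ContDiff ℝ n fun x => gramDet x y :=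
  ((contDiff_norm_sq ℝ).mul contDiff_const).sub ((contDiff_id.inner ℝ contDiff_const).pow 2)

theorem phaseSlope_sub_smul (hκ : κ ^ 2 = 1) (ξ η : E) :
    phaseSlope κ ξ η (η - κ • (ξ - η)) = (bracket η + bracket (ξ - η)) *
      (pairWeight ξ η - (1 + κ * inner ℝ η (ξ - η))) / pairWeight ξ η := by
  have hη := bracket_pos η
  have hζ := bracket_pos (ξ - η)
  simp only [phaseSlope, pairWeight, inner_sub_right _ η (κ • (ξ - η)), real_inner_smul_right,
    real_inner_self_eq_norm_sq, real_inner_comm η (ξ - η)]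
  field_simp
  linear_combination (-bracket (ξ - η)) * bracket_sq η - bracket η * bracket_sq (ξ - η)
    + bracket η * ‖ξ - η‖ ^ 2 * hκ

theorem phaseAmplitude_mul_phaseSlope (hκ : κ ^ 2 = 1) (ξ η : E) :
    phaseAmplitude κ ξ η * phaseSlope κ ξ η (η - κ • (ξ - η))
      = ‖η - κ • (ξ - η)‖ ^ 2 + gramDet η (ξ - η) := by
  have hη := bracket_pos η
  have hζ := bracket_pos (ξ - η)
  have hpair := pairWeight_pos ξ η
  calc phaseAmplitude κ ξ η * phaseSlope κ ξ η (η - κ • (ξ - η))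
      = pairWeight ξ η ^ 2 - (1 + κ * inner ℝ η (ξ - η)) ^ 2 := by
        rw [phaseSlope_sub_smul hκ, phaseAmplitude]
        field_simp
        ring
    _ = ‖η - κ • (ξ - η)‖ ^ 2 + gramDet η (ξ - η) := by
        rw [pairWeight_sq, gramDet, norm_sub_sq_real η (κ • (ξ - η)), norm_smul, mul_pow,
          Real.norm_eq_abs, sq_abs, real_inner_smul_right]
        linear_combination (-‖ξ - η‖ ^ 2 - inner ℝ η (ξ - η) ^ 2) * hκ

theorem phaseAmplitude_neg_one_mul_phaseSlope {r : ℝ} (hω : ‖ω‖ = 1) (hξ : ξ = r • ω)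
    (η : E) :
    phaseAmplitude (-1) ξ η * phaseSlope (-1) ξ η ω = r * (1 + gramDet η ω) := by
  rcases eq_or_ne r 0 with rfl | hr
  · simp [hξ, phaseSlope, bracket, neg_div]
  have hdir : η - (-1 : ℝ) • (ξ - η) = r • ω := by
    rw [← hξ]
    module
  have hgram : gramDet η (ξ - η) = r ^ 2 * gramDet η ω := by
    rw [hξ]
    convert gramDet_smul_add_smul 1 0 (-1) r η ω using 2 <;> first | module | ring
  have h := phaseAmplitude_mul_phaseSlope (κ := -1) (by norm_num) ξ η
  rw [hdir, hgram, phaseSlope_smul, norm_smul, mul_pow, hω, Real.norm_eq_abs, sq_abs] at h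
  refine mul_left_cancel₀ hr ?_
  linear_combination h

theorem phaseAmplitude_one_mul_phaseSlope {ρ : ℝ} (hρ : ρ ≠ 0) (hω : ‖ω‖ = 1) (ξ : E) :
    2 * phaseAmplitude 1 ξ ((1 / 2 : ℝ) • ξ + ρ • ω)
      * phaseSlope 1 ξ ((1 / 2 : ℝ) • ξ + ρ • ω) ω = ρ * (4 + gramDet ω ξ) := by
  set η := (1 / 2 : ℝ) • ξ + ρ • ω with hη
  have hdir : η - (1 : ℝ) • (ξ - η) = (2 * ρ) • ω := by
    rw [hη]
    module
  have hgram : gramDet η (ξ - η) = ρ ^ 2 * gramDet ω ξ := by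
    rw [hη]
    convert gramDet_smul_add_smul ρ (1 / 2) (-ρ) (1 / 2) ω ξ using 2 <;> first | module | ring
  have h := phaseAmplitude_mul_phaseSlope (κ := 1) (by norm_num) ξ η
  rw [hdir, hgram, phaseSlope_smul, norm_smul, mul_pow, hω, Real.norm_eq_abs, sq_abs] at h
  refine mul_left_cancel₀ hρ ?_
  linear_combination h

end Phase

section IntegrationByParts

theorem mul_integral_mul_eq_neg_integral_mul_dirDeriv {V : Type*} [NormedAddCommGroup V]
    [NormedSpace ℝ V] [FiniteDimensional ℝ V] [MeasurableSpace V] [BorelSpace V] {μ : Measure V}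
    [μ.IsAddHaarMeasure] {v : V} {E c H : V → ℂ} {z : ℂ} (hE : Differentiable ℝ E)
    (hE_le : ∀ η, ‖E η‖ ≤ 1) (hcE : ∀ η, c η * dirDeriv v E η = z * E η)
    (hcH : Differentiable ℝ fun η => c η * H η) (hH_int : Integrable H μ)
    (hcH_int : Integrable (fun η => c η * H η) μ)
    (hcH'_int : Integrable (dirDeriv v fun η => c η * H η) μ) :
    z * ∫ η, E η * H η ∂μ = -∫ η, E η * dirDeriv v (fun η => c η * H η) η ∂μ := by
  have hderiv (η : V) : (c η * H η) * fderiv ℝ E η v = z * (E η * H η) := by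
    have := hcE η
    rw [dirDeriv] at this
    linear_combination H η * this
  have hE_meas : AEStronglyMeasurable E μ := hE.continuous.aestronglyMeasurable
  have hE_ae : ∀ᵐ η ∂μ, ‖E η‖ ≤ 1 := Eventually.of_forall hE_le
  have hparts := integral_mul_fderiv_eq_neg_fderiv_mul_of_integrable (μ := μ)
    (f := fun η => c η * H η) (g := E) (v := v)
    (hcH'_int.mul_bdd (c := 1) hE_meas hE_ae)
    (by simpa only [hderiv] using (hH_int.bdd_mul (c := 1) hE_meas hE_ae).const_mul z)
    (hcH_int.mul_bdd (c := 1) hE_meas hE_ae) (fun x _ => hcH x) (fun x _ => hE x)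
  simp only [hderiv, integral_const_mul] at hparts
  simp only [dirDeriv, mul_comm (E _) (fderiv ℝ _ _ v), hparts]

variable {n : ℕ} {ξ v : Plane} {D K : ℝ} {z : ℂ} {E c F : Plane → ℂ}

theorem mul_integral_eq_of_le_inv_pairWeight {H : Plane → ℂ} {D₀ D₁ D₂ : ℝ}
    (hE : Differentiable ℝ E) (hE_le : ∀ η, ‖E η‖ ≤ 1)
    (hcE : ∀ η, c η * dirDeriv v E η = z * E η)
    (hH : Continuous H) (hcH : ContDiff ℝ 1 fun η => c η * H η)
    (hH_le : ∀ η, ‖H η‖ ≤ D₀ * (pairWeight ξ η ^ (n + 3))⁻¹)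
    (hcH_le : ∀ η, ‖c η * H η‖ ≤ D₁ * (pairWeight ξ η ^ (n + 3))⁻¹)
    (hcH'_le : ∀ η, ‖dirDeriv v (fun η => c η * H η) η‖ ≤ D₂ * (pairWeight ξ η ^ (n + 3))⁻¹) :
    z * ∫ η, E η * H η = -∫ η, E η * dirDeriv v (fun η => c η * H η) η :=
  mul_integral_mul_eq_neg_integral_mul_dirDeriv hE hE_le hcE (hcH.differentiable one_ne_zero)
    (integrable_of_le_inv_pairWeight hH hH_le)
    (integrable_of_le_inv_pairWeight hcH.continuous hcH_le)
    (integrable_of_le_inv_pairWeight (contDiff_dirDeriv (n := 0) hcH).continuous hcH'_le)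

theorem norm_sq_mul_norm_integral_le (hE : Differentiable ℝ E) (hE_le : ∀ η, ‖E η‖ ≤ 1)
    (hcE : ∀ η, c η * dirDeriv v E η = z * E η)
    (hc : HasJetBound v (fun η => pairWeight ξ η ^ 4) K c)
    (hF : HasJetBound v (fun η => (pairWeight ξ η ^ (n + 11))⁻¹) D F) :
    ‖z‖ ^ 2 * ‖∫ η, E η * F η‖
      ≤ 2 ^ n * inverseCubeMass * (8 * K ^ 2 * D) * (bracket ξ ^ n)⁻¹ := by
  have hcF := hc.mul hF
  set F₁ := dirDeriv v fun η => c η * F η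
  have hcF₁ : ContDiff ℝ 1 fun η => c η * F₁ η :=
    (hc.contDiff.of_le one_le_two).mul hcF.contDiff_one_dirDeriv
  have hbound {j : ℕ} (hj : j ≤ 8) {C x : ℝ} (η : Plane)
      (hx : x ≤ C * (pairWeight ξ η ^ j * (pairWeight ξ η ^ (n + 11))⁻¹)) (hC : 0 ≤ C) :
      x ≤ C * (pairWeight ξ η ^ (n + 3))⁻¹ :=
    hx.trans (mul_le_mul_of_nonneg_left
      ((mul_comm _ _).trans_le (inv_pairWeight_pow_mul_pow_le hj n ξ η)) hC)
  have hK : 0 ≤ K := nonneg_of_mul_nonneg_left (hc.nonneg 0) (pow_pos (pairWeight_pos ξ 0) _)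
  have hD : 0 ≤ D :=
    nonneg_of_mul_nonneg_left (hF.nonneg 0) (inv_pos.2 (pow_pos (pairWeight_pos ξ 0) _))
  have hprod (η : Plane) {x y : ℂ} (hx : ‖x‖ ≤ K * pairWeight ξ η ^ 4)
      (hy : ‖y‖ ≤ 4 * K * D * (pairWeight ξ η ^ 4 * (pairWeight ξ η ^ (n + 11))⁻¹)) :
      ‖x * y‖ ≤ 4 * K ^ 2 * D * (pairWeight ξ η ^ (n + 3))⁻¹ :=
    hbound le_rfl η ((norm_mul_le_of_le hx hy).trans_eq (by ring)) (by positivity)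
  have hcF₁'_le (η : Plane) : ‖dirDeriv v (fun η => c η * F₁ η) η‖
      ≤ 8 * K ^ 2 * D * (pairWeight ξ η ^ (n + 3))⁻¹ := by
    rw [dirDeriv_mul hc.differentiable hcF.differentiable_dirDeriv]
    refine (norm_add_le_of_le (hprod η (hc.bound_dirDeriv η) (hcF.bound_dirDeriv η))
      (hprod η (hc.bound η) (hcF.bound_dirDeriv_dirDeriv η))).trans_eq ?_
    ring
  have hparts₀ := mul_integral_eq_of_le_inv_pairWeight hE hE_le hcE hF.contDiff.continuous
    (hcF.contDiff.of_le one_le_two)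
    (fun η => hbound (Nat.zero_le 8) η ((hF.bound η).trans_eq (by ring)) hD)
    (fun η => hbound (by norm_num) η (hcF.bound η) (by positivity))
    (fun η => hbound (by norm_num) η (hcF.bound_dirDeriv η) (by positivity))
  have hparts₁ := mul_integral_eq_of_le_inv_pairWeight hE hE_le hcE
    hcF.contDiff_one_dirDeriv.continuous hcF₁
    (fun η => hbound (by norm_num) η (hcF.bound_dirDeriv η) (by positivity))
    (fun η => hprod η (hc.bound η) (hcF.bound_dirDeriv η)) hcF₁'_le
  have htwice : z ^ 2 * ∫ η, E η * F η = ∫ η, E η * dirDeriv v (fun η => c η * F₁ η) η := by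
    linear_combination z * hparts₀ - hparts₁
  rw [← norm_pow, ← norm_mul, htwice]
  exact norm_integral_le_of_le_inv_pairWeight fun η => (norm_mul_le_of_le (hE_le η)
    (hcF₁'_le η)).trans_eq (one_mul _)

end IntegrationByParts

section DifferencePhase

variable {n : ℕ} {ξ : Plane} {D : ℝ} {F : Plane → ℂ}

theorem norm_integral_expI_mul_le (θ : Plane → ℝ)
    (hF : ∀ η, ‖F η‖ ≤ D * (pairWeight ξ η ^ (n + 3))⁻¹) :
    ‖∫ η, expI (θ η) * F η‖ ≤ 2 ^ n * inverseCubeMass * D * (bracket ξ ^ n)⁻¹ :=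
  norm_integral_le_of_le_inv_pairWeight fun η => by
    rw [norm_mul, norm_expI, one_mul]
    exact hF η

theorem HasJetBound.norm_le_inv_pairWeight {v : Plane}
    (hF : HasJetBound v (fun η => (pairWeight ξ η ^ (n + 11))⁻¹) D F) (η : Plane) :
    ‖F η‖ ≤ D * (pairWeight ξ η ^ (n + 3))⁻¹ := by
  have hD : 0 ≤ D :=
    nonneg_of_mul_nonneg_left (hF.nonneg 0) (inv_pos.2 (pow_pos (pairWeight_pos ξ 0) _))
  refine (hF.bound η).trans (mul_le_mul_of_nonneg_left ?_ hD)
  simpa only [pow_zero, mul_one] using inv_pairWeight_pow_mul_pow_le (Nat.zero_le 8) n ξ η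

theorem exists_hasJetBound_phaseAmplitude_div_gramDet {E : Type*} [NormedAddCommGroup E]
    [InnerProductSpace ℝ E] : ∃ K, 0 ≤ K ∧ ∀ {κ : ℝ} {ξ v : E}, κ ^ 2 = 1 → ‖v‖ ≤ 1 →
      HasJetBound v (fun η => pairWeight ξ η ^ 4) K
        fun η => (phaseAmplitude κ ξ η : ℂ) * (((1 + gramDet η v)⁻¹ : ℝ) : ℂ) := by
  obtain ⟨K, hK, hamp⟩ := exists_hasJetBound_phaseAmplitude (E := E)
  refine ⟨4 * K * 1, by positivity, fun {κ ξ v} hκ hv => ?_⟩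
  have hpos (η : E) : 0 < 1 + gramDet η v := by linarith [gramDet_nonneg η v]
  have hinv : HasJetBound v (fun _ => 1) 1 fun η => (((1 + gramDet η v)⁻¹ : ℝ) : ℂ) := by
    refine .of_invariant ?_ (fun η t => by rw [gramDet_add_smul]) fun η => ?_
    · exact Complex.ofRealCLM.contDiff.comp
        ((contDiff_const.add (contDiff_gramDet v)).inv fun η => (hpos η).ne')
    · rw [Complex.norm_real, Real.norm_of_nonneg (inv_nonneg.2 (hpos η).le)]
      exact inv_le_one_of_one_le₀ (by linarith [gramDet_nonneg η v])
  simpa only [mul_one] using (hamp hκ hv).mul hinv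

/-- The phase `⟨η⟩ - ⟨ξ - η⟩` is stationary only at the frequency `ξ = 0`. -/
theorem exists_norm_integral_difference_phase_le (n : ℕ) : ∃ K, 0 ≤ K ∧
    ∀ (ξ : Plane) (lam D : ℝ) (F : Plane → ℂ),
      (∀ v, ‖v‖ ≤ 1 → HasJetBound v (fun η => (pairWeight ξ η ^ (n + 11))⁻¹) D F) →
      ‖∫ η, expI (lam * phase (-1) ξ η) * F η‖ * (1 + lam ^ 2 * ‖ξ‖ ^ 2)
        ≤ K * D * (bracket ξ ^ n)⁻¹ := by
  obtain ⟨K, -, hc⟩ := exists_hasJetBound_phaseAmplitude_div_gramDet (E := Plane)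
  have hmass := inverseCubeMass_nonneg
  refine ⟨2 ^ n * inverseCubeMass * (1 + 8 * K ^ 2), by positivity, fun ξ lam D F hF => ?_⟩
  have htrivial := norm_integral_expI_mul_le (fun η => lam * phase (-1) ξ η)
    (hF 0 (by simp)).norm_le_inv_pairWeight
  suffices hmain : lam ^ 2 * ‖ξ‖ ^ 2 * ‖∫ η, expI (lam * phase (-1) ξ η) * F η‖
      ≤ 2 ^ n * inverseCubeMass * (8 * K ^ 2 * D) * (bracket ξ ^ n)⁻¹ by linarith
  obtain ⟨ω, hω, hξ⟩ : ∃ ω : Plane, ‖ω‖ = 1 ∧ ξ = ‖ξ‖ • ω := by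
    rcases eq_or_ne ξ 0 with rfl | hξ
    · obtain ⟨ω, hω⟩ := exists_norm_eq Plane zero_le_one
      exact ⟨ω, hω, by simp⟩
    · exact ⟨‖ξ‖⁻¹ • ξ, norm_smul_inv_norm hξ, (smul_inv_smul₀ (norm_ne_zero_iff.2 hξ) ξ).symm⟩
  have hcE (η : Plane) : (phaseAmplitude (-1) ξ η : ℂ) * (((1 + gramDet η ω)⁻¹ : ℝ) : ℂ) *
      dirDeriv ω (fun η => expI (lam * phase (-1) ξ η)) η
        = Complex.I * lam * ‖ξ‖ * expI (lam * phase (-1) ξ η) := by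
    have hslope : phaseAmplitude (-1) ξ η * (1 + gramDet η ω)⁻¹ * phaseSlope (-1) ξ η ω = ‖ξ‖ := by
      have hpos : 0 < 1 + gramDet η ω := by linarith [gramDet_nonneg η ω]
      rw [mul_right_comm, phaseAmplitude_neg_one_mul_phaseSlope hω hξ,
        mul_inv_cancel_right₀ hpos.ne']
    rw [dirDeriv_expI_phase, ← hslope]
    push_cast
    ring
  convert norm_sq_mul_norm_integral_le (differentiable_expI_phase (-1) lam ξ)
    (fun η => (norm_expI _).le) hcE (hc (by norm_num) hω.le) (hF ω hω.le) using 2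
  simp [mul_pow]

end DifferencePhase

section Polar

/-- The unit vector of the plane at angle `φ`. -/
def unitVector (φ : ℝ) : Plane := !₂[Real.cos φ, Real.sin φ]

theorem norm_unitVector (φ : ℝ) : ‖unitVector φ‖ = 1 := by
  simp [unitVector, EuclideanSpace.norm_eq]

theorem continuous_unitVector : Continuous unitVector := by
  unfold unitVector
  fun_prop

theorem integral_plane_eq_integral_prod (G : Plane → ℂ) :
    ∫ η, G η = ∫ p : ℝ × ℝ, G !₂[p.1, p.2] := by
  let e : Plane ≃ᵐ ℝ × ℝ :=
    (MeasurableEquiv.toLp 2 (Fin 2 → ℝ)).symm.trans MeasurableEquiv.finTwoArrow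
  have he : MeasurePreserving e volume volume :=
    (EuclideanSpace.volume_preserving_symm_measurableEquiv_toLp (Fin 2)).trans
      (volume_preserving_finTwoArrow ℝ)
  rw [← he.integral_comp']
  congr 1 with η
  congr 1
  ext i
  fin_cases i <;> rfl

theorem integral_eq_setIntegral_polar (G : Plane → ℂ) :
    ∫ η, G η = ∫ p in Set.Ioi (0 : ℝ) ×ˢ Set.Ioo (-Real.pi) Real.pi,
      (p.1 : ℂ) * G (p.1 • unitVector p.2) := by
  have hpolar (p : ℝ × ℝ) :
      (!₂[(polarCoord.symm p).1, (polarCoord.symm p).2] : Plane) = p.1 • unitVector p.2 := by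
    ext i
    fin_cases i <;> simp [unitVector]
  rw [integral_plane_eq_integral_prod, ← integral_comp_polarCoord_symm]
  simp only [hpolar, Complex.real_smul]
  rfl

theorem integrable_polar {G : Plane → ℂ} (hG : Continuous G) {B : ℝ}
    (hB : ∀ ρ φ : ℝ, 0 < ρ → ‖(ρ : ℂ) * G (ρ • unitVector φ)‖ ≤ B * (1 + ρ ^ 2)⁻¹) :
    Integrable (fun p : ℝ × ℝ => (p.1 : ℂ) * G (p.1 • unitVector p.2))
      ((volume.restrict (Set.Ioi 0)).prod (volume.restrict (Set.Ioo (-Real.pi) Real.pi))) := by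
  have hdom : Integrable (fun p : ℝ × ℝ => B * (1 + p.1 ^ 2)⁻¹)
      ((volume.restrict (Set.Ioi 0)).prod (volume.restrict (Set.Ioo (-Real.pi) Real.pi))) :=
    ((integrable_inv_one_add_sq.const_mul B).integrableOn).comp_fst _
  have hcont : Continuous fun p : ℝ × ℝ => (p.1 : ℂ) * G (p.1 • unitVector p.2) :=
    (Complex.continuous_ofReal.comp continuous_fst).mul
      (hG.comp (continuous_fst.smul (continuous_unitVector.comp continuous_snd)))
  refine hdom.mono' hcont.aestronglyMeasurable ?_
  rw [Measure.prod_restrict]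
  filter_upwards [ae_restrict_mem (measurableSet_Ioi.prod measurableSet_Ioo)] with p hp
  exact hB p.1 p.2 hp.1

theorem integral_eq_integral_integral_polar {G : Plane → ℂ} (hG : Continuous G) {B : ℝ}
    (hB : ∀ ρ φ : ℝ, 0 < ρ → ‖(ρ : ℂ) * G (ρ • unitVector φ)‖ ≤ B * (1 + ρ ^ 2)⁻¹) :
    ∫ η, G η = ∫ φ in Set.Ioo (-Real.pi) Real.pi, ∫ ρ in Set.Ioi (0 : ℝ),
      (ρ : ℂ) * G (ρ • unitVector φ) := by
  rw [integral_eq_setIntegral_polar, Measure.volume_eq_prod, ← Measure.prod_restrict,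
    integral_prod_symm _ (integrable_polar hG hB)]

theorem norm_const_mul_integral_le_of_forall_ray {G : Plane → ℂ} (hG : Continuous G) {B M : ℝ}
    (hB : ∀ ρ φ : ℝ, 0 < ρ → ‖(ρ : ℂ) * G (ρ • unitVector φ)‖ ≤ B * (1 + ρ ^ 2)⁻¹) (z : ℂ)
    (hM : ∀ φ, ‖z * ∫ ρ in Set.Ioi (0 : ℝ), (ρ : ℂ) * G (ρ • unitVector φ)‖ ≤ M) :
    ‖z * ∫ η, G η‖ ≤ 2 * Real.pi * M := by
  rw [integral_eq_integral_integral_polar hG hB, ← integral_const_mul]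
  refine (norm_integral_le_of_norm_le_const (Eventually.of_forall hM)).trans_eq ?_
  rw [measureReal_restrict_apply_univ, Real.volume_real_Ioo_of_le (by linarith [Real.pi_pos])]
  ring

end Polar

section RadialIntegral

variable {M : ℝ}

theorem norm_integral_Ioi_le_of_le_inv_one_add_sq {f : ℝ → ℂ}
    (hf : ∀ x, ‖f x‖ ≤ M * (1 + x ^ 2)⁻¹) : ‖∫ x in Set.Ioi (0 : ℝ), f x‖ ≤ M * Real.pi := by
  have hdom : Integrable fun x : ℝ => M * (1 + x ^ 2)⁻¹ := integrable_inv_one_add_sq.const_mul M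
  calc ‖∫ x in Set.Ioi (0 : ℝ), f x‖ ≤ ∫ x in Set.Ioi (0 : ℝ), M * (1 + x ^ 2)⁻¹ :=
        norm_integral_le_of_norm_le hdom.integrableOn (Eventually.of_forall hf)
    _ ≤ ∫ x : ℝ, M * (1 + x ^ 2)⁻¹ := setIntegral_le_integral hdom
        (Eventually.of_forall fun x => (norm_nonneg _).trans (hf x))
    _ = M * Real.pi := by rw [integral_const_mul, integral_univ_inv_one_add_sq]

theorem tendsto_zero_of_le_inv_one_add_sq {f : ℝ → ℂ} (hf : ∀ x, ‖f x‖ ≤ M * (1 + x ^ 2)⁻¹) :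
    Tendsto f atTop (𝓝 0) := by
  have hatTop : Tendsto (fun x : ℝ => 1 + x ^ 2) atTop atTop :=
    tendsto_atTop_add_const_left _ _ (tendsto_pow_atTop two_ne_zero)
  exact squeeze_zero_norm hf (by simpa using hatTop.inv_tendsto_atTop.const_mul M)

theorem norm_integral_Ioi_mul_deriv_le {H H' E E' : ℝ → ℂ}
    (hH : ∀ x, HasDerivAt H (H' x) x) (hE : ∀ x, HasDerivAt E (E' x) x) (hE_le : ∀ x, ‖E x‖ ≤ 1)
    (hH_le : ∀ x, ‖H x‖ ≤ M * (1 + x ^ 2)⁻¹) (hH'_le : ∀ x, ‖H' x‖ ≤ M * (1 + x ^ 2)⁻¹)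
    (hH' : Continuous H') (hint : IntegrableOn (fun x => H x * E' x) (Set.Ioi 0)) :
    ‖∫ x in Set.Ioi (0 : ℝ), H x * E' x‖ ≤ M * (1 + Real.pi) := by
  have hEc : Continuous E := continuous_iff_continuousAt.2 fun x => (hE x).continuousAt
  have hHc : Continuous H := continuous_iff_continuousAt.2 fun x => (hH x).continuousAt
  have hmul {g : ℝ → ℂ} (hg : ∀ x, ‖g x‖ ≤ M * (1 + x ^ 2)⁻¹) (x : ℝ) :
      ‖g x * E x‖ ≤ M * (1 + x ^ 2)⁻¹ :=
    (norm_mul_le_of_le (hg x) (hE_le x)).trans_eq (mul_one _)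
  have hint' : Integrable fun x => H' x * E x :=
    (integrable_inv_one_add_sq.const_mul M).mono' (hH'.mul hEc).aestronglyMeasurable
      (Eventually.of_forall (hmul hH'_le))
  have hparts := integral_Ioi_mul_deriv_eq_deriv_mul (a := (0 : ℝ)) (fun x _ => hH x)
    (fun x _ => hE x) hint hint'.integrableOn (hHc.mul hEc).continuousWithinAt
    (tendsto_zero_of_le_inv_one_add_sq (hmul hH_le))
  have hboundary : ‖-(H 0 * E 0)‖ ≤ M := by simpa using hmul hH_le 0
  rw [hparts, zero_sub, Pi.mul_apply]
  linarith [norm_sub_le_of_le hboundary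
    (norm_integral_Ioi_le_of_le_inv_one_add_sq (hmul hH'_le))]

end RadialIntegral

section SumPhase

variable {E : Type*} [NormedAddCommGroup E] [InnerProductSpace ℝ E]

theorem one_add_sq_le_pairWeight_sq {ω : E} (hω : ‖ω‖ = 1) (ξ : E) (ρ : ℝ) :
    1 + ρ ^ 2 ≤ pairWeight ξ ((1 / 2 : ℝ) • ξ + ρ • ω) ^ 2 := by
  set η := (1 / 2 : ℝ) • ξ + ρ • ω with hη
  have hpar := parallelogram_law_with_norm ℝ η (ξ - η)
  have hdiff : η - (ξ - η) = (2 * ρ) • ω := by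
    rw [hη]
    module
  rw [hdiff, norm_smul, hω, mul_one, Real.norm_eq_abs, sq_abs] at hpar
  rw [pairWeight_sq]
  nlinarith [sq_nonneg ‖η + (ξ - η)‖, mul_nonneg (sq_nonneg ‖η‖) (sq_nonneg ‖ξ - η‖)]

theorem one_add_abs_mul_inv_pairWeight_pow_le {ω : E} (hω : ‖ω‖ = 1) (n : ℕ) (ξ : E) (ρ : ℝ) :
    (1 + |ρ|) * (pairWeight ξ ((1 / 2 : ℝ) • ξ + ρ • ω) ^ (n + 3))⁻¹
      ≤ 2 * 2 ^ n * (bracket ξ ^ n)⁻¹ * (1 + ρ ^ 2)⁻¹ := by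
  have hsq := one_add_sq_le_pairWeight_sq hω ξ ρ
  set η := (1 / 2 : ℝ) • ξ + ρ • ω
  have hone := one_le_pairWeight ξ η
  have hξ := bracket_pos ξ
  have hρ : 1 + |ρ| ≤ 2 * pairWeight ξ η := by
    linarith [abs_le_of_sq_le_sq (a := ρ) (by linarith) (pairWeight_pos ξ η).le]
  have hξη := pow_le_pow_left₀ hξ.le (bracket_le_two_mul_pairWeight ξ η) n
  rw [mul_assoc, ← mul_inv, ← div_eq_mul_inv, ← div_eq_mul_inv,
    div_le_div_iff₀ (by positivity) (by positivity)]
  calc (1 + |ρ|) * (bracket ξ ^ n * (1 + ρ ^ 2))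
      ≤ (2 * pairWeight ξ η) * ((2 * pairWeight ξ η) ^ n * pairWeight ξ η ^ 2) := by gcongr
    _ = 2 * 2 ^ n * pairWeight ξ η ^ (n + 3) := by ring

variable {n : ℕ} {ξ ω : Plane} {D K lam : ℝ} {F : Plane → ℂ}

/-- The oscillatory integrand with phase `⟨η⟩ + ⟨ξ - η⟩` as a function of the displacement
`y = η - ξ / 2` from the stationary point. -/
def sumPhaseIntegrand (lam : ℝ) (ξ : Plane) (F : Plane → ℂ) (y : Plane) : ℂ :=
  expI (lam * phase 1 ξ ((1 / 2 : ℝ) • ξ + y)) * F ((1 / 2 : ℝ) • ξ + y)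

theorem continuous_sumPhaseIntegrand (hF : Continuous F) :
    Continuous (sumPhaseIntegrand lam ξ F) := by
  have hshift : Continuous fun y : Plane => (1 / 2 : ℝ) • ξ + y := by fun_prop
  exact (continuous_expI.comp (((continuous_phase 1 ξ).comp hshift).const_mul lam)).mul
    (hF.comp hshift)

theorem integral_sumPhaseIntegrand :
    ∫ y, sumPhaseIntegrand lam ξ F y = ∫ η, expI (lam * phase 1 ξ η) * F η :=
  integral_add_left_eq_self (fun η => expI (lam * phase 1 ξ η) * F η) _

theorem norm_mul_sumPhaseIntegrand_le (hω : ‖ω‖ = 1)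
    (hF : ∀ η, ‖F η‖ ≤ D * (pairWeight ξ η ^ (n + 3))⁻¹) {ρ : ℝ} (hρ : 0 < ρ) :
    ‖(ρ : ℂ) * sumPhaseIntegrand lam ξ F (ρ • ω)‖
      ≤ D * (2 * 2 ^ n * (bracket ξ ^ n)⁻¹) * (1 + ρ ^ 2)⁻¹ := by
  have hradial := one_add_abs_mul_inv_pairWeight_pow_le hω n ξ ρ
  rw [sumPhaseIntegrand]
  set η := (1 / 2 : ℝ) • ξ + ρ • ω
  have hpos : 0 < (pairWeight ξ η ^ (n + 3))⁻¹ := inv_pos.2 (pow_pos (pairWeight_pos _ _) _)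
  have hD : 0 ≤ D := nonneg_of_mul_nonneg_left ((norm_nonneg _).trans (hF η)) hpos
  rw [norm_mul, norm_mul, norm_expI, one_mul, Complex.norm_real, Real.norm_of_nonneg hρ.le]
  rw [abs_of_pos hρ] at hradial
  calc ρ * ‖F η‖ ≤ (1 + ρ) * (D * (pairWeight ξ η ^ (n + 3))⁻¹) := by
        gcongr
        · linarith
        · exact hF η
    _ = D * ((1 + ρ) * (pairWeight ξ η ^ (n + 3))⁻¹) := by ring
    _ ≤ D * (2 * 2 ^ n * (bracket ξ ^ n)⁻¹ * (1 + ρ ^ 2)⁻¹) := by gcongr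
    _ = D * (2 * 2 ^ n * (bracket ξ ^ n)⁻¹) * (1 + ρ ^ 2)⁻¹ := by ring

theorem integrableOn_mul_sumPhaseIntegrand (hω : ‖ω‖ = 1) (hFc : Continuous F)
    (hF : ∀ η, ‖F η‖ ≤ D * (pairWeight ξ η ^ (n + 3))⁻¹) :
    IntegrableOn (fun ρ : ℝ => (ρ : ℂ) * sumPhaseIntegrand lam ξ F (ρ • ω)) (Set.Ioi 0) := by
  have hcont : Continuous fun ρ : ℝ => (ρ : ℂ) * sumPhaseIntegrand lam ξ F (ρ • ω) :=
    Complex.continuous_ofReal.mul ((continuous_sumPhaseIntegrand hFc).comp (by fun_prop))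
  refine (integrable_inv_one_add_sq.const_mul
    (D * (2 * 2 ^ n * (bracket ξ ^ n)⁻¹))).integrableOn.mono' hcont.aestronglyMeasurable ?_
  filter_upwards [ae_restrict_mem measurableSet_Ioi] with ρ hρ
  exact norm_mul_sumPhaseIntegrand_le hω hF hρ

theorem mul_sumPhaseIntegrand_eq (hω : ‖ω‖ = 1) {ρ : ℝ} (hρ : ρ ≠ 0) :
    Complex.I * lam * (ρ * sumPhaseIntegrand lam ξ F (ρ • ω))
      = ((2 * (4 + gramDet ω ξ)⁻¹ : ℝ) : ℂ) * phaseAmplitude 1 ξ ((1 / 2 : ℝ) • ξ + ρ • ω)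
        * F ((1 / 2 : ℝ) • ξ + ρ • ω)
        * dirDeriv ω (fun η => expI (lam * phase 1 ξ η)) ((1 / 2 : ℝ) • ξ + ρ • ω) := by
  have hpos : 0 < 4 + gramDet ω ξ := by linarith [gramDet_nonneg ω ξ]
  have hslope : 2 * phaseAmplitude 1 ξ ((1 / 2 : ℝ) • ξ + ρ • ω)
      * phaseSlope 1 ξ ((1 / 2 : ℝ) • ξ + ρ • ω) ω * (4 + gramDet ω ξ)⁻¹ = ρ := by
    rw [phaseAmplitude_one_mul_phaseSlope hρ hω, mul_inv_cancel_right₀ hpos.ne']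
  have hslope' := congrArg (fun x : ℝ => (x : ℂ)) hslope
  push_cast at hslope'
  rw [dirDeriv_expI_phase, sumPhaseIntegrand, ← hslope']
  push_cast
  ring

theorem norm_le_inv_one_add_sq_of_le_pairWeight (hω : ‖ω‖ = 1) (hD : 0 ≤ D) (ρ : ℝ) {x : ℂ}
    (hx : ‖x‖ ≤ D * (pairWeight ξ ((1 / 2 : ℝ) • ξ + ρ • ω) ^ 4
      * (pairWeight ξ ((1 / 2 : ℝ) • ξ + ρ • ω) ^ (n + 11))⁻¹)) :
    ‖x‖ ≤ D * (2 * 2 ^ n * (bracket ξ ^ n)⁻¹) * (1 + ρ ^ 2)⁻¹ := by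
  have hradial := one_add_abs_mul_inv_pairWeight_pow_le hω n ξ ρ
  set η := (1 / 2 : ℝ) • ξ + ρ • ω
  have hpos : 0 < (pairWeight ξ η ^ (n + 3))⁻¹ := inv_pos.2 (pow_pos (pairWeight_pos _ _) _)
  calc ‖x‖ ≤ D * ((pairWeight ξ η ^ (n + 11))⁻¹ * pairWeight ξ η ^ 4) :=
        hx.trans_eq (by rw [mul_comm (pairWeight ξ η ^ 4)])
    _ ≤ D * (pairWeight ξ η ^ (n + 3))⁻¹ := by
        gcongr
        exact inv_pairWeight_pow_mul_pow_le (by norm_num) n ξ η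
    _ ≤ D * ((1 + |ρ|) * (pairWeight ξ η ^ (n + 3))⁻¹) := by
        gcongr
        exact le_mul_of_one_le_left hpos.le (le_add_of_nonneg_right (abs_nonneg ρ))
    _ ≤ D * (2 * 2 ^ n * (bracket ξ ^ n)⁻¹ * (1 + ρ ^ 2)⁻¹) := by gcongr
    _ = D * (2 * 2 ^ n * (bracket ξ ^ n)⁻¹) * (1 + ρ ^ 2)⁻¹ := by ring

theorem norm_mul_integral_ray_le (hω : ‖ω‖ = 1) (hK : 0 ≤ K) (hD : 0 ≤ D)
    (hamp : HasJetBound ω (fun η => pairWeight ξ η ^ 4) K fun η => (phaseAmplitude 1 ξ η : ℂ))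
    (hF : HasJetBound ω (fun η => (pairWeight ξ η ^ (n + 11))⁻¹) D F) :
    ‖Complex.I * lam * ∫ ρ in Set.Ioi (0 : ℝ), (ρ : ℂ) * sumPhaseIntegrand lam ξ F (ρ • ω)‖
      ≤ 16 * K * D * (2 * 2 ^ n * (bracket ξ ^ n)⁻¹) * (1 + Real.pi) := by
  set z : ℂ := ((2 * (4 + gramDet ω ξ)⁻¹ : ℝ) : ℂ) with hz
  have hz_le : ‖z‖ ≤ 1 := by
    have hpos : 0 < 4 + gramDet ω ξ := by linarith [gramDet_nonneg ω ξ]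
    rw [hz, Complex.norm_real, Real.norm_of_nonneg (by positivity), ← div_eq_mul_inv,
      div_le_one hpos]
    linarith [gramDet_nonneg ω ξ]
  have hjet : HasJetBound ω (fun η => pairWeight ξ η ^ 4 * (pairWeight ξ η ^ (n + 11))⁻¹)
      (16 * K * D) fun η => z * phaseAmplitude 1 ξ η * F η := by
    refine ((hamp.const_mul z).mul hF).mono fun η => ?_
    have hpos := pairWeight_pos ξ η
    calc 4 * (4 * ‖z‖ * K) * D * (pairWeight ξ η ^ 4 * (pairWeight ξ η ^ (n + 11))⁻¹)
        ≤ 4 * (4 * 1 * K) * D * (pairWeight ξ η ^ 4 * (pairWeight ξ η ^ (n + 11))⁻¹) := by gcongr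
      _ = 16 * K * D * (pairWeight ξ η ^ 4 * (pairWeight ξ η ^ (n + 11))⁻¹) := by ring
  have hray := fun (ρ : ℝ) (hρ : ρ ∈ Set.Ioi (0 : ℝ)) =>
    mul_sumPhaseIntegrand_eq (F := F) (lam := lam) (ξ := ξ) hω (ne_of_gt hρ)
  have hint := IntegrableOn.congr_fun ((integrableOn_mul_sumPhaseIntegrand (lam := lam) hω
    hF.contDiff.continuous hF.norm_le_inv_pairWeight).const_mul (Complex.I * lam))
    hray measurableSet_Ioi
  rw [← integral_const_mul, setIntegral_congr_fun measurableSet_Ioi hray]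
  exact norm_integral_Ioi_mul_deriv_le (fun ρ => hasDerivAt_comp_line (hjet.differentiable _))
    (fun ρ => hasDerivAt_comp_line (differentiable_expI_phase 1 lam ξ _))
    (fun ρ => (norm_expI _).le)
    (fun ρ => norm_le_inv_one_add_sq_of_le_pairWeight hω (by positivity) ρ (hjet.bound _))
    (fun ρ => norm_le_inv_one_add_sq_of_le_pairWeight hω (by positivity) ρ
      (hjet.bound_dirDeriv _))
    (hjet.contDiff_one_dirDeriv.continuous.comp (by fun_prop)) hint

/-- The phase `⟨η⟩ + ⟨ξ - η⟩` is stationary at `η = ξ / 2` for every `ξ`; in polar coordinates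
about that point the Jacobian `ρ` makes up for the degeneracy, at the price of only one power. -/
theorem exists_norm_integral_sum_phase_le (n : ℕ) : ∃ K, 0 ≤ K ∧
    ∀ (ξ : Plane) (lam D : ℝ) (F : Plane → ℂ),
      (∀ v, ‖v‖ ≤ 1 → HasJetBound v (fun η => (pairWeight ξ η ^ (n + 11))⁻¹) D F) →
      ‖∫ η, expI (lam * phase 1 ξ η) * F η‖ * (1 + |lam|) ≤ K * D * (bracket ξ ^ n)⁻¹ := by
  obtain ⟨K, hK, hamp⟩ := exists_hasJetBound_phaseAmplitude (E := Plane)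
  have hmass := inverseCubeMass_nonneg
  refine ⟨2 ^ n * inverseCubeMass + 2 * Real.pi * (16 * K * (2 * 2 ^ n) * (1 + Real.pi)),
    by positivity, fun ξ lam D F hF => ?_⟩
  have hF₀ := hF 0 (by simp)
  have hD : 0 ≤ D :=
    nonneg_of_mul_nonneg_left (hF₀.nonneg 0) (inv_pos.2 (pow_pos (pairWeight_pos ξ 0) _))
  have htrivial := norm_integral_expI_mul_le (fun η => lam * phase 1 ξ η)
    hF₀.norm_le_inv_pairWeight
  have hpolar := norm_const_mul_integral_le_of_forall_ray
    (continuous_sumPhaseIntegrand (lam := lam) (ξ := ξ) hF₀.contDiff.continuous)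
    (fun ρ φ hρ => norm_mul_sumPhaseIntegrand_le (norm_unitVector φ) hF₀.norm_le_inv_pairWeight hρ)
    (Complex.I * lam)
    (fun φ => norm_mul_integral_ray_le (norm_unitVector φ) hK hD
      (hamp (by norm_num) (norm_unitVector φ).le) (hF _ (norm_unitVector φ).le))
  rw [integral_sumPhaseIntegrand, norm_mul, norm_mul, Complex.norm_I, one_mul,
    Complex.norm_real, Real.norm_eq_abs] at hpolar
  linarith

end SumPhase

section JetDecay

/-- `A` is a `C²` function which, together with its first two derivatives, is bounded by
`D ⟨η⟩⁻ᵏ`: the regularity asked of the profile of a half wave. -/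
def HasJetDecay {E : Type*} [NormedAddCommGroup E] [NormedSpace ℝ E] (k : ℕ) (D : ℝ)
    (A : E → ℂ) : Prop :=
  ∀ v, ‖v‖ ≤ 1 → HasJetBound v (fun η => (bracket η ^ k)⁻¹) D A

namespace HasJetDecay

section Normed

variable {E : Type*} [NormedAddCommGroup E] [NormedSpace ℝ E] {k : ℕ} {D D' : ℝ} {A B : E → ℂ}

theorem continuous (hA : HasJetDecay k D A) : Continuous A := (hA 0 (by simp)).contDiff.continuous

theorem norm_le (hA : HasJetDecay k D A) (η : E) : ‖A η‖ ≤ D * (bracket η ^ k)⁻¹ :=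
  (hA 0 (by simp)).bound η

theorem nonneg (hA : HasJetDecay k D A) : 0 ≤ D :=
  nonneg_of_mul_nonneg_left ((hA 0 (by simp)).nonneg 0) (inv_pos.2 (pow_pos (bracket_pos 0) k))

theorem mono (hA : HasJetDecay k D A) {j : ℕ} (hj : j ≤ k) (hD : D ≤ D') : HasJetDecay j D' A := by
  refine fun v hv => (hA v hv).mono fun η => ?_
  have hη := bracket_pos η
  exact mul_le_mul hD (inv_anti₀ (by positivity) (pow_le_pow_right₀ (one_le_bracket η) hj))
    (by positivity) (hA.nonneg.trans hD)

theorem add (hA : HasJetDecay k D A) (hB : HasJetDecay k D' B) :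
    HasJetDecay k (D + D') fun η => A η + B η :=
  fun v hv => (hA v hv).add (hB v hv)

theorem const_mul (hA : HasJetDecay k D A) (c : ℂ) :
    HasJetDecay k (4 * ‖c‖ * D) fun η => c * A η :=
  fun v hv => (hA v hv).const_mul c

theorem continuousLinearMap_mul (hA : HasJetDecay (k + 1) D A) (L : E →L[ℝ] ℝ) (hL : ‖L‖ ≤ 1) :
    HasJetDecay k (4 * D) fun η => (L η : ℂ) * A η := by
  refine fun v hv => ((HasJetBound.ofReal_continuousLinearMap L hL hv).mul (hA v hv)).mono
    fun η => le_of_eq ?_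
  have hη := (bracket_pos η).ne'
  rw [pow_succ]
  field_simp

theorem integrable [MeasurableSpace E] [BorelSpace E] [FiniteDimensional ℝ E]
    {μ : Measure E} [μ.IsAddHaarMeasure] (hA : HasJetDecay k D A)
    (hk : Module.finrank ℝ E < k) : Integrable A μ :=
  ((integrable_inv_bracket_pow hk).const_mul D).mono' hA.continuous.aestronglyMeasurable
    (Eventually.of_forall hA.norm_le)

end Normed

variable {E : Type*} [NormedAddCommGroup E] [InnerProductSpace ℝ E] {k : ℕ} {D : ℝ} {A : E → ℂ}

theorem bracket_mul (hA : HasJetDecay (k + 1) D A) :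
    HasJetDecay k (8 * D) fun η => (bracket η : ℂ) * A η := by
  refine fun v hv => ((hasJetBound_bracket hv).mul (hA v hv)).mono fun η => le_of_eq ?_
  have hη := (bracket_pos η).ne'
  rw [pow_succ]
  field_simp
  ring

theorem inv_bracket_mul (hA : HasJetDecay (k + 2) D A) :
    HasJetDecay k (48 * D) fun η => ((bracket η : ℂ))⁻¹ * A η := by
  intro v hv
  have hinv := (hasJetBound_bracket hv).inv one_le_two one_le_bracket fun η => by
    rw [Complex.norm_real]
    exact (one_le_bracket η).trans (Real.le_norm_self _)
  refine (hinv.mul (hA v hv)).mono fun η => le_of_eq ?_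
  have hη := (bracket_pos η).ne'
  rw [pow_add]
  field_simp
  ring

end HasJetDecay

end JetDecay

section PairPhase

variable {E : Type*} [NormedAddCommGroup E] {ε ε' : ℝ}

/-- The phase `ε⟨η⟩ + ε'⟨ξ - η⟩` of the interaction of two half waves; the signs `ε` and `ε'` tell
the direction of time in each of them. -/
def pairPhase (ε ε' : ℝ) (ξ η : E) : ℝ := ε * bracket η + ε' * bracket (ξ - η)

theorem pairPhase_eq_mul_phase (hε : ε ^ 2 = 1) (ξ η : E) :
    pairPhase ε ε' ξ η = ε * phase (ε * ε') ξ η := by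
  rw [pairPhase, phase]
  linear_combination (-ε' * bracket (ξ - η)) * hε

theorem abs_pairPhase_le (hε : ε ^ 2 = 1) (hε' : ε' ^ 2 = 1) (ξ η : E) :
    |pairPhase ε ε' ξ η| ≤ 2 * pairWeight ξ η :=
  calc |pairPhase ε ε' ξ η| ≤ |ε * bracket η| + |ε' * bracket (ξ - η)| := abs_add_le _ _
    _ = bracket η + bracket (ξ - η) := by
        rw [abs_mul, abs_mul, abs_eq_one_of_sq_eq_one hε, abs_eq_one_of_sq_eq_one hε',
          abs_of_pos (bracket_pos _), abs_of_pos (bracket_pos _), one_mul, one_mul]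
    _ ≤ 2 * pairWeight ξ η := by
        linarith [bracket_le_pairWeight ξ η, bracket_sub_le_pairWeight ξ η]

theorem continuous_pairPhase : Continuous fun p : E × E => pairPhase ε ε' p.1 p.2 :=
  ((continuous_bracket.comp continuous_snd).const_mul ε).add
    ((continuous_bracket.comp (continuous_fst.sub continuous_snd)).const_mul ε')

theorem continuous_expI_pairPhase (s : ℝ) :
    Continuous fun p : E × E => expI (s * pairPhase ε ε' p.1 p.2) :=
  continuous_expI.comp (continuous_pairPhase.const_mul s)

end PairPhase

section PairIntegral

/-- `H (ξ, η)` is continuous and bounded by `D (⟨η⟩⟨ξ - η⟩)⁻ᵏ`. -/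
structure IsDecayingKernel {E : Type*} [NormedAddCommGroup E] (k : ℕ) (D : ℝ) (H : E × E → ℂ) :
    Prop where
  continuous : Continuous H
  bound : ∀ ξ η, ‖H (ξ, η)‖ ≤ D * (pairWeight ξ η ^ k)⁻¹

/-- The kernel `A(η) B(ξ - η)` of a convolution. -/
def convolutionKernel {E : Type*} [AddGroup E] (A B : E → ℂ) (p : E × E) : ℂ :=
  A p.2 * B (p.1 - p.2)

/-- Multiplication of a kernel by `i (ε⟨η⟩ + ε'⟨ξ - η⟩)`, the effect of a time derivative. -/
def phaseMul {E : Type*} [NormedAddCommGroup E] (ε ε' : ℝ) (H : E × E → ℂ) (p : E × E) : ℂ :=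
  Complex.I * pairPhase ε ε' p.1 p.2 * H p

/-- Division of a kernel by the time resonance function, which solves the oscillator equation
`∂ₛ² + ⟨ξ⟩²`. -/
def resonanceDiv {E : Type*} [NormedAddCommGroup E] (ε ε' : ℝ) (H : E × E → ℂ) (p : E × E) : ℂ :=
  H p * ((timeResonance ε ε' p.1 p.2)⁻¹ : ℝ)

/-- The oscillatory integral `∫ exp(i s (ε⟨η⟩ + ε'⟨ξ - η⟩)) H(ξ, η) dη`. -/
def pairIntegral (ε ε' : ℝ) (H : Plane × Plane → ℂ) (s : ℝ) (ξ : Plane) : ℂ :=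
  ∫ η, expI (s * pairPhase ε ε' ξ η) * H (ξ, η)

theorem timeResonance_ne_zero {E : Type*} [NormedAddCommGroup E] [InnerProductSpace ℝ E]
    {ε ε' : ℝ} (hε : ε ^ 2 = 1) (hε' : ε' ^ 2 = 1) (ξ η : E) : timeResonance ε ε' ξ η ≠ 0 :=
  abs_pos.1 (one_pos.trans_le (one_le_abs_timeResonance hε hε' ξ η))

theorem HasJetDecay.isDecayingKernel {E : Type*} [NormedAddCommGroup E] [NormedSpace ℝ E] {k : ℕ}
    {DA DB : ℝ} {A B : E → ℂ} (hA : HasJetDecay k DA A) (hB : HasJetDecay k DB B) :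
    IsDecayingKernel k (DA * DB) (convolutionKernel A B) where
  continuous := (hA.continuous.comp continuous_snd).mul
    (hB.continuous.comp (continuous_fst.sub continuous_snd))
  bound ξ η := by
    rw [convolutionKernel, norm_mul]
    refine (mul_le_mul (hA.norm_le η) (hB.norm_le (ξ - η)) (norm_nonneg _)
      ((norm_nonneg _).trans (hA.norm_le η))).trans_eq ?_
    rw [pairWeight, mul_pow, mul_inv]
    ring

namespace IsDecayingKernel

variable {ε ε' : ℝ} {k : ℕ} {D : ℝ}

theorem phaseMul {E : Type*} [NormedAddCommGroup E] {H : E × E → ℂ} (hε : ε ^ 2 = 1)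
    (hε' : ε' ^ 2 = 1) (hH : IsDecayingKernel (k + 1) D H) :
    IsDecayingKernel k (2 * D) (phaseMul ε ε' H) where
  continuous := (continuous_const.mul (Complex.continuous_ofReal.comp continuous_pairPhase)).mul
    hH.continuous
  bound ξ η := by
    have hpos := pairWeight_pos ξ η
    rw [EulerPoisson.phaseMul, norm_mul, norm_mul, Complex.norm_I, one_mul, Complex.norm_real]
    refine (mul_le_mul (abs_pairPhase_le hε hε' ξ η) (hH.bound ξ η) (norm_nonneg _)
      (by positivity)).trans_eq ?_
    rw [pow_succ]
    field_simp

theorem resonanceDiv {E : Type*} [NormedAddCommGroup E] [InnerProductSpace ℝ E] {H : E × E → ℂ}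
    (hε : ε ^ 2 = 1) (hε' : ε' ^ 2 = 1) (hH : IsDecayingKernel k D H) :
    IsDecayingKernel k D (resonanceDiv ε ε' H) where
  continuous := by
    have hres : Continuous fun p : E × E => timeResonance ε ε' p.1 p.2 :=
      ((continuous_bracket.comp continuous_fst).pow 2).sub (continuous_pairPhase.pow 2)
    exact hH.continuous.mul (Complex.continuous_ofReal.comp
      (hres.inv₀ fun p => timeResonance_ne_zero hε hε' p.1 p.2))
  bound ξ η := by
    rw [EulerPoisson.resonanceDiv, norm_mul, Complex.norm_real, norm_inv]
    exact (mul_le_of_le_one_right (norm_nonneg _)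
      (inv_le_one_of_one_le₀ (one_le_abs_timeResonance hε hε' ξ η))).trans (hH.bound ξ η)

variable {H : Plane × Plane → ℂ}

theorem integrable (hH : IsDecayingKernel (k + 3) D H) (ξ : Plane) :
    Integrable fun η => H (ξ, η) :=
  integrable_of_le_inv_pairWeight (hH.continuous.comp (Continuous.prodMk_right ξ)) (hH.bound ξ)

theorem integrable_expI_mul (hH : IsDecayingKernel (k + 3) D H) (s : ℝ) (ξ : Plane) :
    Integrable fun η => expI (s * pairPhase ε ε' ξ η) * H (ξ, η) :=
  (hH.integrable ξ).bdd_mul (c := 1)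
    ((continuous_expI_pairPhase s).comp (Continuous.prodMk_right ξ)).aestronglyMeasurable
    (Eventually.of_forall fun _ => (norm_expI _).le)

theorem stronglyMeasurable_pairIntegral (hH : IsDecayingKernel k D H) (s : ℝ) :
    StronglyMeasurable (pairIntegral ε ε' H s) :=
  ((continuous_expI_pairPhase s).mul hH.continuous).stronglyMeasurable.integral_prod_right'

theorem norm_pairIntegral_le (hH : IsDecayingKernel (k + 3) D H) (s : ℝ) (ξ : Plane) :
    ‖pairIntegral ε ε' H s ξ‖ ≤ 2 ^ k * inverseCubeMass * D * (bracket ξ ^ k)⁻¹ :=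
  norm_integral_expI_mul_le (fun η => s * pairPhase ε ε' ξ η) (hH.bound ξ)

theorem hasDerivAt_pairIntegral (hε : ε ^ 2 = 1) (hε' : ε' ^ 2 = 1)
    (hH : IsDecayingKernel (k + 4) D H) (s : ℝ) (ξ : Plane) :
    HasDerivAt (fun s => pairIntegral ε ε' H s ξ)
      (pairIntegral ε ε' (EulerPoisson.phaseMul ε ε' H) s ξ) s := by
  have hH' := hH.phaseMul (k := k + 3) hε hε'
  refine (hasDerivAt_integral_of_dominated_loc_of_deriv_le (μ := (volume : Measure Plane))
    (s := Set.univ) (F := fun s η => expI (s * pairPhase ε ε' ξ η) * H (ξ, η))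
    (F' := fun s η => expI (s * pairPhase ε ε' ξ η) * EulerPoisson.phaseMul ε ε' H (ξ, η))
    (bound := fun η => ‖EulerPoisson.phaseMul ε ε' H (ξ, η)‖) univ_mem
    (Eventually.of_forall fun r => (hH.integrable_expI_mul (k := k + 1) r ξ).aestronglyMeasurable)
    (hH.integrable_expI_mul (k := k + 1) s ξ) (hH'.integrable_expI_mul s ξ).aestronglyMeasurable
    (Eventually.of_forall fun η r _ => ?_) (hH'.integrable ξ).norm
    (Eventually.of_forall fun η r _ => ?_)).2
  · rw [norm_mul, norm_expI, one_mul]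
  · refine (((hasDerivAt_expI (r * pairPhase ε ε' ξ η)).scomp r
      ((hasDerivAt_id r).mul_const (pairPhase ε ε' ξ η))).mul_const (H (ξ, η))).congr_deriv ?_
    simp [EulerPoisson.phaseMul]
    ring

theorem norm_pairIntegral_sub_le (hε : ε ^ 2 = 1) (hε' : ε' ^ 2 = 1)
    (hH : IsDecayingKernel (k + 4) D H) (s r : ℝ) (ξ : Plane) :
    ‖pairIntegral ε ε' H s ξ - pairIntegral ε ε' H r ξ‖
      ≤ |s - r| * (2 ^ k * inverseCubeMass * (2 * D) * (bracket ξ ^ k)⁻¹) := by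
  have h := convex_univ.norm_image_sub_le_of_norm_hasDerivWithin_le
    (fun y _ => (hH.hasDerivAt_pairIntegral hε hε' y ξ).hasDerivWithinAt)
    (fun y _ => (hH.phaseMul (k := k + 3) hε hε').norm_pairIntegral_le (ε := ε) (ε' := ε') y ξ)
    (Set.mem_univ r) (Set.mem_univ s)
  rwa [Real.norm_eq_abs, mul_comm] at h

/-- The time resonance function is the symbol `⟨ξ⟩²` of the oscillator minus the square of the
phase. -/
theorem pairIntegral_phaseMul_phaseMul_resonanceDiv (hε : ε ^ 2 = 1) (hε' : ε' ^ 2 = 1)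
    (hH : IsDecayingKernel (k + 3) D H) (s : ℝ) (ξ : Plane) :
    pairIntegral ε ε'
        (EulerPoisson.phaseMul ε ε' (EulerPoisson.phaseMul ε ε'
          (EulerPoisson.resonanceDiv ε ε' H))) s ξ
      = pairIntegral ε ε' H s ξ
        - ((bracket ξ ^ 2 : ℝ) : ℂ) * pairIntegral ε ε' (EulerPoisson.resonanceDiv ε ε' H) s ξ := by
  simp only [pairIntegral]
  rw [← integral_const_mul, ← integral_sub (hH.integrable_expI_mul s ξ)
    (((hH.resonanceDiv hε hε').integrable_expI_mul s ξ).const_mul _)]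
  refine integral_congr_ae (Eventually.of_forall fun η => ?_)
  have hres : ((timeResonance ε ε' ξ η : ℝ) : ℂ) * ((timeResonance ε ε' ξ η)⁻¹ : ℝ) = 1 := by
    rw [← Complex.ofReal_mul, mul_inv_cancel₀ (timeResonance_ne_zero hε hε' ξ η),
      Complex.ofReal_one]
  have hdef : ((timeResonance ε ε' ξ η : ℝ) : ℂ)
      = ((bracket ξ ^ 2 : ℝ) : ℂ) - (pairPhase ε ε' ξ η : ℂ) ^ 2 := by
    rw [timeResonance, pairPhase]
    push_cast
    ring
  rw [hdef] at hres
  simp only [EulerPoisson.phaseMul, EulerPoisson.resonanceDiv]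
  linear_combination (expI (s * pairPhase ε ε' ξ η) * (pairPhase ε ε' ξ η : ℂ) ^ 2 * H (ξ, η)
      * ((timeResonance ε ε' ξ η)⁻¹ : ℝ)) * Complex.I_sq
    + (expI (s * pairPhase ε ε' ξ η) * H (ξ, η)) * hres

end IsDecayingKernel

theorem phaseMul_resonanceDiv_convolutionKernel (ε ε' : ℝ) {E : Type*} [NormedAddCommGroup E]
    (A B : E → ℂ) :
    phaseMul ε ε' (resonanceDiv ε ε' (convolutionKernel A B))
      = fun p => resonanceDiv ε ε'
          (convolutionKernel (fun η => (Complex.I * ε) * ((bracket η : ℂ) * A η)) B) p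
        + resonanceDiv ε ε'
          (convolutionKernel A fun η => (Complex.I * ε') * ((bracket η : ℂ) * B η)) p := by
  ext p
  simp only [phaseMul, resonanceDiv, convolutionKernel, pairPhase]
  push_cast
  ring

end PairIntegral

section OscillatoryDecay

variable {m : ℕ} {C s z : ℝ} {ξ : Plane}

theorem bracket_le_one_add_abs (s : ℝ) : bracket s ≤ 1 + |s| := by
  refine (abs_le_of_sq_le_sq' ?_ (by positivity)).2
  rw [bracket_sq, Real.norm_eq_abs]
  nlinarith [abs_nonneg s]

theorem bracket_pow_mul_inv_bracket_pow (m : ℕ) (ξ : Plane) :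
    bracket ξ ^ (m + 2) * (bracket ξ ^ (m + 4))⁻¹ = (bracket ξ ^ 2)⁻¹ := by
  have hξ := (bracket_pos ξ).ne'
  rw [show m + 4 = m + 2 + 2 by ring, pow_add _ (m + 2) 2]
  field_simp

theorem bracket_pow_mul_le_decayWeight_of_mul_one_add_abs_le (hC : 0 ≤ C) (hz : 0 ≤ z)
    (h : z * (1 + |s|) ≤ C * (bracket ξ ^ (m + 4))⁻¹) :
    bracket ξ ^ (m + 2) * z ≤ C * decayWeight s ξ := by
  have hξ := bracket_pos ξ
  have hs := bracket_pos s
  have hz_le : z ≤ C * (bracket ξ ^ (m + 4))⁻¹ * (bracket s)⁻¹ := by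
    rw [← div_eq_mul_inv, le_div_iff₀ hs]
    exact (mul_le_mul_of_nonneg_left (bracket_le_one_add_abs s) hz).trans h
  calc bracket ξ ^ (m + 2) * z
      ≤ bracket ξ ^ (m + 2) * (C * (bracket ξ ^ (m + 4))⁻¹ * (bracket s)⁻¹) := by gcongr
    _ = C * ((bracket s)⁻¹ * (bracket ξ ^ (m + 2) * (bracket ξ ^ (m + 4))⁻¹)) := by ring
    _ ≤ C * decayWeight s ξ := by
        rw [bracket_pow_mul_inv_bracket_pow, decayWeight]
        exact mul_le_mul_of_nonneg_left
          (le_add_of_nonneg_right (inv_nonneg.2 (sq_nonneg _))) hC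

theorem bracket_pow_mul_le_decayWeight_of_mul_one_add_sq_le (hC : 0 ≤ C)
    (h : z * (1 + s ^ 2 * ‖ξ‖ ^ 2) ≤ C * (bracket ξ ^ (m + 4))⁻¹) :
    bracket ξ ^ (m + 2) * z ≤ C * decayWeight s ξ := by
  have hξ := bracket_pos ξ
  have hs := bracket_pos s
  have hz_le : z ≤ C * (bracket ξ ^ (m + 4))⁻¹ * (1 + s ^ 2 * ‖ξ‖ ^ 2)⁻¹ := by
    rwa [← div_eq_mul_inv, le_div_iff₀ (by positivity)]
  have hscale : (bracket ξ ^ 2)⁻¹ * (1 + s ^ 2 * ‖ξ‖ ^ 2)⁻¹ ≤ (bracket (bracket s • ξ) ^ 2)⁻¹ := by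
    rw [← mul_inv]
    refine inv_anti₀ (pow_pos (bracket_pos _) 2) ?_
    rw [bracket_sq, bracket_sq, norm_smul, mul_pow, Real.norm_eq_abs, sq_abs, bracket_sq,
      Real.norm_eq_abs, sq_abs]
    nlinarith [mul_nonneg (sq_nonneg s) (mul_nonneg (sq_nonneg ‖ξ‖) (sq_nonneg ‖ξ‖))]
  calc bracket ξ ^ (m + 2) * z
      ≤ bracket ξ ^ (m + 2) * (C * (bracket ξ ^ (m + 4))⁻¹ * (1 + s ^ 2 * ‖ξ‖ ^ 2)⁻¹) := by gcongr
    _ = C * (bracket ξ ^ (m + 2) * (bracket ξ ^ (m + 4))⁻¹ * (1 + s ^ 2 * ‖ξ‖ ^ 2)⁻¹) := by ring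
    _ ≤ C * decayWeight s ξ := by
        rw [bracket_pow_mul_inv_bracket_pow, decayWeight]
        refine mul_le_mul_of_nonneg_left (hscale.trans (le_add_of_nonneg_left ?_)) hC
        positivity

theorem pairIntegral_eq_integral_phase {ε ε' κ : ℝ} (hε : ε ^ 2 = 1) (hκ : ε * ε' = κ)
    (H : Plane × Plane → ℂ) (s : ℝ) (ξ : Plane) :
    pairIntegral ε ε' H s ξ = ∫ η, expI (s * ε * phase κ ξ η) * H (ξ, η) := by
  simp only [pairIntegral, pairPhase_eq_mul_phase hε, hκ, mul_assoc]

theorem exists_bracket_pow_mul_norm_pairIntegral_le (m : ℕ) : ∃ K, 0 ≤ K ∧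
    ∀ {ε ε' D : ℝ} {H : Plane × Plane → ℂ}, ε ^ 2 = 1 → ε' ^ 2 = 1 →
      (∀ ξ v, ‖v‖ ≤ 1 →
        HasJetBound v (fun η => (pairWeight ξ η ^ (m + 15))⁻¹) D fun η => H (ξ, η)) →
      ∀ s ξ, bracket ξ ^ (m + 2) * ‖pairIntegral ε ε' H s ξ‖ ≤ K * D * decayWeight s ξ := by
  obtain ⟨K₁, hK₁, hsum⟩ := exists_norm_integral_sum_phase_le (m + 4)
  obtain ⟨K₂, hK₂, hdiff⟩ := exists_norm_integral_difference_phase_le (m + 4)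
  refine ⟨max K₁ K₂, hK₁.trans (le_max_left _ _), fun {ε ε' D H} hε hε' hH s ξ => ?_⟩
  have hD : 0 ≤ D := nonneg_of_mul_nonneg_left ((hH ξ 0 (by simp)).nonneg 0)
    (inv_pos.2 (pow_pos (pairWeight_pos ξ 0) _))
  have hweight := decayWeight_nonneg s ξ
  rcases sq_eq_one_iff.1 (show (ε * ε') ^ 2 = 1 by rw [mul_pow, hε, hε', one_mul])
    with hκ | hκ
  · have h := hsum ξ (s * ε) D _ (hH ξ)
    rw [← pairIntegral_eq_integral_phase hε hκ, abs_mul, abs_eq_one_of_sq_eq_one hε, mul_one] at h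
    refine (bracket_pow_mul_le_decayWeight_of_mul_one_add_abs_le (by positivity) (norm_nonneg _)
      h).trans ?_
    gcongr
    exact le_max_left _ _
  · have h := hdiff ξ (s * ε) D _ (hH ξ)
    rw [← pairIntegral_eq_integral_phase hε hκ, mul_pow, hε, mul_one] at h
    refine (bracket_pow_mul_le_decayWeight_of_mul_one_add_sq_le (by positivity) h).trans ?_
    gcongr
    exact le_max_right _ _

end OscillatoryDecay

section BilinearSolution

theorem exists_hasJetBound_resonanceDiv {E : Type*} [NormedAddCommGroup E]
    [InnerProductSpace ℝ E] (n : ℕ) : ∃ K, 0 ≤ K ∧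
    ∀ {ε ε' : ℝ} {A B : E → ℂ} {DA DB : ℝ}, ε ^ 2 = 1 → ε' ^ 2 = 1 →
      HasJetDecay (n + 2) DA A → HasJetDecay (n + 2) DB B → ∀ ξ v, ‖v‖ ≤ 1 →
      HasJetBound v (fun η => (pairWeight ξ η ^ n)⁻¹) (K * (DA * DB))
        fun η => resonanceDiv ε ε' (convolutionKernel A B) (ξ, η) := by
  obtain ⟨K, hK, hres⟩ := exists_hasJetBound_inv_timeResonance (E := E)
  refine ⟨16 * K, by positivity, fun {ε ε' A B DA DB} hε hε' hA hB ξ v hv =>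
    (((hA v hv).mul ((hB v hv).comp_const_sub ξ)).mul (hres hε hε' hv)).mono fun η => ?_⟩
  have hη := (bracket_pos η).ne'
  have hξη := (bracket_pos (ξ - η)).ne'
  refine le_of_eq ?_
  rw [pairWeight, pow_add, pow_add]
  field_simp
  ring

theorem exists_norm_pairIntegral_resonanceDiv_le (m : ℕ) : ∃ K, 0 ≤ K ∧
    ∀ {ε ε' : ℝ} {A B : Plane → ℂ} {DA DB : ℝ}, ε ^ 2 = 1 → ε' ^ 2 = 1 →
      HasJetDecay (m + 17) DA A → HasJetDecay (m + 17) DB B → ∀ s ξ,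
      bracket ξ ^ (m + 2)
          * ‖pairIntegral ε ε' (resonanceDiv ε ε' (convolutionKernel A B)) s ξ‖
        ≤ K * (DA * DB) * decayWeight s ξ := by
  obtain ⟨K₁, hK₁, hjet⟩ := exists_hasJetBound_resonanceDiv (E := Plane) (m + 15)
  obtain ⟨K₂, hK₂, hint⟩ := exists_bracket_pow_mul_norm_pairIntegral_le m
  refine ⟨K₂ * K₁, by positivity, fun hε hε' hA hB s ξ => ?_⟩
  refine (hint hε hε' (hjet hε hε' hA hB) s ξ).trans_eq ?_
  ring

theorem exists_norm_pairIntegral_phaseMul_resonanceDiv_le (m : ℕ) : ∃ K, 0 ≤ K ∧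
    ∀ {ε ε' : ℝ} {A B : Plane → ℂ} {DA DB : ℝ}, ε ^ 2 = 1 → ε' ^ 2 = 1 →
      HasJetDecay (m + 18) DA A → HasJetDecay (m + 18) DB B → ∀ s ξ,
      bracket ξ ^ (m + 2)
          * ‖pairIntegral ε ε' (phaseMul ε ε' (resonanceDiv ε ε' (convolutionKernel A B))) s ξ‖
        ≤ K * (DA * DB) * decayWeight s ξ := by
  obtain ⟨K, hK, hint⟩ := exists_norm_pairIntegral_resonanceDiv_le m
  refine ⟨64 * K, by positivity, fun {ε ε' A B DA DB} hε hε' hA hB s ξ => ?_⟩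
  have hnorm : ∀ {x : ℝ}, x ^ 2 = 1 → ‖Complex.I * (x : ℂ)‖ = 1 := fun {x} hx => by
    rw [norm_mul, Complex.norm_I, Complex.norm_real, one_mul, Real.norm_eq_abs,
      abs_eq_one_of_sq_eq_one hx]
  have hA₀ := hA.mono (j := m + 17) (by omega) le_rfl
  have hB₀ := hB.mono (j := m + 17) (by omega) le_rfl
  have hA₁ := hA.bracket_mul.const_mul (Complex.I * ε)
  have hB₁ := hB.bracket_mul.const_mul (Complex.I * ε')
  rw [hnorm hε] at hA₁
  rw [hnorm hε'] at hB₁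
  have hA₁B := ((hA₁.isDecayingKernel hB₀).resonanceDiv hε hε').integrable_expI_mul
    (k := m + 14) (ε := ε) (ε' := ε') s ξ
  have hAB₁ := ((hA₀.isDecayingKernel hB₁).resonanceDiv hε hε').integrable_expI_mul
    (k := m + 14) (ε := ε) (ε' := ε') s ξ
  rw [phaseMul_resonanceDiv_convolutionKernel, pairIntegral]
  simp only [mul_add]
  rw [integral_add hA₁B hAB₁]
  refine (mul_le_mul_of_nonneg_left (norm_add_le _ _) (pow_nonneg (bracket_pos ξ).le _)).trans ?_
  rw [mul_add]
  refine (add_le_add (hint hε hε' hA₁ hB₀ s ξ) (hint hε hε' hA₀ hB₁ s ξ)).trans_eq ?_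
  ring

theorem exists_isDecayingSolution_pairIntegral (m : ℕ) : ∃ K, 0 ≤ K ∧
    ∀ {ε ε' : ℝ} {A B : Plane → ℂ} {DA DB : ℝ}, ε ^ 2 = 1 → ε' ^ 2 = 1 →
      HasJetDecay (m + 18) DA A → HasJetDecay (m + 18) DB B →
      ∃ Q Q', IsDecayingSolution m (K * (DA * DB))
        (pairIntegral ε ε' (convolutionKernel A B)) Q Q' := by
  obtain ⟨K₀, hK₀, hbound⟩ := exists_norm_pairIntegral_resonanceDiv_le m
  obtain ⟨K₁, -, hbound'⟩ := exists_norm_pairIntegral_phaseMul_resonanceDiv_le m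
  refine ⟨max K₀ K₁, hK₀.trans (le_max_left _ _), fun {ε ε' A B DA DB} hε hε' hA hB => ?_⟩
  have hD : 0 ≤ DA * DB := mul_nonneg hA.nonneg hB.nonneg
  have hlow : ∀ {j}, j ≤ m + 18 → IsDecayingKernel j (DA * DB) (convolutionKernel A B) :=
    fun hj => (hA.mono hj le_rfl).isDecayingKernel (hB.mono hj le_rfl)
  have hker := hlow le_rfl
  have hdiv := hker.resonanceDiv hε hε'
  have hphase := hdiv.phaseMul (k := m + 17) hε hε'
  have hle : ∀ {K : ℝ}, K ≤ max K₀ K₁ → ∀ s ξ,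
      K * (DA * DB) * decayWeight s ξ ≤ max K₀ K₁ * (DA * DB) * decayWeight s ξ :=
    fun hK s ξ => mul_le_mul_of_nonneg_right (mul_le_mul_of_nonneg_right hK hD)
      (decayWeight_nonneg s ξ)
  exact ⟨pairIntegral ε ε' (resonanceDiv ε ε' (convolutionKernel A B)),
    pairIntegral ε ε' (phaseMul ε ε' (resonanceDiv ε ε' (convolutionKernel A B))),
    { nonneg := mul_nonneg (hK₀.trans (le_max_left _ _)) hD
      stronglyMeasurable_source := hker.stronglyMeasurable_pairIntegral
      stronglyMeasurable := hdiv.stronglyMeasurable_pairIntegral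
      stronglyMeasurable_deriv := hphase.stronglyMeasurable_pairIntegral
      hasDerivAt := hdiv.hasDerivAt_pairIntegral (k := m + 14) hε hε'
      hasDerivAt_deriv := fun s ξ => by
        rw [smul_eq_mul,
          ← hker.pairIntegral_phaseMul_phaseMul_resonanceDiv (k := m + 15) hε hε']
        exact hphase.hasDerivAt_pairIntegral (k := m + 13) hε hε' s ξ
      bound := fun s ξ => (hbound hε hε' (hA.mono (by omega) le_rfl)
        (hB.mono (by omega) le_rfl) s ξ).trans (hle (le_max_left _ _) s ξ)
      bound_deriv := fun s ξ => (hbound' hε hε' hA hB s ξ).trans (hle (le_max_right _ _) s ξ)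
      source_bound := ⟨_, (hlow (j := 5) (by omega)).norm_pairIntegral_le⟩
      source_lipschitz :=
        ⟨_, (hlow (j := 6) (by omega)).norm_pairIntegral_sub_le hε hε'⟩ }⟩

end BilinearSolution

section Superposition

variable {F : Type*} [NormedAddCommGroup F]

theorem bracket_pow_mul_norm_add_le {a b : F} {ξ : Plane} {k : ℕ} {C C' w : ℝ}
    (ha : bracket ξ ^ k * ‖a‖ ≤ C * w) (hb : bracket ξ ^ k * ‖b‖ ≤ C' * w) :
    bracket ξ ^ k * ‖a + b‖ ≤ (C + C') * w := by
  refine (mul_le_mul_of_nonneg_left (norm_add_le a b) (pow_nonneg (bracket_pos ξ).le k)).trans ?_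
  rw [mul_add, add_mul]
  exact add_le_add ha hb

variable [NormedSpace ℂ F]
variable {m : ℕ} {D D' : ℝ} {g Q Q₁ g' Q' Q₁' : ℝ → Plane → F}

namespace IsDecayingSolution

theorem add (h : IsDecayingSolution m D g Q Q₁) (h' : IsDecayingSolution m D' g' Q' Q₁') :
    IsDecayingSolution m (D + D') (fun s ξ => g s ξ + g' s ξ) (fun s ξ => Q s ξ + Q' s ξ)
      (fun s ξ => Q₁ s ξ + Q₁' s ξ) where
  nonneg := add_nonneg h.nonneg h'.nonneg
  stronglyMeasurable_source s :=
    (h.stronglyMeasurable_source s).add (h'.stronglyMeasurable_source s)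
  stronglyMeasurable s := (h.stronglyMeasurable s).add (h'.stronglyMeasurable s)
  stronglyMeasurable_deriv s := (h.stronglyMeasurable_deriv s).add (h'.stronglyMeasurable_deriv s)
  hasDerivAt s ξ := (h.hasDerivAt s ξ).add (h'.hasDerivAt s ξ)
  hasDerivAt_deriv s ξ :=
    ((h.hasDerivAt_deriv s ξ).add (h'.hasDerivAt_deriv s ξ)).congr_deriv (by rw [smul_add]; abel)
  bound s ξ := bracket_pow_mul_norm_add_le (h.bound s ξ) (h'.bound s ξ)
  bound_deriv s ξ := bracket_pow_mul_norm_add_le (h.bound_deriv s ξ) (h'.bound_deriv s ξ)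
  source_bound := by
    obtain ⟨B, hB⟩ := h.source_bound
    obtain ⟨B', hB'⟩ := h'.source_bound
    refine ⟨B + B', fun s ξ => (norm_add_le _ _).trans ?_⟩
    rw [add_mul]
    exact add_le_add (hB s ξ) (hB' s ξ)
  source_lipschitz := by
    obtain ⟨B, hB⟩ := h.source_lipschitz
    obtain ⟨B', hB'⟩ := h'.source_lipschitz
    refine ⟨B + B', fun s r ξ => ?_⟩
    rw [add_sub_add_comm, add_mul, mul_add]
    exact (norm_add_le _ _).trans (add_le_add (hB s r ξ) (hB' s r ξ))

theorem map {F' : Type*} [NormedAddCommGroup F'] [NormedSpace ℂ F']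
    (h : IsDecayingSolution m D g Q Q₁) (M : Plane → F →L[ℂ] F') (hM : StronglyMeasurable M)
    (hM_le : ∀ ξ, ‖M ξ‖ ≤ 1) :
    IsDecayingSolution m D (fun s ξ => M ξ (g s ξ)) (fun s ξ => M ξ (Q s ξ))
      (fun s ξ => M ξ (Q₁ s ξ)) := by
  have hle : ∀ ξ v, ‖M ξ v‖ ≤ ‖v‖ := fun ξ v =>
    ((M ξ).le_opNorm v).trans (mul_le_of_le_one_left (norm_nonneg _) (hM_le ξ))
  have hmeas : ∀ {a : Plane → F}, StronglyMeasurable a → StronglyMeasurable fun ξ => M ξ (a ξ) :=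
    fun {a} ha => (isBoundedBilinearMap_apply (𝕜 := ℂ)).continuous.comp_stronglyMeasurable
      (hM.prodMk ha)
  have hderiv : ∀ ξ {f : ℝ → F} {f' : F} {s : ℝ}, HasDerivAt f f' s →
      HasDerivAt (fun s => M ξ (f s)) (M ξ f') s := fun ξ {_ _ s} hf =>
    ((M ξ).restrictScalars ℝ).hasFDerivAt.comp_hasDerivAt s hf
  have hbound : ∀ {a : F} {C : ℝ} (ξ : Plane), bracket ξ ^ (m + 2) * ‖a‖ ≤ C →
      bracket ξ ^ (m + 2) * ‖M ξ a‖ ≤ C := fun ξ ha =>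
    (mul_le_mul_of_nonneg_left (hle ξ _) (pow_nonneg (bracket_pos ξ).le _)).trans ha
  obtain ⟨B, hB⟩ := h.source_bound
  obtain ⟨B', hB'⟩ := h.source_lipschitz
  exact
    { nonneg := h.nonneg
      stronglyMeasurable_source := fun s => hmeas (h.stronglyMeasurable_source s)
      stronglyMeasurable := fun s => hmeas (h.stronglyMeasurable s)
      stronglyMeasurable_deriv := fun s => hmeas (h.stronglyMeasurable_deriv s)
      hasDerivAt := fun s ξ => hderiv ξ (h.hasDerivAt s ξ)
      hasDerivAt_deriv := fun s ξ =>
        (hderiv ξ (h.hasDerivAt_deriv s ξ)).congr_deriv (by rw [map_sub, map_smul])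
      bound := fun s ξ => hbound ξ (h.bound s ξ)
      bound_deriv := fun s ξ => hbound ξ (h.bound_deriv s ξ)
      source_bound := ⟨B, fun s ξ => (hle ξ _).trans (hB s ξ)⟩
      source_lipschitz := ⟨B', fun s r ξ => by
        rw [← map_sub]
        exact (hle ξ _).trans (hB' s r ξ)⟩ }

theorem neg (h : IsDecayingSolution m D g Q Q₁) :
    IsDecayingSolution m D (fun s ξ => -g s ξ) (fun s ξ => -Q s ξ) (fun s ξ => -Q₁ s ξ) := by
  simpa only [neg_apply, ContinuousLinearMap.id_apply] using
    h.map (fun _ => -ContinuousLinearMap.id ℂ F) stronglyMeasurable_const fun _ =>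
      (norm_neg _).trans_le ContinuousLinearMap.norm_id_le

theorem mono (h : IsDecayingSolution m D g Q Q₁) (hD : D ≤ D') :
    IsDecayingSolution m D' g Q Q₁ :=
  { h with
    nonneg := h.nonneg.trans hD
    bound := fun s ξ => (h.bound s ξ).trans
      (mul_le_mul_of_nonneg_right hD (decayWeight_nonneg s ξ))
    bound_deriv := fun s ξ => (h.bound_deriv s ξ).trans
      (mul_le_mul_of_nonneg_right hD (decayWeight_nonneg s ξ)) }

end IsDecayingSolution

end Superposition

section Sources

variable {F : Type*} [NormedAddCommGroup F] [InnerProductSpace ℂ F] [CompleteSpace F]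
variable {m : ℕ} {D D' : ℝ} {G G' : ℝ → Lp F 2 (volume : Measure Plane)}

/-- The `L²`-valued source `G` is the inverse Fourier transform of the source of a decaying
solution on the Fourier side, with constant `D`. -/
def HasDecayingSolution (m : ℕ) (D : ℝ) (G : ℝ → Lp F 2 (volume : Measure Plane)) : Prop :=
  ∃ g Q Q' : ℝ → Plane → F, IsDecayingSolution m D g Q Q' ∧ ∀ s, G s = l2InvHat (g s)

namespace HasDecayingSolution

theorem sub (h : HasDecayingSolution m D G) (h' : HasDecayingSolution m D' G') :
    HasDecayingSolution m (D + D') fun s => G s - G' s := by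
  obtain ⟨g, Q, Q₁, hQ, hG⟩ := h
  obtain ⟨g', Q', Q₁', hQ', hG'⟩ := h'
  exact ⟨_, _, _, hQ.add hQ'.neg, fun s => by
    simp only [l2InvHat_add (hQ.memLp_source s) (hQ'.neg.memLp_source s),
      l2InvHat_neg (hQ'.memLp_source s), hG, hG', sub_eq_add_neg]⟩

theorem mono (h : HasDecayingSolution m D G) (hD : D ≤ D') : HasDecayingSolution m D' G := by
  obtain ⟨g, Q, Q₁, hQ, hG⟩ := h
  exact ⟨g, Q, Q₁, hQ.mono hD, hG⟩

theorem l2Multiplier (h : HasDecayingSolution m D G) (M : Plane → F →L[ℂ] F)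
    (hM : StronglyMeasurable M) (hM_le : ∀ ξ, ‖M ξ‖ ≤ 1) :
    HasDecayingSolution m D fun s => l2Multiplier (fun ξ v => M ξ v) (G s) := by
  obtain ⟨g, Q, Q₁, hQ, hG⟩ := h
  exact ⟨_, _, _, hQ.map M hM hM_le, fun s => by
    simp only [hG, l2Multiplier_l2InvHat _ (hQ.memLp_source s)]⟩

end HasDecayingSolution

end Sources

section FourierInverse

variable {V : Type*} [NormedAddCommGroup V] [InnerProductSpace ℝ V] [FiniteDimensional ℝ V]
  [MeasurableSpace V] [BorelSpace V]
variable {F : Type*} [NormedAddCommGroup F] [NormedSpace ℂ F] {f : V → F}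

theorem integrable_fourierChar_smul (hf : Integrable f) (x : V) :
    Integrable fun v => Real.fourierChar (inner ℝ v x) • f v := by
  simpa only [inner_neg_right, neg_neg] using (Real.fourierIntegral_convergent_iff (-x)).2 hf

theorem differentiable_fourierInv (h0 : Integrable f) (h1 : Integrable fun v => ‖v‖ * ‖f v‖) :
    Differentiable ℝ (𝓕⁻ f) := by
  rw [Real.fourierInv_eq_fourier_comp_neg]
  refine Real.differentiable_fourier h0.comp_neg ?_
  simpa only [norm_neg] using h1.comp_neg

theorem fderiv_fourierInv (h0 : Integrable f) (h1 : Integrable fun v => ‖v‖ * ‖f v‖) (x v : V) :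
    fderiv ℝ (𝓕⁻ f) x v
      = 𝓕⁻ (fun y => (2 * Real.pi * Complex.I * (inner ℝ y v : ℝ) : ℂ) • f y) x := by
  have h1_neg : Integrable fun v => ‖v‖ * ‖f (-v)‖ := by simpa only [norm_neg] using h1.comp_neg
  rw [Real.fourierInv_eq_fourier_comp_neg, Real.fourierInv_eq_fourier_comp_neg,
    Real.fderiv_fourier h0.comp_neg h1_neg, Real.fourier_continuousLinearMap_apply]
  · refine congrArg (fun f : V → F => 𝓕 f x) (funext fun y => ?_)
    simp only [VectorFourier.fourierSMulRight_apply, innerSL_apply_apply ℝ, inner_neg_left,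
      ← Complex.coe_smul, smul_smul]
    congr 1
    push_cast
    ring
  · exact (h1_neg.const_mul (2 * Real.pi * ‖innerSL ℝ (E := V)‖)).mono'
      h0.comp_neg.aestronglyMeasurable.fourierSMulRight (Eventually.of_forall fun y =>
        (VectorFourier.norm_fourierSMulRight_le (innerSL ℝ) (fun x => f (-x)) y).trans_eq
          (by ring))

theorem hasDerivAt_fourierInv {f f' : ℝ → V → F} {bound : V → ℝ} (hf : ∀ t, Integrable (f t))
    (hf' : ∀ t, Integrable (f' t)) (hbound : Integrable bound) (hle : ∀ t v, ‖f' t v‖ ≤ bound v)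
    (hderiv : ∀ t v, HasDerivAt (fun t => f t v) (f' t v) t) (x : V) (t : ℝ) :
    HasDerivAt (fun t => 𝓕⁻ (f t) x) (𝓕⁻ (f' t) x) t := by
  simp only [Real.fourierInv_eq]
  exact (hasDerivAt_integral_of_dominated_loc_of_deriv_le (s := Set.univ) (bound := bound)
    (F' := fun t v => Real.fourierChar (inner ℝ v x) • f' t v) univ_mem
    (Eventually.of_forall fun t => (integrable_fourierChar_smul (hf t) x).aestronglyMeasurable)
    (integrable_fourierChar_smul (hf t) x)
    (integrable_fourierChar_smul (hf' t) x).aestronglyMeasurable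
    (Eventually.of_forall fun v r _ => (Circle.norm_smul _ _).trans_le (hle r v)) hbound
    (Eventually.of_forall fun v r _ => (hderiv r v).const_smul _)).2

theorem fourierInv_mul_fourierInv {a b : V → ℂ} (ha : Integrable a) (hb : Integrable b) (x : V) :
    𝓕⁻ a x * 𝓕⁻ b x = 𝓕⁻ (fun ζ => ∫ η, a η * b (ζ - η)) x := by
  rw [Real.fourierInv_eq_fourier_neg, Real.fourierInv_eq_fourier_neg,
    Real.fourierInv_eq_fourier_neg, ← Real.fourier_mul_convolution_eq ha hb]
  rfl

end FourierInverse

section InverseHatCalculus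

theorem integrable_norm_mul_comp_two_pi_smul {F : Type*} [NormedAddCommGroup F] {a : Plane → F}
    (h : Integrable fun ξ => ‖ξ‖ * ‖a ξ‖) :
    Integrable fun ζ : Plane => ‖ζ‖ * ‖a ((2 * Real.pi) • ζ)‖ := by
  refine ((h.comp_smul Real.two_pi_pos.ne').const_mul (2 * Real.pi)⁻¹).congr
    (Eventually.of_forall fun ζ => ?_)
  simp only [norm_smul, Real.norm_of_nonneg Real.two_pi_pos.le]
  field_simp

variable {F : Type*} [NormedAddCommGroup F] [NormedSpace ℂ F] {a b : Plane → F}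

theorem invHat_add (ha : Integrable a) (hb : Integrable b) (x : Plane) :
    invHat (fun ξ => a ξ + b ξ) x = invHat a x + invHat b x := by
  simp only [invHat, Real.fourierInv_eq, smul_add]
  exact integral_add (integrable_fourierChar_smul (ha.comp_smul Real.two_pi_pos.ne') x)
    (integrable_fourierChar_smul (hb.comp_smul Real.two_pi_pos.ne') x)

theorem map_invHat {F' : Type*} [NormedAddCommGroup F'] [NormedSpace ℂ F'] [CompleteSpace F]
    [CompleteSpace F'] (L : F →L[ℂ] F') (ha : Integrable a) (x : Plane) :
    L (invHat a x) = invHat (fun ξ => L (a ξ)) x := by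
  simp only [invHat, Real.fourierInv_eq]
  rw [← L.integral_comp_comm
    (integrable_fourierChar_smul (ha.comp_smul Real.two_pi_pos.ne') x)]
  simp only [Circle.smul_def, map_smul]

theorem differentiable_invHat (h0 : Integrable a) (h1 : Integrable fun ξ => ‖ξ‖ * ‖a ξ‖) :
    Differentiable ℝ (invHat a) :=
  differentiable_fourierInv (h0.comp_smul Real.two_pi_pos.ne')
    (integrable_norm_mul_comp_two_pi_smul h1)

theorem fderiv_invHat (h0 : Integrable a) (h1 : Integrable fun ξ => ‖ξ‖ * ‖a ξ‖) (x v : Plane) :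
    fderiv ℝ (invHat a) x v = invHat (fun ξ => (Complex.I * (inner ℝ ξ v : ℝ)) • a ξ) x := by
  rw [invHat, fderiv_fourierInv (h0.comp_smul Real.two_pi_pos.ne')
    (integrable_norm_mul_comp_two_pi_smul h1), invHat]
  refine congrArg (fun f : Plane → F => 𝓕⁻ f x) (funext fun ζ => ?_)
  rw [real_inner_smul_left]
  congr 1
  push_cast
  ring

theorem hasDerivAt_invHat {a a' : ℝ → Plane → F} {bound : Plane → ℝ} (ha : ∀ t, Integrable (a t))
    (ha' : ∀ t, Integrable (a' t)) (hbound : Integrable bound)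
    (hle : ∀ t ξ, ‖a' t ξ‖ ≤ bound ξ) (hderiv : ∀ t ξ, HasDerivAt (fun t => a t ξ) (a' t ξ) t)
    (x : Plane) (t : ℝ) : HasDerivAt (fun t => invHat (a t) x) (invHat (a' t) x) t :=
  hasDerivAt_fourierInv (fun t => (ha t).comp_smul Real.two_pi_pos.ne')
    (fun t => (ha' t).comp_smul Real.two_pi_pos.ne')
    (hbound.comp_smul Real.two_pi_pos.ne') (fun t _ => hle t _) (fun t _ => hderiv t _) x t

theorem invHat_mul_invHat {a b : Plane → ℂ} (ha : Integrable a) (hb : Integrable b) (x : Plane) :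
    invHat a x * invHat b x
      = invHat (fun ξ => (((2 * Real.pi) ^ 2)⁻¹ : ℝ) * ∫ η, a η * b (ξ - η)) x := by
  rw [invHat, invHat, fourierInv_mul_fourierInv (ha.comp_smul Real.two_pi_pos.ne')
    (hb.comp_smul Real.two_pi_pos.ne'), invHat]
  refine congrArg (fun f : Plane → ℂ => 𝓕⁻ f x) (funext fun ζ => ?_)
  have h := Measure.integral_comp_smul (volume : Measure Plane)
    (fun η => a η * b ((2 * Real.pi) • ζ - η)) (2 * Real.pi)
  rw [finrank_euclideanSpace_fin, abs_of_pos (by positivity), Complex.real_smul] at h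
  simpa only [smul_sub] using h

end InverseHatCalculus

section Projection

variable {𝕜 ι : Type*} [RCLike 𝕜] [Fintype ι]

theorem norm_proj_le (j : ι) : ‖(EuclideanSpace.proj j : EuclideanSpace 𝕜 ι →L[𝕜] 𝕜)‖ ≤ 1 :=
  ContinuousLinearMap.opNorm_le_bound _ zero_le_one fun x =>
    (PiLp.norm_apply_le x j).trans_eq (one_mul _).symm

end Projection

section DecayingSources

variable {F : Type*} [NormedAddCommGroup F]

/-- The functions `p s` are inverse Fourier transforms of integrable functions, and these form the
source of a decaying solution with constant `D`. -/
def IsDecayingSource [NormedSpace ℂ F] (m : ℕ) (D : ℝ) (p : ℝ → Plane → F) : Prop :=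
  ∃ g Q Q' : ℝ → Plane → F, IsDecayingSolution m D g Q Q' ∧ (∀ s, Integrable (g s)) ∧
    ∀ s x, p s x = invHat (g s) x

namespace IsDecayingSource

section Normed

variable [NormedSpace ℂ F] {m : ℕ} {D D' : ℝ} {p p' : ℝ → Plane → F}

theorem add (h : IsDecayingSource m D p) (h' : IsDecayingSource m D' p') :
    IsDecayingSource m (D + D') fun s x => p s x + p' s x := by
  obtain ⟨g, Q, Q₁, hQ, hg, hp⟩ := h
  obtain ⟨g', Q', Q₁', hQ', hg', hp'⟩ := h'
  exact ⟨_, _, _, hQ.add hQ', fun s => (hg s).add (hg' s), fun s x => by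
    simp only [hp, hp', invHat_add (hg s) (hg' s)]⟩

theorem map {F' : Type*} [NormedAddCommGroup F'] [NormedSpace ℂ F'] [CompleteSpace F]
    [CompleteSpace F'] (h : IsDecayingSource m D p) (L : F →L[ℂ] F') (hL : ‖L‖ ≤ 1) :
    IsDecayingSource m D fun s x => L (p s x) := by
  obtain ⟨g, Q, Q₁, hQ, hg, hp⟩ := h
  exact ⟨_, _, _, hQ.map (fun _ => L) stronglyMeasurable_const fun _ => hL,
    fun s => L.integrable_comp (hg s), fun s x => by simp only [hp, map_invHat L (hg s)]⟩

theorem neg [CompleteSpace F] (h : IsDecayingSource m D p) :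
    IsDecayingSource m D fun s x => -p s x := by
  simpa only [neg_apply, ContinuousLinearMap.id_apply] using
    h.map (-ContinuousLinearMap.id ℂ F) ((norm_neg _).trans_le ContinuousLinearMap.norm_id_le)

theorem sub [CompleteSpace F] (h : IsDecayingSource m D p) (h' : IsDecayingSource m D' p') :
    IsDecayingSource m (D + D') fun s x => p s x - p' s x := by
  simpa only [sub_eq_add_neg] using h.add h'.neg

theorem mono (h : IsDecayingSource m D p) (hD : D ≤ D') : IsDecayingSource m D' p := by
  obtain ⟨g, Q, Q₁, hQ, hg, hp⟩ := h
  exact ⟨g, Q, Q₁, hQ.mono hD, hg, hp⟩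

end Normed

section Inner

variable [InnerProductSpace ℂ F] [CompleteSpace F] {m : ℕ} {D : ℝ} {p : ℝ → Plane → F}

theorem memLp (h : IsDecayingSource m D p) (s : ℝ) : MemLp (p s) 2 volume := by
  obtain ⟨g, Q, Q₁, hQ, hg, hp⟩ := h
  rw [funext (hp s)]
  exact memLp_invHat (hg s) (hQ.memLp_source s)

theorem hasDecayingSolution (h : IsDecayingSource m D p) :
    HasDecayingSolution m D fun s => toL2 (p s) := by
  obtain ⟨g, Q, Q₁, hQ, hg, hp⟩ := h
  exact ⟨g, Q, Q₁, hQ, fun s => by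
    simp only [funext (hp s), toL2_invHat (hg s) (hQ.memLp_source s)]⟩

end Inner

end IsDecayingSource

end DecayingSources

section HalfWave

variable {ε ε' : ℝ} {A B : Plane → ℂ} {D D' : ℝ} {k : ℕ}

/-- The Fourier transform `e^{iεt⟨ξ⟩} A(ξ)` of a half wave. -/
def evolve (ε : ℝ) (A : Plane → ℂ) (t : ℝ) (ξ : Plane) : ℂ := expI (t * (ε * bracket ξ)) * A ξ

/-- The half wave `e^{iεt⟨∇⟩}` applied to the function with Fourier transform `A`. -/
def halfWave (ε : ℝ) (A : Plane → ℂ) (t : ℝ) : Plane → ℂ := invHat (evolve ε A t)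

theorem norm_evolve (t : ℝ) (ξ : Plane) : ‖evolve ε A t ξ‖ = ‖A ξ‖ := by
  rw [evolve, norm_mul, norm_expI, one_mul]

theorem continuous_evolve (hA : Continuous A) (t : ℝ) : Continuous (evolve ε A t) :=
  (continuous_expI.comp (continuous_const.mul (continuous_const.mul continuous_bracket))).mul hA

theorem integrable_evolve (hA : HasJetDecay (k + 3) D A) (t : ℝ) : Integrable (evolve ε A t) :=
  (hA.integrable (by simp)).norm.mono' (continuous_evolve hA.continuous t).aestronglyMeasurable
    (Eventually.of_forall fun ξ => (norm_evolve t ξ).le)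

theorem integrable_norm_mul_evolve (hA : HasJetDecay (k + 4) D A) (t : ℝ) :
    Integrable fun ξ => ‖ξ‖ * ‖evolve ε A t ξ‖ := by
  have hbracket : Integrable fun ξ => (bracket ξ : ℂ) * A ξ :=
    (hA.bracket_mul (k := k + 3)).integrable (by simp)
  refine hbracket.norm.mono'
    (continuous_norm.mul (continuous_evolve hA.continuous t).norm).aestronglyMeasurable
    (Eventually.of_forall fun ξ => ?_)
  rw [norm_mul, norm_norm, norm_norm, norm_evolve, norm_mul, Complex.norm_real,
    Real.norm_of_nonneg (bracket_pos ξ).le]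
  exact mul_le_mul_of_nonneg_right (norm_le_bracket ξ) (norm_nonneg _)

theorem differentiable_halfWave (hA : HasJetDecay (k + 4) D A) (t : ℝ) :
    Differentiable ℝ (halfWave ε A t) :=
  differentiable_invHat (integrable_evolve (k := k + 1) hA t) (integrable_norm_mul_evolve hA t)

theorem pd_halfWave (hA : HasJetDecay (k + 4) D A) (j : Fin 2) (t : ℝ) (x : Plane) :
    pd j (halfWave ε A t) x = halfWave ε (fun ξ => Complex.I * ((ξ j : ℂ) * A ξ)) t x := by
  rw [pd, halfWave, fderiv_invHat (integrable_evolve (k := k + 1) hA t)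
    (integrable_norm_mul_evolve hA t), halfWave]
  refine congrArg (invHat · x) (funext fun ξ => ?_)
  rw [EuclideanSpace.inner_single_right, one_mul, conj_trivial, evolve, evolve, smul_eq_mul]
  ring

theorem hasDerivAt_evolve (t : ℝ) (ξ : Plane) :
    HasDerivAt (fun t => evolve ε A t ξ)
      (evolve ε (fun ξ => (Complex.I * ε) * ((bracket ξ : ℂ) * A ξ)) t ξ) t := by
  refine (((hasDerivAt_expI _).scomp t ((hasDerivAt_id t).mul_const (ε * bracket ξ))).mul_const
    (A ξ)).congr_deriv ?_
  simp only [id, one_mul, Complex.real_smul, evolve]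
  push_cast
  ring

theorem hasDerivAt_halfWave (hA : HasJetDecay (k + 4) D A) (t : ℝ) (x : Plane) :
    HasDerivAt (fun t => halfWave ε A t x)
      (halfWave ε (fun ξ => (Complex.I * ε) * ((bracket ξ : ℂ) * A ξ)) t x) t :=
  have hderiv := (hA.bracket_mul (k := k + 3)).const_mul (Complex.I * ε)
  hasDerivAt_invHat (integrable_evolve (k := k + 1) hA) (integrable_evolve hderiv)
    (hderiv.integrable (by simp)).norm (fun t ξ => (norm_evolve t ξ).le) hasDerivAt_evolve x t

theorem evolve_mul_evolve (t : ℝ) (ξ η : Plane) :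
    evolve ε A t η * evolve ε' B t (ξ - η)
      = expI (t * pairPhase ε ε' ξ η) * convolutionKernel A B (ξ, η) := by
  simp only [evolve, expI, pairPhase, convolutionKernel]
  rw [mul_add, Complex.ofReal_add, add_mul, Complex.exp_add]
  ring

theorem halfWave_mul_halfWave (hA : HasJetDecay (k + 3) D A) (hB : HasJetDecay (k + 3) D' B)
    (t : ℝ) (x : Plane) :
    halfWave ε A t x * halfWave ε' B t x
      = invHat (fun ξ => (((2 * Real.pi) ^ 2)⁻¹ : ℝ)
          * pairIntegral ε ε' (convolutionKernel A B) t ξ) x := by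
  rw [halfWave, halfWave, invHat_mul_invHat (integrable_evolve hA t) (integrable_evolve hB t)]
  simp only [evolve_mul_evolve, pairIntegral]

theorem IsDecayingKernel.integrable_pairIntegral {H : Plane × Plane → ℂ}
    (hH : IsDecayingKernel (k + 6) D H) (s : ℝ) : Integrable (pairIntegral ε ε' H s) :=
  (integrable_inv_bracket_pow (k := k + 3) (by simp)).const_mul _ |>.mono'
    (hH.stronglyMeasurable_pairIntegral s).aestronglyMeasurable
    (Eventually.of_forall (hH.norm_pairIntegral_le (k := k + 3) s))

theorem exists_isDecayingSource_halfWave_mul (m : ℕ) : ∃ K, 0 ≤ K ∧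
    ∀ {ε ε' : ℝ} {A B : Plane → ℂ} {DA DB : ℝ}, ε ^ 2 = 1 → ε' ^ 2 = 1 →
      HasJetDecay (m + 18) DA A → HasJetDecay (m + 18) DB B →
      IsDecayingSource m (K * (DA * DB)) fun s x => halfWave ε A s x * halfWave ε' B s x := by
  obtain ⟨K, hK, hsol⟩ := exists_isDecayingSolution_pairIntegral m
  refine ⟨K, hK, fun {ε ε' A B DA DB} hε hε' hA hB => ?_⟩
  obtain ⟨Q, Q', hQ⟩ := hsol hε hε' hA hB
  have hint := (hA.isDecayingKernel hB).integrable_pairIntegral (k := m + 12) (ε := ε) (ε' := ε')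
  let L : ℂ →L[ℂ] ℂ := (((2 * Real.pi) ^ 2)⁻¹ : ℝ) • ContinuousLinearMap.id ℂ ℂ
  have hL : ‖L‖ ≤ 1 := by
    rw [norm_smul, ContinuousLinearMap.norm_id, mul_one, Real.norm_of_nonneg (by positivity)]
    exact inv_le_one_of_one_le₀ (one_le_pow₀ (by linarith [Real.pi_gt_three]))
  exact ⟨_, _, _, hQ.map (fun _ => L) stronglyMeasurable_const fun _ => hL,
    fun s => L.integrable_comp (hint s), halfWave_mul_halfWave (k := m + 15) hA hB⟩

end HalfWave

section PartialDerivatives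

theorem pd_add {F : Type*} [NormedAddCommGroup F] [InnerProductSpace ℂ F] {u v : Plane → F}
    (hu : Differentiable ℝ u) (hv : Differentiable ℝ v) (j : Fin 2) (x : Plane) :
    pd j (fun x => u x + v x) x = pd j u x + pd j v x := by
  rw [pd, fderiv_fun_add (hu x) (hv x)]
  rfl

theorem pd_mul {u v : Plane → ℂ} (hu : Differentiable ℝ u) (hv : Differentiable ℝ v) (j : Fin 2)
    (x : Plane) : pd j (fun x => u x * v x) x = u x * pd j v x + v x * pd j u x := by
  rw [pd, fderiv_fun_mul (hu x) (hv x)]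
  rfl

end PartialDerivatives

section Waves

variable {u : ℝ → Plane → ℂ} {D D' : ℝ} {k : ℕ}

/-- `u` is a superposition of two half waves of opposite signs, whose profiles are bounded by
`D ⟨ξ⟩⁻ᵏ` together with two derivatives. -/
def IsWave (k : ℕ) (D : ℝ) (u : ℝ → Plane → ℂ) : Prop :=
  ∃ A B : Plane → ℂ, HasJetDecay k D A ∧ HasJetDecay k D B ∧
    u = fun t x => halfWave 1 A t x + halfWave (-1) B t x

namespace IsWave

theorem nonneg (h : IsWave k D u) : 0 ≤ D :=
  have ⟨_, _, hA, _⟩ := h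
  hA.nonneg

theorem mono (h : IsWave k D u) {j : ℕ} (hj : j ≤ k) (hD : D ≤ D') : IsWave j D' u :=
  have ⟨A, B, hA, hB, hu⟩ := h
  ⟨A, B, hA.mono hj hD, hB.mono hj hD, hu⟩

theorem differentiable (h : IsWave (k + 4) D u) (t : ℝ) : Differentiable ℝ (u t) := by
  obtain ⟨A, B, hA, hB, rfl⟩ := h
  exact (differentiable_halfWave hA t).add (differentiable_halfWave hB t)

theorem pd (h : IsWave (k + 4) D u) (j : Fin 2) :
    IsWave (k + 3) (16 * D) fun t x => pd j (u t) x := by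
  obtain ⟨A, B, hA, hB, rfl⟩ := h
  have hprofile {A : Plane → ℂ} (hA : HasJetDecay (k + 4) D A) :
      HasJetDecay (k + 3) (16 * D) fun ξ => Complex.I * ((ξ j : ℂ) * A ξ) :=
    ((hA.continuousLinearMap_mul (k := k + 3) (EuclideanSpace.proj j)
      (norm_proj_le j)).const_mul Complex.I).mono le_rfl
      (le_of_eq (by rw [Complex.norm_I]; ring))
  refine ⟨_, _, hprofile hA, hprofile hB, funext₂ fun t x => ?_⟩
  rw [← pd_halfWave hA, ← pd_halfWave hB,
    pd_add (differentiable_halfWave hA t) (differentiable_halfWave hB t)]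

theorem exists_hasDerivAt (h : IsWave (k + 4) D u) :
    ∃ u', IsWave (k + 3) (32 * D) u' ∧ ∀ t x, HasDerivAt (fun s => u s x) (u' t x) t := by
  obtain ⟨A, B, hA, hB, rfl⟩ := h
  have hprofile {A : Plane → ℂ} {ε : ℝ} (hε : ε ^ 2 = 1) (hA : HasJetDecay (k + 4) D A) :
      HasJetDecay (k + 3) (32 * D) fun ξ => (Complex.I * ε) * ((bracket ξ : ℂ) * A ξ) :=
    ((hA.bracket_mul (k := k + 3)).const_mul _).mono le_rfl (le_of_eq (by
      rw [norm_mul, Complex.norm_I, Complex.norm_real, one_mul, Real.norm_eq_abs,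
        abs_eq_one_of_sq_eq_one hε]
      ring))
  exact ⟨_, ⟨_, _, hprofile (one_pow 2) hA, hprofile neg_one_sq hB, rfl⟩, fun t x =>
    (hasDerivAt_halfWave hA t x).add (hasDerivAt_halfWave hB t x)⟩

theorem exists_isDecayingSource_mul (m : ℕ) : ∃ K, 0 ≤ K ∧ ∀ {u v : ℝ → Plane → ℂ} {D : ℝ},
    IsWave (m + 18) D u → IsWave (m + 18) D v →
      IsDecayingSource m (K * D ^ 2) fun s x => u s x * v s x := by
  obtain ⟨K, hK, hmul⟩ := exists_isDecayingSource_halfWave_mul m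
  refine ⟨4 * K, by positivity, ?_⟩
  rintro _ _ D ⟨A, B, hA, hB, rfl⟩ ⟨A', B', hA', hB', rfl⟩
  have h1 : (1 : ℝ) ^ 2 = 1 := one_pow 2
  have h2 : (-1 : ℝ) ^ 2 = 1 := neg_one_sq
  have hsum := (((hmul h1 h1 hA hA').add (hmul h1 h2 hA hB')).add (hmul h2 h1 hB hA')).add
    (hmul h2 h2 hB hB')
  rw [show 4 * K * D ^ 2 = K * (D * D) + K * (D * D) + K * (D * D) + K * (D * D) by ring]
  convert hsum using 3 with s x
  ring

end IsWave

end Waves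

section Jets

variable {F : Type*} [NormedAddCommGroup F] [InnerProductSpace ℂ F]
variable {w : Plane → F} {A : Plane → ℂ}

theorem dirDeriv_eq_sum_pd (v : Plane) (A : Plane → ℂ) (ξ : Plane) :
    dirDeriv v A ξ = ∑ j, v j • pd j A ξ := by
  conv_lhs => rw [← (EuclideanSpace.basisFun (Fin 2) ℝ).sum_repr v]
  simp only [dirDeriv, map_sum, map_smul, pd, EuclideanSpace.basisFun_repr,
    EuclideanSpace.basisFun_apply]

theorem norm_dirDeriv_le {v : Plane} (hv : ‖v‖ ≤ 1) (A : Plane → ℂ) (ξ : Plane) :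
    ‖dirDeriv v A ξ‖ ≤ ∑ j, ‖pd j A ξ‖ := by
  rw [dirDeriv_eq_sum_pd]
  refine norm_sum_le_of_le _ fun j _ => ?_
  rw [norm_smul]
  exact mul_le_of_le_one_left (norm_nonneg _) ((PiLp.norm_apply_le v j).trans hv)

theorem dirDeriv_comm {E : Type*} [NormedAddCommGroup E] [NormedSpace ℝ E] {A : E → ℂ}
    (hA : ContDiff ℝ 2 A) (v v' : E) :
    dirDeriv v (dirDeriv v' A) = dirDeriv v' (dirDeriv v A) := by
  have hfderiv : Differentiable ℝ (fderiv ℝ A) :=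
    (hA.fderiv_right (m := 1) le_rfl).differentiable one_ne_zero
  have hsecond (v v' ξ : E) :
      dirDeriv v (dirDeriv v' A) ξ = fderiv ℝ (fderiv ℝ A) ξ v v' := by
    rw [dirDeriv_eq_of_hasFDerivAt (A := dirDeriv v' A)
      ((hfderiv ξ).hasFDerivAt.clm_apply (hasFDerivAt_const v' ξ))]
    simp
  ext ξ
  rw [hsecond, hsecond]
  exact hA.contDiffAt.isSymmSndFDerivAt (by simp) v v'

theorem norm_dirDeriv_dirDeriv_le {v : Plane} (hv : ‖v‖ ≤ 1) (hA : ContDiff ℝ 2 A) (ξ : Plane) :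
    ‖dirDeriv v (dirDeriv v A) ξ‖ ≤ ∑ j, ∑ i, ‖pd i (pd j A) ξ‖ :=
  (norm_dirDeriv_le hv _ ξ).trans (Finset.sum_le_sum fun j _ =>
    (congrArg norm (congrFun (dirDeriv_comm hA _ v) ξ)).trans_le (norm_dirDeriv_le hv (pd j A) ξ))

theorem contDiff_pd (hw : ContDiff ℝ 2 w) (j : Fin 2) : ContDiff ℝ 1 (pd j w) :=
  (hw.fderiv_right (m := 1) le_rfl).clm_apply contDiff_const

theorem pd_map {F' : Type*} [NormedAddCommGroup F'] [InnerProductSpace ℂ F']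
    (L : F →L[ℂ] F') (hw : Differentiable ℝ w) (j : Fin 2) :
    pd j (fun ξ => L (w ξ)) = fun ξ => L (pd j w ξ) := by
  ext ξ
  have hcomp := ((L.restrictScalars ℝ).hasFDerivAt.comp ξ (hw ξ).hasFDerivAt).fderiv
  exact DFunLike.congr_fun hcomp _

theorem jetSum_eq (w : Plane → F) (ξ : Plane) :
    jetSum w ξ = ‖w ξ‖ + (‖pd 1 w ξ‖ + ‖pd 0 w ξ‖)
      + (‖pd 1 (pd 1 w) ξ‖ + ‖pd 0 (pd 1 w) ξ‖ + ‖pd 0 (pd 0 w) ξ‖) := by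
  simp [jetSum, Finset.sum_range_succ, Finset.Nat.antidiagonal_succ]
  ring

theorem jetSum_nonneg (w : Plane → F) (ξ : Plane) : 0 ≤ jetSum w ξ :=
  Finset.sum_nonneg fun _ _ => Finset.sum_nonneg fun _ _ => norm_nonneg _

theorem norm_le_jetSum (w : Plane → F) (ξ : Plane) : ‖w ξ‖ ≤ jetSum w ξ := by
  rw [jetSum_eq, add_assoc]
  exact le_add_of_nonneg_right (by positivity)

theorem norm_dirDeriv_le_jetSum {v : Plane} (hv : ‖v‖ ≤ 1) (A : Plane → ℂ) (ξ : Plane) :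
    ‖dirDeriv v A ξ‖ ≤ jetSum A ξ := by
  refine (norm_dirDeriv_le hv A ξ).trans ?_
  rw [Fin.sum_univ_two, jetSum_eq, add_comm ‖pd 0 A ξ‖, add_right_comm]
  exact le_add_of_nonneg_left (by positivity)

theorem norm_dirDeriv_dirDeriv_le_two_mul_jetSum {v : Plane} (hv : ‖v‖ ≤ 1)
    (hA : ContDiff ℝ 2 A) (ξ : Plane) : ‖dirDeriv v (dirDeriv v A) ξ‖ ≤ 2 * jetSum A ξ := by
  have hcomm : pd 1 (pd 0 A) ξ = pd 0 (pd 1 A) ξ := congrFun (dirDeriv_comm hA _ _) ξ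
  have hsum := norm_dirDeriv_dirDeriv_le hv hA ξ
  simp only [Fin.sum_univ_two, hcomm] at hsum
  rw [jetSum_eq]
  linarith [norm_nonneg (A ξ), norm_nonneg (pd 0 A ξ), norm_nonneg (pd 1 A ξ),
    norm_nonneg (pd 0 (pd 0 A) ξ), norm_nonneg (pd 1 (pd 1 A) ξ)]

theorem jetSum_map_le {L : F →L[ℂ] ℂ} (hL : ‖L‖ ≤ 1) (hw : ContDiff ℝ 2 w) (ξ : Plane) :
    jetSum (fun ξ => L (w ξ)) ξ ≤ jetSum w ξ := by
  have hpd (j : Fin 2) : Differentiable ℝ (pd j w) :=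
    (contDiff_pd hw j).differentiable one_ne_zero
  have hle : ∀ z, ‖L z‖ ≤ ‖z‖ := fun z =>
    (L.le_opNorm z).trans (mul_le_of_le_one_left (norm_nonneg _) hL)
  simp only [jetSum_eq, pd_map L (hw.differentiable two_ne_zero), pd_map L (hpd _)]
  gcongr <;> exact hle _

/-- `w` is a `C²` function whose derivatives of order at most two, summed as in the norm of the
data, are bounded by `D ⟨ξ⟩⁻ᵏ`. -/
structure HasJetSumDecay (k : ℕ) (D : ℝ) (w : Plane → F) : Prop where
  contDiff : ContDiff ℝ 2 w
  bound : ∀ ξ, bracket ξ ^ k * jetSum w ξ ≤ D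

namespace HasJetSumDecay

variable {k : ℕ} {D : ℝ}

theorem jetSum_le (hw : HasJetSumDecay k D w) (ξ : Plane) :
    jetSum w ξ ≤ D * (bracket ξ ^ k)⁻¹ := by
  rw [← div_eq_mul_inv, le_div_iff₀ (pow_pos (bracket_pos ξ) k), mul_comm]
  exact hw.bound ξ

theorem map (hw : HasJetSumDecay k D w) {L : F →L[ℂ] ℂ} (hL : ‖L‖ ≤ 1) :
    HasJetSumDecay k D fun ξ => L (w ξ) where
  contDiff := (L.restrictScalars ℝ).contDiff.comp hw.contDiff
  bound ξ := (mul_le_mul_of_nonneg_left (jetSum_map_le hL hw.contDiff ξ)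
    (pow_nonneg (bracket_pos ξ).le k)).trans (hw.bound ξ)

theorem integrable (hw : HasJetSumDecay k D w) (hk : 2 < k) : Integrable w :=
  ((integrable_inv_bracket_pow (by simpa using hk)).const_mul D).mono'
    hw.contDiff.continuous.aestronglyMeasurable
    (Eventually.of_forall fun ξ => (norm_le_jetSum w ξ).trans (hw.jetSum_le ξ))

theorem hasJetDecay (hA : HasJetSumDecay k D A) : HasJetDecay k (2 * D) A := by
  have hle (ξ : Plane) : 2 * jetSum A ξ ≤ 2 * D * (bracket ξ ^ k)⁻¹ := by
    rw [mul_assoc]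
    exact mul_le_mul_of_nonneg_left (hA.jetSum_le ξ) zero_le_two
  have htwo (ξ : Plane) : jetSum A ξ ≤ 2 * D * (bracket ξ ^ k)⁻¹ :=
    (le_mul_of_one_le_left (jetSum_nonneg A ξ) one_le_two).trans (hle ξ)
  exact fun v hv =>
    { contDiff := hA.contDiff
      bound := fun ξ => (norm_le_jetSum A ξ).trans (htwo ξ)
      bound_dirDeriv := fun ξ => (norm_dirDeriv_le_jetSum hv A ξ).trans (htwo ξ)
      bound_dirDeriv_dirDeriv := fun ξ =>
        (norm_dirDeriv_dirDeriv_le_two_mul_jetSum hv hA.contDiff ξ).trans (hle ξ) }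

end HasJetSumDecay

end Jets

section LinearSolutions

variable {F : Type*} [NormedAddCommGroup F] [InnerProductSpace ℂ F]

theorem integrable_ofReal_smul {σ : Plane → ℝ} {w : Plane → F} (hσ : Continuous σ)
    (hσ_le : ∀ ξ, |σ ξ| ≤ 1) (hw : Integrable w) : Integrable fun ξ => (σ ξ : ℂ) • w ξ :=
  hw.norm.mono' ((Complex.continuous_ofReal.comp hσ).aestronglyMeasurable.smul hw.1)
    (Eventually.of_forall fun ξ => norm_ofReal_smul_le (hσ_le ξ) (w ξ))

theorem multiplier_eq_invHat (σ : Plane → ℝ) (f : Plane → F) :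
    multiplier σ f = invHat fun ξ => (σ ξ : ℂ) • hat f ξ := by
  simp only [multiplier, invHat, hat, smul_smul, inv_mul_cancel₀ Real.two_pi_pos.ne', one_smul]

theorem map_multiplier [CompleteSpace F] (L : F →L[ℂ] ℂ) {σ : Plane → ℝ} {f : Plane → F}
    (hσ : Continuous σ) (hσ_le : ∀ ξ, |σ ξ| ≤ 1) (hf : Integrable (hat f)) (x : Plane) :
    L (multiplier σ f x) = invHat (fun ξ => (σ ξ : ℂ) * L (hat f ξ)) x := by
  rw [multiplier_eq_invHat, map_invHat L (integrable_ofReal_smul hσ hσ_le hf)]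
  simp only [map_smul, smul_eq_mul]

/-- The Fourier transform of the half wave with sign `ε` in the linear solution whose data have
Fourier transforms `a` and `b`. -/
def halfWaveProfile (ε : ℝ) (a b : Plane → ℂ) (ξ : Plane) : ℂ :=
  1 / 2 * a ξ + -(ε * Complex.I) / 2 * ((bracket ξ : ℂ)⁻¹ * b ξ)

theorem cos_mul_add_propagatorSymbol_mul (a b : Plane → ℂ) (t : ℝ) (ξ : Plane) :
    (Real.cos (t * bracket ξ) : ℂ) * a ξ + (propagatorSymbol t ξ : ℂ) * b ξ
      = evolve 1 (halfWaveProfile 1 a b) t ξ + evolve (-1) (halfWaveProfile (-1) a b) t ξ := by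
  simp only [evolve, expI, halfWaveProfile, propagatorSymbol]
  push_cast
  rw [Complex.cos, Complex.sin, one_mul, neg_one_mul, mul_neg]
  ring

theorem HasJetDecay.halfWaveProfile {k : ℕ} {D ε : ℝ} {a b : Plane → ℂ}
    (ha : HasJetDecay (k + 2) D a) (hb : HasJetDecay (k + 2) D b) (hε : ε ^ 2 = 1) :
    HasJetDecay k (100 * D) (halfWaveProfile ε a b) := by
  have hcoeff : ‖-((ε : ℂ) * Complex.I) / 2‖ = 1 / 2 := by
    rw [norm_div, norm_neg, norm_mul, Complex.norm_I, Complex.norm_real, Real.norm_eq_abs,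
      abs_eq_one_of_sq_eq_one hε, mul_one, Complex.norm_ofNat]
  refine (((ha.mono (Nat.le_add_right k 2) le_rfl).const_mul (1 / 2)).add
    (hb.inv_bracket_mul.const_mul (-(ε * Complex.I) / 2))).mono le_rfl ?_
  rw [hcoeff]
  norm_num
  linarith [ha.nonneg]

theorem isWave_linearSol [CompleteSpace F] {f g : Plane → F} {k : ℕ} {D : ℝ}
    (hf : HasJetSumDecay (k + 5) D (hat f)) (hg : HasJetSumDecay (k + 5) D (hat g))
    {L : F →L[ℂ] ℂ} (hL : ‖L‖ ≤ 1) :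
    IsWave (k + 3) (200 * D) fun t x => L (linearSol f g t x) := by
  have hprofile {ε : ℝ} (hε : ε ^ 2 = 1) : HasJetDecay (k + 3) (200 * D)
      (halfWaveProfile ε (fun ξ => L (hat f ξ)) fun ξ => L (hat g ξ)) :=
    ((hf.map hL).hasJetDecay.halfWaveProfile (hg.map hL).hasJetDecay hε).mono le_rfl
      (le_of_eq (by ring))
  have hplus := hprofile (one_pow 2)
  have hminus := hprofile neg_one_sq
  have hcos (t : ℝ) : Continuous fun ξ : Plane => Real.cos (t * bracket ξ) :=
    Real.continuous_cos.comp (continuous_bracket.const_mul t)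
  have hcos_le (t : ℝ) (ξ : Plane) := Real.abs_cos_le_one (t * bracket ξ)
  refine ⟨_, _, hplus, hminus, funext₂ fun t x => ?_⟩
  change L (multiplier _ f x + multiplier (propagatorSymbol t) g x) = _
  rw [map_add, map_multiplier L (hcos t) (hcos_le t) (hf.integrable (by omega)),
    map_multiplier L (continuous_propagatorSymbol t) (abs_propagatorSymbol_le_one t)
      (hg.integrable (by omega)), ← invHat_add, halfWave, halfWave,
    ← invHat_add (integrable_evolve hplus t) (integrable_evolve hminus t)]
  · exact congrArg (invHat · x) (funext (cos_mul_add_propagatorSymbol_mul _ _ t))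
  · exact integrable_ofReal_smul (hcos t) (hcos_le t) (L.integrable_comp (hf.integrable (by omega)))
  · exact integrable_ofReal_smul (continuous_propagatorSymbol t) (abs_propagatorSymbol_le_one t)
      (L.integrable_comp (hg.integrable (by omega)))

end LinearSolutions

section QuadraticExpressions

variable {k n : ℕ} {D : ℝ} {q : ℝ → Plane → ℂ}

/-- `q` is a sum of `n` products of two waves. -/
inductive IsQuadratic (k : ℕ) (D : ℝ) : ℕ → (ℝ → Plane → ℂ) → Prop
  | mul {u v : ℝ → Plane → ℂ} : IsWave k D u → IsWave k D v →
      IsQuadratic k D 1 fun t x => u t x * v t x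
  | add {n n' : ℕ} {q q' : ℝ → Plane → ℂ} : IsQuadratic k D n q → IsQuadratic k D n' q' →
      IsQuadratic k D (n + n') fun t x => q t x + q' t x

namespace IsQuadratic

theorem differentiable (h : IsQuadratic (k + 4) D n q) (t : ℝ) : Differentiable ℝ (q t) := by
  induction h with
  | mul hu hv => exact (hu.differentiable t).mul (hv.differentiable t)
  | add _ _ hq hq' => exact hq.add hq'

theorem pd (h : IsQuadratic (k + 4) D n q) (j : Fin 2) :
    IsQuadratic (k + 3) (16 * D) (2 * n) fun t x => pd j (q t) x := by
  induction h with
  | mul hu hv =>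
    simp only [pd_mul (hu.differentiable _) (hv.differentiable _)]
    have hD : D ≤ 16 * D := by linarith [hu.nonneg]
    exact (IsQuadratic.mul (hu.mono (Nat.le_succ _) hD) (hv.pd j)).add
      (.mul (hv.mono (Nat.le_succ _) hD) (hu.pd j))
  | add hq hq' ih ih' =>
    simp only [pd_add (hq.differentiable _) (hq'.differentiable _), mul_add]
    exact ih.add ih'

theorem exists_hasDerivAt (h : IsQuadratic (k + 4) D n q) :
    ∃ q', IsQuadratic (k + 3) (32 * D) (2 * n) q' ∧
      ∀ t x, HasDerivAt (fun s => q s x) (q' t x) t := by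
  induction h with
  | mul hu hv =>
    have hD : D ≤ 32 * D := by linarith [hu.nonneg]
    obtain ⟨u', hu', hderiv⟩ := hu.exists_hasDerivAt
    obtain ⟨v', hv', hderiv'⟩ := hv.exists_hasDerivAt
    exact ⟨_, (IsQuadratic.mul hu' (hv.mono (Nat.le_succ _) hD)).add
      (.mul (hu.mono (Nat.le_succ _) hD) hv'), fun t x => (hderiv t x).mul (hderiv' t x)⟩
  | add _ _ ih ih' =>
    obtain ⟨q', hq', hderiv⟩ := ih
    obtain ⟨r', hr', hderiv'⟩ := ih'
    rw [mul_add]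
    exact ⟨_, hq'.add hr', fun t x => (hderiv t x).add (hderiv' t x)⟩

theorem exists_isDecayingSource (m : ℕ) : ∃ K, 0 ≤ K ∧
    ∀ {n : ℕ} {q : ℝ → Plane → ℂ} {D : ℝ}, IsQuadratic (m + 18) D n q →
      IsDecayingSource m (n * (K * D ^ 2)) q := by
  obtain ⟨K, hK, hmul⟩ := IsWave.exists_isDecayingSource_mul m
  refine ⟨K, hK, fun {n q D} hq => ?_⟩
  induction hq with
  | mul hu hv => simpa only [Nat.cast_one, one_mul] using hmul hu hv
  | add _ _ ih ih' => simpa only [Nat.cast_add, add_mul] using ih.add ih'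

end IsQuadratic

end QuadraticExpressions

section Components

theorem pd_apply {v : Plane → Vec} (hv : ∀ j, Differentiable ℝ fun x => v x j) (i j : Fin 2)
    (x : Plane) : pd i v x j = pd i (fun y => v y j) x :=
  (congrFun (pd_map (EuclideanSpace.proj j) ((differentiable_piLp 2).2 hv) i) x).symm

theorem hasDerivAt_vec {w : ℝ → Vec} {w' : Fin 2 → ℂ} {t : ℝ}
    (h : ∀ j, HasDerivAt (fun s => w s j) (w' j) t) : HasDerivAt w (WithLp.toLp 2 w') t := by
  have hcomp :=
    (PiLp.hasFDerivAt_toLp (𝕜 := ℝ) 2 fun j => w t j).comp_hasDerivAt t (hasDerivAt_pi.2 h)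
  exact hcomp

theorem IsDecayingSource.vec {m : ℕ} {D : ℝ} {p : ℝ → Plane → Vec}
    (h : ∀ j, IsDecayingSource m D fun s x => p s x j) : IsDecayingSource m (2 * D) p := by
  have hsingle (j : Fin 2) :=
    (h j).map (ContinuousLinearMap.toSpanSingleton ℂ (EuclideanSpace.single j 1 : Vec)) (by simp)
  rw [two_mul]
  convert (hsingle 0).add (hsingle 1) using 3 with s x
  ext i
  fin_cases i <;> simp

end Components

section Nonlinearity

variable {k m : ℕ} {D : ℝ} {u : ℝ → Plane → ℂ} {v : ℝ → Plane → Vec}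

theorem isQuadratic_massFlux (hu : IsWave (k + 4) D u)
    (hv : ∀ j, IsWave (k + 4) D fun t x => v t x j) :
    IsQuadratic (k + 3) (16 * D) 4 fun t x => massFlux (u t) (v t) x := by
  have hD : D ≤ 16 * D := by linarith [hu.nonneg]
  have hu_mono := hu.mono (Nat.le_succ _) hD
  have hv_mono (j : Fin 2) := (hv j).mono (Nat.le_succ _) hD
  simp only [massFlux, advect, divergence, Fin.sum_univ_two, smul_eq_mul, mul_add,
    pd_apply fun j => (hv j).differentiable _]
  exact ((IsQuadratic.mul (hv_mono 0) (hu.pd 0)).add (.mul (hv_mono 1) (hu.pd 1))).add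
    ((IsQuadratic.mul hu_mono ((hv 0).pd 0)).add (.mul hu_mono ((hv 1).pd 1)))

theorem isQuadratic_momentumFlux (hu : IsWave (k + 4) D u)
    (hv : ∀ j, IsWave (k + 4) D fun t x => v t x j) (j : Fin 2) :
    IsQuadratic (k + 3) (16 * D) 3 fun t x => momentumFlux (u t) (v t) x j := by
  have hD : D ≤ 16 * D := by linarith [hu.nonneg]
  have hv_mono (j : Fin 2) := (hv j).mono (Nat.le_succ _) hD
  simp only [momentumFlux, advect, grad, Fin.sum_univ_two, PiLp.add_apply, PiLp.smul_apply,
    smul_eq_mul, pd_apply fun j => (hv j).differentiable _]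
  exact ((IsQuadratic.mul (hv_mono 0) ((hv j).pd 0)).add (.mul (hv_mono 1) ((hv j).pd 1))).add
    (.mul (hu.mono (Nat.le_succ _) hD) (hu.pd j))

theorem exists_isDecayingSource_G₁ (m : ℕ) : ∃ K, 0 ≤ K ∧
    ∀ {D : ℝ} {u : ℝ → Plane → ℂ} {v : ℝ → Plane → Vec}, IsWave (m + 20) D u →
      (∀ j, IsWave (m + 20) D fun t x => v t x j) → IsDecayingSource m (K * D ^ 2) (G₁ u v) := by
  obtain ⟨K, hK, hsource⟩ := IsQuadratic.exists_isDecayingSource m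
  refine ⟨12 * (K * 256 ^ 2) + 8 * (K * 512 ^ 2), by positivity, fun {D u v} hu hv => ?_⟩
  have hmomentum := isQuadratic_momentumFlux hu hv
  obtain ⟨q, hq, hderiv⟩ := (isQuadratic_massFlux hu hv).exists_hasDerivAt
  have hdiv := hsource (((hmomentum 0).pd 0).add ((hmomentum 1).pd 1))
  have hG₁ : G₁ u v = fun s x => pd 0 (fun x => momentumFlux (u s) (v s) x 0) x
      + pd 1 (fun x => momentumFlux (u s) (v s) x 1) x - q s x := by
    ext s x
    rw [G₁, (hderiv s x).deriv, divergence, Fin.sum_univ_two,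
      pd_apply fun j => (hmomentum j).differentiable s,
      pd_apply fun j => (hmomentum j).differentiable s]
  rw [hG₁]
  refine (hdiv.sub (hsource hq)).mono (le_of_eq ?_)
  push_cast
  ring

theorem exists_isDecayingSource_G₂local (m : ℕ) : ∃ K, 0 ≤ K ∧
    ∀ {D : ℝ} {u : ℝ → Plane → ℂ} {v : ℝ → Plane → Vec}, IsWave (m + 20) D u →
      (∀ j, IsWave (m + 20) D fun t x => v t x j) →
        IsDecayingSource m (K * D ^ 2) (G₂local u v) := by
  obtain ⟨K, hK, hsource⟩ := IsQuadratic.exists_isDecayingSource m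
  refine ⟨16 * (K * 256 ^ 2) + 12 * (K * 512 ^ 2), by positivity, fun {D u v} hu hv => ?_⟩
  choose q hq hderiv using fun j => (isQuadratic_momentumFlux hu hv j).exists_hasDerivAt
  have hG₂ (j : Fin 2) (s : ℝ) (x : Plane) :
      G₂local u v s x j = pd j (massFlux (u s) (v s)) x - q j s x := by
    rw [G₂local, (hasDerivAt_vec fun j => hderiv j s x).deriv]
    rfl
  have hcomponent (j : Fin 2) := (hsource ((isQuadratic_massFlux hu hv).pd j)).sub (hsource (hq j))
  simp only [← hG₂] at hcomponent
  refine (IsDecayingSource.vec hcomponent).mono (le_of_eq ?_)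
  push_cast
  ring

theorem exists_isDecayingSource_smul (m : ℕ) : ∃ K, 0 ≤ K ∧
    ∀ {D : ℝ} {u : ℝ → Plane → ℂ} {v : ℝ → Plane → Vec}, IsWave (m + 18) D u →
      (∀ j, IsWave (m + 18) D fun t x => v t x j) →
        IsDecayingSource m (K * D ^ 2) fun s x => u s x • v s x := by
  obtain ⟨K, hK, hmul⟩ := IsWave.exists_isDecayingSource_mul m
  refine ⟨2 * K, by positivity, fun {D u v} hu hv => ?_⟩
  rw [mul_assoc]
  exact .vec fun j => hmul hu (hv j)

end Nonlinearity

section Projection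

/-- The inclusion of the real frequency plane in `ℂ²`. -/
def complexify (ξ : Plane) : Vec := WithLp.toLp 2 fun j => ((ξ j : ℝ) : ℂ)

theorem norm_complexify (ξ : Plane) : ‖complexify ξ‖ = ‖ξ‖ := by
  simp [complexify, EuclideanSpace.norm_eq]

theorem continuous_complexify : Continuous complexify := by
  unfold complexify
  fun_prop

/-- The orthogonal projection on the line spanned by `ξ`, the symbol of `∇Δ⁻¹∇·`. -/
def projSymbol (ξ : Plane) : Vec →L[ℂ] Vec :=
  (((‖ξ‖ ^ 2)⁻¹ : ℝ) : ℂ) • InnerProductSpace.rankOne ℂ (complexify ξ) (complexify ξ)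

theorem norm_projSymbol_le (ξ : Plane) : ‖projSymbol ξ‖ ≤ 1 := by
  rw [projSymbol, norm_smul, InnerProductSpace.norm_rankOne, norm_complexify, Complex.norm_real,
    Real.norm_of_nonneg (by positivity), ← sq]
  exact inv_mul_le_one

theorem stronglyMeasurable_projSymbol : StronglyMeasurable projSymbol := by
  have hscalar : Measurable fun ξ : Plane => (((‖ξ‖ ^ 2)⁻¹ : ℝ) : ℂ) := by fun_prop
  have hrankOne : Continuous fun ξ : Plane =>
      InnerProductSpace.rankOne ℂ (complexify ξ) (complexify ξ) := by
    refine continuous_clm_apply.2 fun z => ?_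
    simp only [InnerProductSpace.rankOne_apply]
    exact (continuous_complexify.inner (𝕜 := ℂ) continuous_const).smul continuous_complexify
  exact hscalar.stronglyMeasurable.smul hrankOne.stronglyMeasurable

theorem gradInvLapDiv_eq : gradInvLapDiv = l2Multiplier fun ξ v => projSymbol ξ v := by
  unfold gradInvLapDiv
  congr 1
  ext ξ v j
  simp only [projSymbol, complexify, smul_apply, InnerProductSpace.rankOne_apply, PiLp.smul_apply,
    smul_eq_mul, PiLp.inner_apply, RCLike.inner_apply, Complex.conj_ofReal, Fin.sum_univ_two]
  push_cast
  linear_combination (-(ξ j : ℂ) * (ξ 0 * v 0 + ξ 1 * v 1) * ((‖ξ‖ : ℂ) ^ 2)⁻¹) * Complex.I_mul_I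

end Projection

section DuhamelFromInfinity

variable {F : Type*} [NormedAddCommGroup F] [InnerProductSpace ℂ F] [CompleteSpace F]
variable {m : ℕ} {D : ℝ} {G : ℝ → Lp F 2 (volume : Measure Plane)}

namespace HasDecayingSolution

theorem intervalIntegrable (h : HasDecayingSolution m D G) (T t : ℝ) :
    IntervalIntegrable (fun s => propagator (t - s) (G s)) volume T t := by
  obtain ⟨g, Q, Q', hQ, hG⟩ := h
  obtain rfl : G = fun s => l2InvHat (g s) := funext hG
  exact (hQ.continuous_propagator t).intervalIntegrable T t

theorem tendsto_duhamel (h : HasDecayingSolution m D G) (t : ℝ) :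
    Tendsto (fun T : ℝ => duhamel G T t) atTop (𝓝 (duhamelInfty G t)) := by
  obtain ⟨g, Q, Q', hQ, hG⟩ := h
  obtain rfl : G = fun s => l2InvHat (g s) := funext hG
  rw [hQ.duhamelInfty_eq]
  exact hQ.tendsto_duhamel t

theorem differentiable_duhamelInfty (h : HasDecayingSolution m D G) :
    Differentiable ℝ (duhamelInfty G) := by
  obtain ⟨g, Q, Q', hQ, hG⟩ := h
  obtain rfl : G = fun s => l2InvHat (g s) := funext hG
  rw [hQ.duhamelInfty_eq]
  exact fun t => (hQ.hasDerivAt_l2InvHat t).differentiableAt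

theorem sobolevNorm_duhamelInfty_le (h : HasDecayingSolution m D G) (t : ℝ) :
    ENNReal.ofReal (bracket t) * (sobolevNorm (m + 2) (duhamelInfty G t)
      + sobolevNorm (m + 2) (deriv (duhamelInfty G) t)) ≤ ENNReal.ofReal D * (4 * bracketMass) := by
  obtain ⟨g, Q, Q', hQ, hG⟩ := h
  obtain rfl : G = fun s => l2InvHat (g s) := funext hG
  exact hQ.sobolevNorm_duhamelInfty_le t

end HasDecayingSolution

end DuhamelFromInfinity

theorem exists_hasDecayingSolution (m : ℕ) : ∃ K, 0 ≤ K ∧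
    ∀ {D : ℝ} {u : ℝ → Plane → ℂ} {v : ℝ → Plane → Vec}, IsWave (m + 20) D u →
      (∀ j, IsWave (m + 20) D fun t x => v t x j) →
        (∀ s, MemLp (G₁ u v s) 2 volume ∧ MemLp (G₂local u v s) 2 volume ∧
          MemLp (fun x => u s x • v s x) 2 volume) ∧
        HasDecayingSolution m (K * D ^ 2) (G₁L2 u v) ∧
        HasDecayingSolution m (K * D ^ 2) (G₂L2 u v) := by
  obtain ⟨K₁, hK₁, hsource₁⟩ := exists_isDecayingSource_G₁ m
  obtain ⟨K₂, hK₂, hsource₂⟩ := exists_isDecayingSource_G₂local m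
  obtain ⟨K₃, hK₃, hsource₃⟩ := exists_isDecayingSource_smul m
  refine ⟨K₁ + (K₂ + K₃), by positivity, fun {D u v} hu hv => ?_⟩
  have h₁ := hsource₁ hu hv
  have h₂ := hsource₂ hu hv
  have h₃ := hsource₃ (hu.mono (by omega) le_rfl) fun j => (hv j).mono (by omega) le_rfl
  have hproj := h₃.hasDecayingSolution.l2Multiplier projSymbol stronglyMeasurable_projSymbol
    norm_projSymbol_le
  rw [← gradInvLapDiv_eq] at hproj
  exact ⟨fun s => ⟨h₁.memLp s, h₂.memLp s, h₃.memLp s⟩,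
    h₁.hasDecayingSolution.mono
      (mul_le_mul_of_nonneg_right (le_add_of_nonneg_right (by positivity)) (sq_nonneg D)),
    (h₂.hasDecayingSolution.sub hproj).mono ((add_mul K₂ K₃ _).symm.trans_le
      (mul_le_mul_of_nonneg_right (le_add_of_nonneg_left hK₁) (sq_nonneg D)))⟩

section Data

variable {m : ℕ} {f₁ g₁ : Plane → ℂ} {f₂ g₂ : Plane → Vec}

theorem bracket_pow_mul_jetSum_le_toReal_dataNorm (hN : dataNorm m f₁ g₁ f₂ g₂ < ∞) (ξ : Plane) :
    bracket ξ ^ (m + 24) * (jetSum (hat f₁) ξ + jetSum (hat f₂) ξ + jetSum (hat g₁) ξ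
      + jetSum (hat g₂) ξ) ≤ (dataNorm m f₁ g₁ f₂ g₂).toReal := by
  rw [← ENNReal.ofReal_le_iff_le_toReal hN.ne, dataNorm]
  exact le_iSup (fun ξ : Plane => ENNReal.ofReal (bracket ξ ^ (m + 24) *
    (jetSum (hat f₁) ξ + jetSum (hat f₂) ξ + jetSum (hat g₁) ξ + jetSum (hat g₂) ξ))) ξ

theorem isWave_linearSol_of_dataNorm_lt_top (hf₁ : ContDiff ℝ 2 (hat f₁))
    (hg₁ : ContDiff ℝ 2 (hat g₁)) (hf₂ : ContDiff ℝ 2 (hat f₂)) (hg₂ : ContDiff ℝ 2 (hat g₂))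
    (hN : dataNorm m f₁ g₁ f₂ g₂ < ∞) :
    IsWave (m + 20) (200 * (dataNorm m f₁ g₁ f₂ g₂).toReal) (linearSol f₁ g₁) ∧
    ∀ j, IsWave (m + 20) (200 * (dataNorm m f₁ g₁ f₂ g₂).toReal)
      fun t x => linearSol f₂ g₂ t x j := by
  have hdecay {F : Type} [NormedAddCommGroup F] [InnerProductSpace ℂ F] {w : Plane → F}
      (hw : ContDiff ℝ 2 w) (hle : ∀ ξ, jetSum w ξ ≤ jetSum (hat f₁) ξ + jetSum (hat f₂) ξ
        + jetSum (hat g₁) ξ + jetSum (hat g₂) ξ) :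
      HasJetSumDecay (m + 24) (dataNorm m f₁ g₁ f₂ g₂).toReal w :=
    ⟨hw, fun ξ => (mul_le_mul_of_nonneg_left (hle ξ) (pow_nonneg (bracket_pos ξ).le _)).trans
      (bracket_pow_mul_jetSum_le_toReal_dataNorm hN ξ)⟩
  have hnonneg₁ := jetSum_nonneg (hat f₁)
  have hnonneg₂ := jetSum_nonneg (hat g₁)
  have hnonneg₃ := jetSum_nonneg (hat f₂)
  have hnonneg₄ := jetSum_nonneg (hat g₂)
  have hwave₁ := isWave_linearSol (k := m + 19)
    (hdecay hf₁ fun ξ => by linarith [hnonneg₂ ξ, hnonneg₃ ξ, hnonneg₄ ξ])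
    (hdecay hg₁ fun ξ => by linarith [hnonneg₁ ξ, hnonneg₃ ξ, hnonneg₄ ξ])
    (L := ContinuousLinearMap.id ℂ ℂ) ContinuousLinearMap.norm_id_le
  have hwave₂ (j : Fin 2) := isWave_linearSol (k := m + 19)
    (hdecay hf₂ fun ξ => by linarith [hnonneg₁ ξ, hnonneg₂ ξ, hnonneg₄ ξ])
    (hdecay hg₂ fun ξ => by linarith [hnonneg₁ ξ, hnonneg₂ ξ, hnonneg₃ ξ])
    (L := EuclideanSpace.proj j) (norm_proj_le j)
  exact ⟨hwave₁.mono (by omega) le_rfl, fun j => (hwave₂ j).mono (by omega) le_rfl⟩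

theorem ofReal_mul_sq_mul {K : ℝ} (hK : 0 ≤ K) {N M : ℝ≥0∞} (hN : N < ∞) (hM : M < ∞) :
    ENNReal.ofReal (K * N.toReal ^ 2) * M = (K.toNNReal * M.toNNReal : ℝ≥0) * N ^ 2 := by
  rw [ENNReal.ofReal_mul hK, ENNReal.ofReal_pow ENNReal.toReal_nonneg, ENNReal.ofReal_toReal hN.ne,
    ENNReal.coe_mul, ENNReal.coe_toNNReal hM.ne, mul_right_comm]
  rfl

end Data

end EulerPoisson

end

theorem mainTheorem2 (m : ℕ) :
    ∃ C : ℝ≥0, ∀ (f₁ g₁ : Plane → ℂ) (f₂ g₂ : Plane → Vec),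
      Integrable f₁ → Integrable g₁ → Integrable f₂ → Integrable g₂ →
      ContDiff ℝ 2 (hat f₁) → ContDiff ℝ 2 (hat g₁) →
      ContDiff ℝ 2 (hat f₂) → ContDiff ℝ 2 (hat g₂) →
      dataNorm m f₁ g₁ f₂ g₂ < ∞ →
      -- the sources are square integrable and the Duhamel integrals are genuine integrals
      (∀ s, MemLp (G₁ (linearSol f₁ g₁) (linearSol f₂ g₂) s) 2 volume ∧
        MemLp (G₂local (linearSol f₁ g₁) (linearSol f₂ g₂) s) 2 volume ∧
        MemLp (fun x => linearSol f₁ g₁ s x • linearSol f₂ g₂ s x) 2 volume) ∧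
      (∀ T t : ℝ,
        IntervalIntegrable
          (fun s => propagator (t - s) (G₁L2 (linearSol f₁ g₁) (linearSol f₂ g₂) s)) volume T t ∧
        IntervalIntegrable
          (fun s => propagator (t - s) (G₂L2 (linearSol f₁ g₁) (linearSol f₂ g₂) s)) volume T t) ∧
      -- they converge in `L²` as the starting time goes to infinity
      (∀ t : ℝ,
        Tendsto (fun T : ℝ => duhamel (G₁L2 (linearSol f₁ g₁) (linearSol f₂ g₂)) T t) atTop
          (𝓝 (Φ₁ f₁ g₁ f₂ g₂ t)) ∧
        Tendsto (fun T : ℝ => duhamel (G₂L2 (linearSol f₁ g₁) (linearSol f₂ g₂)) T t) atTop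
          (𝓝 (Φ₂ f₁ g₁ f₂ g₂ t))) ∧
      -- the limits are differentiable in time and satisfy the estimate
      Differentiable ℝ (Φ₁ f₁ g₁ f₂ g₂) ∧ Differentiable ℝ (Φ₂ f₁ g₁ f₂ g₂) ∧
      (∀ t : ℝ,
        ENNReal.ofReal (bracket t) * (sobolevNorm (m + 2) (Φ₁ f₁ g₁ f₂ g₂ t)
            + sobolevNorm (m + 2) (deriv (Φ₁ f₁ g₁ f₂ g₂) t))
          ≤ C * dataNorm m f₁ g₁ f₂ g₂ ^ 2) ∧
      (∀ t : ℝ,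
        ENNReal.ofReal (bracket t) * (sobolevNorm (m + 2) (Φ₂ f₁ g₁ f₂ g₂ t)
            + sobolevNorm (m + 2) (deriv (Φ₂ f₁ g₁ f₂ g₂) t))
          ≤ C * dataNorm m f₁ g₁ f₂ g₂ ^ 2) := by
  obtain ⟨K, hK, hsol⟩ := exists_hasDecayingSolution m
  have hmass : 4 * bracketMass < ∞ := ENNReal.mul_lt_top ENNReal.ofNat_lt_top bracketMass_lt_top
  refine ⟨(K * 200 ^ 2).toNNReal * (4 * bracketMass).toNNReal, ?_⟩
  intro f₁ g₁ f₂ g₂ _ _ _ _ hf₁ hg₁ hf₂ hg₂ hN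
  obtain ⟨hwave₁, hwave₂⟩ := isWave_linearSol_of_dataNorm_lt_top hf₁ hg₁ hf₂ hg₂ hN
  obtain ⟨hmem, h₁, h₂⟩ := hsol hwave₁ hwave₂
  rw [mul_pow, ← mul_assoc] at h₁ h₂
  have hconst := ofReal_mul_sq_mul (K := K * 200 ^ 2) (by positivity) hN hmass
  exact ⟨hmem, fun T t => ⟨h₁.intervalIntegrable T t, h₂.intervalIntegrable T t⟩,
    fun t => ⟨h₁.tendsto_duhamel t, h₂.tendsto_duhamel t⟩,
    h₁.differentiable_duhamelInfty, h₂.differentiable_duhamelInfty,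
    fun t => (h₁.sobolevNorm_duhamelInfty_le t).trans_eq hconst,
    fun t => (h₂.sobolevNorm_duhamelInfty_le t).trans_eq hconst⟩
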